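/- Let $H>0$, $L>0$ and $a\in\mathbb{R}$ with $|a|<1$. Let $$\mathcal{A}^1(a)=\{u\in H^1((-H,H);\mathbb{R}^2):\ u(\pm H)=(\pm\sqrt{1-a^2},\,a)\},$$ and, for $\varepsilon>0$ and $u=(u_1,u_2)\in\mathcal{A}^1(a)$, let $$E^{1D}_\varepsilon(u)=\frac12\int_{-H}^{H}\varepsilon|u'|^2+\frac1\varepsilon(|u|^2-1)^2+L(u_2')^2\,dy .$$ Let $\mathcal{A}^0$ be the class of all $u=(u_1,u_2):(-H,H)\to\mathbb{R}^2$ with $u_1^3\in BV((-H,H))$, $u_2\in H^1((-H,H))$, $u_2(\pm H)=a$ and $|u|=1$ a.e. in $(-H,H)$. For $u\in\mathcal{A}^0$ let $$E^{1D}_0(u)=\frac L2\int_{-H}^{H}(u_2')^2\,dy+\frac43\sum_{y\in J_{u_1}}\bigl(1-u_2(y)^2\bigr)^{3/2}+\frac16\bigl|u_1(-H)+\sqrt{1-a^2}\bigr|^3+\frac16\bigl|u_1(H)-\sqrt{1-a^2}\bigr|^3 ,$$ where $J_{u_1}\subset(-H,H)$ is the jump set of $u_1$, $u_1(\pm H)$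 are the one-sided traces of $u_1$ at $\pm H$, and pointwise values of $u_2$ are those of its continuous representative. Write $u_\varepsilon\stackrel{\wedge}{\rightharpoonup}u$ if $u_\varepsilon\to u$ strongly in $L^2((-H,H);\mathbb{R}^2)$ and $u_\varepsilon\rightharpoonup u$ weakly in $H_{\mathrm{div}}$, where the divergence of a field depending only on $y$ is the derivative of its second component; the latter means that $u_\varepsilon\rightharpoonup u$ and $u_{\varepsilon,2}'\rightharpoonup u_2'$ weakly in $L^2$. Let $u\in\mathcal{A}^0$. Then: 1. For any sequence $\varepsilon\to0^+$ and any $u_\varepsilon\in\mathcal{A}^1(a)$ with $u_\varepsilon\stackrel{\wedge}{\rightharpoonup}u$, $$\liminf_{\varepsilon\to0}E^{1D}_\varepsilon(u_\varepsilon)\ \ge\ E^{1D}_0(u).$$ 2. There exist $w_\varepsilon\in\mathcal{A}^1(a)$ ($\varepsilon>0$) with $w_\varepsilon\stackrel{\wedge}{\rightharpoonup}u$ as $\varepsilon\to0$ and $$\lim_{\varepsilon\to0}E^{1D}_\varepsilon(w_\varepsilon)=E^{1D}_0(u).$$ -/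

import Mathlib

open MeasureTheory Filter Topology Set
open scoped ENNReal ContDiff

noncomputable section

namespace OneDWall

/-- Lebesgue measure on the open interval `(-H, H)`. -/
def intervalMeasure (H : ℝ) : Measure ℝ := volume.restrict (Ioo (-H) H)

/-- `g` is a weak (distributional) derivative of `v` on `(-H, H)`: integration by parts holds
against every smooth test function with compact support in `(-H, H)`. -/
def IsWeakDeriv (H : ℝ) (v g : ℝ → ℝ) : Prop :=
  ∀ φ : ℝ → ℝ, ContDiff ℝ ∞ φ → HasCompactSupport φ → tsupport φ ⊆ Ioo (-H) H →
    ∫ y, v y * deriv φ y ∂(intervalMeasure H) = -∫ y, g y * φ y ∂(intervalMeasure H)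

/-- The Sobolev space `H¹((-H, H))`: `v ∈ L²` with a weak derivative in `L²`. -/
def MemH1 (H : ℝ) (v : ℝ → ℝ) : Prop :=
  MemLp v 2 (intervalMeasure H) ∧ ∃ g : ℝ → ℝ, MemLp g 2 (intervalMeasure H) ∧ IsWeakDeriv H v g

open scoped Classical in
/-- The weak derivative `v'` of `v ∈ H¹((-H, H))` (determined up to null sets). -/
def weakDeriv (H : ℝ) (v : ℝ → ℝ) : ℝ → ℝ :=
  if h : MemH1 H v then h.2.choose else 0

open scoped Classical in
/-- The representative of `v ∈ H¹((-H, H))` that is continuous on `[-H, H]`. Pointwise values of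
an `H¹` function on `[-H, H]` (including the boundary values) are those of this representative,
which is uniquely determined on `[-H, H]`. -/
def contRep (H : ℝ) (v : ℝ → ℝ) : ℝ → ℝ :=
  if h : ∃ w : ℝ → ℝ, ContinuousOn w (Icc (-H) H) ∧ w =ᵐ[intervalMeasure H] v then h.choose else v

/-- `v ∈ BV((-H, H))`: `v ∈ L¹` and its total variation
`sup {∫ v φ' : φ ∈ C¹_c((-H, H)), |φ| ≤ 1}` is finite. -/
def MemBV (H : ℝ) (v : ℝ → ℝ) : Prop :=
  Integrable v (intervalMeasure H) ∧
    ∃ C : ℝ, ∀ φ : ℝ → ℝ, ContDiff ℝ 1 φ → HasCompactSupport φ → tsupport φ ⊆ Ioo (-H) H →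
      (∀ y, |φ y| ≤ 1) → ∫ y, v y * deriv φ y ∂(intervalMeasure H) ≤ C

/-- `c` is the trace of `v` at `x` from the right: `r⁻¹ ∫_x^{x+r} |v - c| → 0` as `r → 0⁺`. -/
def HasRightTrace (v : ℝ → ℝ) (x c : ℝ) : Prop :=
  Tendsto (fun r : ℝ => (∫⁻ y in Ioo x (x + r), ENNReal.ofReal |v y - c|) / ENNReal.ofReal r)
    (𝓝[>] 0) (𝓝 0)

/-- `c` is the trace of `v` at `x` from the left: `r⁻¹ ∫_{x-r}^x |v - c| → 0` as `r → 0⁺`. -/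
def HasLeftTrace (v : ℝ → ℝ) (x c : ℝ) : Prop :=
  Tendsto (fun r : ℝ => (∫⁻ y in Ioo (x - r) x, ENNReal.ofReal |v y - c|) / ENNReal.ofReal r)
    (𝓝[>] 0) (𝓝 0)

open scoped Classical in
/-- The trace from the right (unique if it exists; `0` by convention if it does not). -/
def rightTrace (v : ℝ → ℝ) (x : ℝ) : ℝ :=
  if h : ∃ c, HasRightTrace v x c then h.choose else 0

open scoped Classical in
/-- The trace from the left (unique if it exists; `0` by convention if it does not). -/
def leftTrace (v : ℝ → ℝ) (x : ℝ) : ℝ :=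
  if h : ∃ c, HasLeftTrace v x c then h.choose else 0

/-- The jump set of `v` in `(-H, H)`: the points with two different one-sided traces. -/
def jumpSet (H : ℝ) (v : ℝ → ℝ) : Set ℝ :=
  {x | x ∈ Ioo (-H) H ∧ ∃ cl cr : ℝ, cl ≠ cr ∧ HasLeftTrace v x cl ∧ HasRightTrace v x cr}

/-- The admissible class `𝒜¹(a)`: vector fields `u = (u₁, u₂) ∈ H¹((-H, H); ℝ²)` with
`u(±H) = (±√(1 - a²), a)`. -/
def MemA1 (H a : ℝ) (u : ℝ → ℝ × ℝ) : Prop :=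
  MemH1 H (fun y => (u y).1) ∧ MemH1 H (fun y => (u y).2) ∧
    contRep H (fun y => (u y).1) (-H) = -√(1 - a ^ 2) ∧
    contRep H (fun y => (u y).2) (-H) = a ∧
    contRep H (fun y => (u y).1) H = √(1 - a ^ 2) ∧
    contRep H (fun y => (u y).2) H = a

/-- The limiting class `𝒜⁰`: `u₁³ ∈ BV((-H, H))`, `u₂ ∈ H¹((-H, H))`, `u₂(±H) = a`, and
`|u| = 1` almost everywhere in `(-H, H)`. -/
def MemA0 (H a : ℝ) (u : ℝ → ℝ × ℝ) : Prop :=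
  MemBV H (fun y => (u y).1 ^ 3) ∧ MemH1 H (fun y => (u y).2) ∧
    contRep H (fun y => (u y).2) (-H) = a ∧ contRep H (fun y => (u y).2) H = a ∧
    ∀ᵐ y ∂(intervalMeasure H), (u y).1 ^ 2 + (u y).2 ^ 2 = 1

/-- The energy
`E_ε(u) = ½ ∫_{-H}^{H} ε |u'|² + ε⁻¹ (|u|² - 1)² + L (u₂')² dy`. -/
def energyEps (H L ε : ℝ) (u : ℝ → ℝ × ℝ) : ℝ≥0∞ :=
  (1 / 2) * ∫⁻ y, ENNReal.ofReal
    (ε * (weakDeriv H (fun z => (u z).1) y ^ 2 + weakDeriv H (fun z => (u z).2) y ^ 2)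
      + (1 / ε) * ((u y).1 ^ 2 + (u y).2 ^ 2 - 1) ^ 2
      + L * weakDeriv H (fun z => (u z).2) y ^ 2) ∂(intervalMeasure H)

/-- The limiting energy
`E₀(u) = (L/2) ∫_{-H}^{H} (u₂')² dy + (4/3) ∑_{y ∈ J_{u₁}} (1 - u₂(y)²)^{3/2}
  + (1/6) |u₁(-H) + √(1 - a²)|³ + (1/6) |u₁(H) - √(1 - a²)|³`. -/
def energyZero (H L a : ℝ) (u : ℝ → ℝ × ℝ) : ℝ≥0∞ :=
  ENNReal.ofReal (L / 2)
      * ∫⁻ y, ENNReal.ofReal (weakDeriv H (fun z => (u z).2) y ^ 2) ∂(intervalMeasure H)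
    + ENNReal.ofReal (4 / 3)
      * ∑' y : jumpSet H (fun z => (u z).1),
          ENNReal.ofReal ((1 - contRep H (fun z => (u z).2) (y : ℝ) ^ 2) ^ (3 / 2 : ℝ))
    + ENNReal.ofReal
        ((1 / 6) * |rightTrace (fun z => (u z).1) (-H) + √(1 - a ^ 2)| ^ 3)
    + ENNReal.ofReal
        ((1 / 6) * |leftTrace (fun z => (u z).1) H - √(1 - a ^ 2)| ^ 3)

/-- Weak convergence in `L²((-H, H))`. -/
def WeakL2Tendsto {ι : Type*} (H : ℝ) (l : Filter ι) (v : ι → ℝ → ℝ) (w : ℝ → ℝ) : Prop :=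
  ∀ ψ : ℝ → ℝ, MemLp ψ 2 (intervalMeasure H) →
    Tendsto (fun i => ∫ y, v i y * ψ y ∂(intervalMeasure H)) l
      (𝓝 (∫ y, w y * ψ y ∂(intervalMeasure H)))

/-- Strong convergence in `L²((-H, H))`. -/
def StrongL2Tendsto {ι : Type*} (H : ℝ) (l : Filter ι) (v : ι → ℝ → ℝ) (w : ℝ → ℝ) : Prop :=
  Tendsto (fun i => eLpNorm (fun y => v i y - w y) 2 (intervalMeasure H)) l (𝓝 0)

/-- Convergence of `v i` to `u` strongly in `L²` and weakly in `H_div`. For fields that depend on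
`y` only the divergence is the derivative of the second component, and weak convergence in `H_div`
is weak `L²` convergence of the field together with its divergence. -/
def HatTendsto {ι : Type*} (H : ℝ) (l : Filter ι) (v : ι → ℝ → ℝ × ℝ) (u : ℝ → ℝ × ℝ) : Prop :=
  (WeakL2Tendsto H l (fun i y => (v i y).1) (fun y => (u y).1) ∧
    WeakL2Tendsto H l (fun i y => (v i y).2) (fun y => (u y).2) ∧
    WeakL2Tendsto H l (fun i => weakDeriv H (fun y => (v i y).2))
      (weakDeriv H (fun y => (u y).2))) ∧
  (StrongL2Tendsto H l (fun i y => (v i y).1) (fun y => (u y).1) ∧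
    StrongL2Tendsto H l (fun i y => (v i y).2) (fun y => (u y).2))

end OneDWall

end

/-! The argument is of Modica–Mortola type. Put c(x) = √(1 - u₂(x)²). The term L(u₂')² bounds the
second components in H¹, so they are equicontinuous, and near a point x the first component w₁ sees
an almost frozen double well with minima ±c(x). By Young's inequality the rest of the density is at
least |1 - w₂² - w₁²| |w₁'|, and a passage of w₁ between -c and c costs ∫_{-c}^{c} (c² - s²) ds =
4c³/3. Since |u| = 1, every trace of u₁ at x is ±c(x). Hence a jump always joins -c to c, and each
boundary term is either 0 or (2c)³/6 = 4c³/3, the cost of a wall sitting at the boundary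
(`LimitField.energyZero_eq`).

Structure of the limit: u₁³ ∈ BV has one-sided limits along a set of full measure. They pass to u₁
through u₁ = u₁³ / (1 - u₂²) where u₂² ≠ 1, while u₁ → 0 where u₂² → 1 (`exists_regulated`).

Lower bound (`energyZero_le_liminf`): finitely many walls have disjoint windows, L¹ convergence
forces a transition in each (`le_lintegral_wallDensity`, `ConvergingFields.sum_wall_le`), and the
L-term is weakly lower semicontinuous. The supremum over finite sets of walls gives the full sum.
The statement is for arbitrary filters, so it covers both sequences and the family ε → 0⁺.

Upper bound (`exists_recovery_family`): jumps can accumulate only where u₂² reaches 1. Replacing u₂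
by `stretch δ u₂`, which equals ±1 wherever u₂ is close to ±1, removes u₁ there; finitely many walls
remain, none is made more expensive, and boundary walls are moved slightly inside
(`LimitField.exists_finite_transitions`). For finitely many walls the second component is kept
fixed. The first is a sign times a Lipschitz regularisation of √(1 - u₂²), cut down to zero at each
wall by an optimal tanh profile (`exists_transition_field`, `eventually_exists_recovery`). Choosing
near-minimisers of excess energy plus squared distances to the limit then gives one family
(`exists_tendsto_zero_of_eventually`). -/

noncomputable section

namespace OneDWall

/-! ### Sobolev functions on an interval and their absolutely continuous representatives. -/

section

variable {H : ℝ}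

instance (H : ℝ) : IsFiniteMeasure (intervalMeasure H) := by
  unfold intervalMeasure; infer_instance

lemma integral_intervalMeasure (hH : 0 < H) (f : ℝ → ℝ) :
    ∫ y, f y ∂(intervalMeasure H) = ∫ y in (-H)..H, f y := by
  rw [intervalIntegral.integral_of_le (by linarith), integral_Ioc_eq_integral_Ioo]; rfl

lemma intervalIntegrable_of_integrable (hH : 0 < H) {f : ℝ → ℝ}
    (hf : Integrable f (intervalMeasure H)) : IntervalIntegrable f volume (-H) H := by
  rw [intervalIntegrable_iff_integrableOn_Ioo_of_le (by linarith)]; exact hf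

lemma intervalIntegrable_of_mem (hH : 0 < H) {f : ℝ → ℝ}
    (hf : Integrable f (intervalMeasure H)) {x y : ℝ} (hx : x ∈ Icc (-H) H)
    (hy : y ∈ Icc (-H) H) : IntervalIntegrable f volume x y := by
  apply (intervalIntegrable_of_integrable hH hf).mono_set
  rw [uIcc_of_le (by linarith : -H ≤ H)]
  exact uIcc_subset_Icc hx hy

lemma integrable_of_memLp_two {f : ℝ → ℝ} (hf : MemLp f 2 (intervalMeasure H)) :
    Integrable f (intervalMeasure H) := hf.integrable (by norm_num)

lemma ae_intervalMeasure {p : ℝ → Prop} (h : ∀ᵐ x, x ∈ Ioo (-H) H → p x) :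
    ∀ᵐ x ∂(intervalMeasure H), p x := by
  rw [intervalMeasure, ae_restrict_iff' measurableSet_Ioo]; exact h

lemma IsWeakDeriv.congr {v w g h : ℝ → ℝ} (hv : IsWeakDeriv H v g)
    (hvw : v =ᵐ[intervalMeasure H] w) (hgh : g =ᵐ[intervalMeasure H] h) : IsWeakDeriv H w h := by
  intro φ h1 h2 h3
  have := hv φ h1 h2 h3
  have e1 : ∫ y, v y * deriv φ y ∂(intervalMeasure H) = ∫ y, w y * deriv φ y ∂(intervalMeasure H) :=
    integral_congr_ae (hvw.mono fun y hy => by simp only [hy])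
  have e2 : ∫ y, g y * φ y ∂(intervalMeasure H) = ∫ y, h y * φ y ∂(intervalMeasure H) :=
    integral_congr_ae (hgh.mono fun y hy => by simp only [hy])
  rwa [e1, e2] at this

lemma integral_mul_test {φ f : ℝ → ℝ} (hφ : tsupport φ ⊆ Ioo (-H) H) :
    ∫ x, φ x • f x = ∫ x, f x * φ x ∂(intervalMeasure H) := by
  rw [intervalMeasure, setIntegral_eq_integral_of_forall_compl_eq_zero]
  · simp [mul_comm]
  · intro x hx
    have : φ x = 0 := by
      by_contra h
      exact hx (hφ (subset_tsupport _ h))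
    simp [this]

lemma integrable_mul_test {φ f : ℝ → ℝ} (hf : Integrable f (intervalMeasure H))
    (h1 : Continuous φ) (h2 : HasCompactSupport φ) :
    Integrable (fun y => f y * φ y) (intervalMeasure H) := by
  obtain ⟨C, hC⟩ := h2.exists_bound_of_continuous h1
  exact hf.mul_bdd h1.aestronglyMeasurable (Eventually.of_forall hC)

/-- The fundamental lemma of the calculus of variations on `(-H, H)`. -/
lemma ae_eq_of_integral_mul_test {f g : ℝ → ℝ} (hf : Integrable f (intervalMeasure H))
    (hg : Integrable g (intervalMeasure H))
    (h : ∀ φ : ℝ → ℝ, ContDiff ℝ ∞ φ → HasCompactSupport φ → tsupport φ ⊆ Ioo (-H) H →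
      ∫ y, f y * φ y ∂(intervalMeasure H) = ∫ y, g y * φ y ∂(intervalMeasure H)) :
    f =ᵐ[intervalMeasure H] g := by
  have key := isOpen_Ioo.ae_eq_zero_of_integral_contDiff_smul_eq_zero (μ := volume)
    (U := Ioo (-H) H) (f := fun y => f y - g y)
    (IntegrableOn.locallyIntegrableOn (hf.sub hg)) (by
      intro φ h1 h2 h3
      rw [integral_mul_test h3]
      simp only [sub_mul]
      rw [integral_sub (integrable_mul_test hf h1.continuous h2)
        (integrable_mul_test hg h1.continuous h2), h φ h1 h2 h3, sub_self])
  filter_upwards [ae_intervalMeasure key] with y hy using sub_eq_zero.1 hy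

lemma IsWeakDeriv.unique {v g h : ℝ → ℝ} (hg : IsWeakDeriv H v g) (hh : IsWeakDeriv H v h)
    (hgi : Integrable g (intervalMeasure H)) (hhi : Integrable h (intervalMeasure H)) :
    g =ᵐ[intervalMeasure H] h := by
  refine ae_eq_of_integral_mul_test hgi hhi fun φ h1 h2 h3 => ?_
  have := hg φ h1 h2 h3
  rw [hh φ h1 h2 h3] at this
  linarith

lemma exists_Icc_of_compact_subset (hH : 0 < H) {K : Set ℝ} (hK : IsCompact K)
    (hKH : K ⊆ Ioo (-H) H) : ∃ b, 0 < b ∧ b < H ∧ K ⊆ Icc (-b) b := by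
  rcases K.eq_empty_or_nonempty with rfl | hne
  · exact ⟨H / 2, by linarith, by linarith, by simp⟩
  obtain ⟨x, hx, hmax⟩ := hK.exists_isMaxOn hne continuous_abs.continuousOn
  have hxH := hKH hx
  refine ⟨max |x| (H / 2), by positivity, ?_, fun y hy => ?_⟩
  · exact max_lt (abs_lt.2 hxH) (by linarith)
  · exact abs_le.1 ((hmax hy).trans (le_max_left _ _))

/-- A function on `(-H, H)` whose weak derivative vanishes is constant. -/
lemma ae_eq_const_of_isWeakDeriv_zero (hH : 0 < H) {z : ℝ → ℝ}
    (hz : Integrable z (intervalMeasure H)) (h : IsWeakDeriv H z 0) :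
    ∃ c, z =ᵐ[intervalMeasure H] fun _ => c := by
  let B : ContDiffBump (0 : ℝ) := ⟨H / 4, H / 2, by linarith, by linarith⟩
  set ρ : ℝ → ℝ := B.normed volume with hρ
  have hρs : ContDiff ℝ ∞ ρ := B.contDiff_normed
  have hρc : HasCompactSupport ρ := B.hasCompactSupport_normed
  have hρt : tsupport ρ ⊆ Ioo (-H) H := by
    rw [hρ, B.tsupport_normed_eq, Real.closedBall_eq_Icc]
    intro x hx
    simp only [mem_Icc, mem_Ioo, B] at hx ⊢
    constructor <;> linarith [hx.1, hx.2]
  refine ⟨∫ y, z y * ρ y ∂(intervalMeasure H), ?_⟩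
  refine ae_eq_of_integral_mul_test hz (integrable_const _) fun ψ h1 h2 h3 => ?_
  set I := ∫ y, ψ y with hI
  -- Subtracting I ρ gives mean zero, so the primitive of k is again a compactly supported test
  -- function. Testing with it yields ∫ zψ = I ∫ zρ, which identifies the constant as ∫ zρ.
  set k : ℝ → ℝ := fun y => ψ y - I * ρ y with hk
  have hks : ContDiff ℝ ∞ k := h1.sub (contDiff_const.mul hρs)
  have hkc : Continuous k := hks.continuous
  obtain ⟨b, hb0, hbH, hb⟩ := exists_Icc_of_compact_subset hH
    (K := tsupport ψ ∪ tsupport ρ) (h2.isCompact.union hρc.isCompact) (union_subset h3 hρt)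
  have hk0 : ∀ y, y ∉ Icc (-b) b → k y = 0 := by
    intro y hy
    have hy1 : ψ y = 0 := by
      by_contra h'; exact hy (hb (Or.inl (subset_tsupport _ h')))
    have hy2 : ρ y = 0 := by
      by_contra h'; exact hy (hb (Or.inr (subset_tsupport _ h')))
    simp [hk, hy1, hy2]
  have hkint : ∫ y, k y = 0 := by
    simp only [hk]
    rw [integral_sub (h1.continuous.integrable_of_hasCompactSupport h2)
      ((hρs.continuous.integrable_of_hasCompactSupport hρc).const_mul I),
      integral_const_mul, hρ, B.integral_normed]
    simp [hI]
  set φ : ℝ → ℝ := fun y => ∫ t in (-H)..y, k t with hφ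
  have hφd : ∀ y, HasDerivAt φ (k y) y := fun y =>
    intervalIntegral.integral_hasDerivAt_right (hkc.intervalIntegrable _ _)
      (hkc.stronglyMeasurableAtFilter _ _) hkc.continuousAt
  have hφderiv : deriv φ = k := funext fun y => (hφd y).deriv
  have hφs : ContDiff ℝ ∞ φ := by
    rw [contDiff_infty_iff_deriv]
    exact ⟨fun y => (hφd y).differentiableAt, by rw [hφderiv]; exact hks⟩
  have hφ0 : ∀ y, y ∉ Icc (-b) b → φ y = 0 := by
    intro y hy
    rw [mem_Icc, not_and_or, not_le, not_le] at hy
    rcases hy with hy | hy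
    · simp only [hφ]
      rw [intervalIntegral.integral_congr (g := fun _ => 0)]
      · simp
      · intro t ht
        apply hk0
        intro ht'
        have := ht.2
        have h4 : max (-H) y < -b := max_lt (by linarith) hy
        linarith [ht'.1]
    · simp only [hφ]
      rw [intervalIntegral.integral_eq_integral_of_support_subset, hkint]
      intro t ht
      have : t ∈ Icc (-b) b := by
        by_contra h'; exact ht (hk0 t h')
      exact ⟨by linarith [this.1], by linarith [this.2]⟩
  have hφt : tsupport φ ⊆ Icc (-b) b := by
    apply closure_minimal _ isClosed_Icc
    intro y hy
    by_contra h'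
    exact hy (hφ0 y h')
  have hφc : HasCompactSupport φ := isCompact_Icc.of_isClosed_subset (isClosed_tsupport _) hφt
  have key := h φ hφs hφc (hφt.trans fun y hy => ⟨by linarith [hy.1], by linarith [hy.2]⟩)
  rw [hφderiv] at key
  simp only [hk, mul_sub, Pi.zero_apply, zero_mul, integral_zero, neg_zero] at key
  rw [integral_sub (integrable_mul_test hz h1.continuous h2)] at key
  · have e1 : ∫ y, z y * (I * ρ y) ∂(intervalMeasure H)
        = I * ∫ y, z y * ρ y ∂(intervalMeasure H) := by
      rw [← integral_const_mul]; congr 1; ext y; ring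
    have e2 : ∫ y, ψ y ∂(intervalMeasure H) = I := by
      have := integral_mul_test (f := fun _ => 1) h3
      simpa using this.symm
    rw [e1] at key
    rw [integral_const_mul, e2]
    linarith
  · have := (integrable_mul_test hz hρs.continuous hρc).const_mul I
    refine this.congr (Eventually.of_forall fun y => ?_)
    simp only; ring

/-- Absolutely continuous functions on `[-H, H]` with square integrable derivative. -/
structure ACL2 (H : ℝ) (v : ℝ → ℝ) : Prop where
  ac : AbsolutelyContinuousOnInterval v (-H) H
  memLp : MemLp (deriv v) 2 (intervalMeasure H)

namespace ACL2

variable {v : ℝ → ℝ}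

lemma continuousOn (hH : 0 < H) (hv : ACL2 H v) : ContinuousOn v (Icc (-H) H) := by
  have := hv.ac.continuousOn
  rwa [uIcc_of_le (by linarith)] at this

lemma sub_eq_integral (hH : 0 < H) (hv : ACL2 H v) {x y : ℝ} (hx : x ∈ Icc (-H) H)
    (hy : y ∈ Icc (-H) H) : v y - v x = ∫ t in x..y, deriv v t := by
  refine (AbsolutelyContinuousOnInterval.integral_deriv_eq_sub (hv.ac.mono ?_)).symm
  rw [uIcc_of_le (by linarith : -H ≤ H)]
  exact uIcc_subset_Icc hx hy

lemma ae_differentiableAt (hH : 0 < H) (hv : ACL2 H v) :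
    ∀ᵐ y ∂(intervalMeasure H), DifferentiableAt ℝ v y := by
  apply ae_intervalMeasure
  filter_upwards [hv.ac.ae_differentiableAt] with y hy hy'
  apply hy
  rw [uIcc_of_le (by linarith : -H ≤ H)]
  exact Ioo_subset_Icc_self hy'

lemma isWeakDeriv (hH : 0 < H) (hv : ACL2 H v) : IsWeakDeriv H v (deriv v) := by
  intro φ h1 h2 h3
  rw [integral_intervalMeasure hH, integral_intervalMeasure hH,
    AbsolutelyContinuousOnInterval.integral_mul_deriv_eq_deriv_mul hv.ac
      ((h1.of_le (by norm_cast)).contDiffOn.absolutelyContinuousOnInterval)]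
  have e1 : φ H = 0 := by
    by_contra h; exact absurd (h3 (subset_tsupport _ h)).2 (lt_irrefl _)
  have e2 : φ (-H) = 0 := by
    by_contra h; exact absurd (h3 (subset_tsupport _ h)).1 (lt_irrefl _)
  simp [e1, e2]

lemma memLp_self (hH : 0 < H) (hv : ACL2 H v) : MemLp v 2 (intervalMeasure H) := by
  obtain ⟨C, hC⟩ := isCompact_Icc.exists_bound_of_continuousOn (hv.continuousOn hH)
  refine MemLp.of_bound
    (((hv.continuousOn hH).mono Ioo_subset_Icc_self).aestronglyMeasurable measurableSet_Ioo) C ?_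
  exact ae_intervalMeasure (Eventually.of_forall fun y hy => hC y (Ioo_subset_Icc_self hy))

lemma memH1 (hH : 0 < H) (hv : ACL2 H v) : MemH1 H v :=
  ⟨hv.memLp_self hH, deriv v, hv.memLp, hv.isWeakDeriv hH⟩

end ACL2

lemma MemH1.weakDeriv_spec {v : ℝ → ℝ} (hv : MemH1 H v) :
    MemLp (weakDeriv H v) 2 (intervalMeasure H) ∧ IsWeakDeriv H v (weakDeriv H v) := by
  unfold weakDeriv
  rw [dif_pos hv]
  exact hv.2.choose_spec

/-- Continuous functions that agree almost everywhere agree everywhere, endpoints included, so the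
choice made in `contRep` is immaterial. -/
lemma contRep_eq (hH : 0 < H) {v w : ℝ → ℝ} (hw : ContinuousOn w (Icc (-H) H))
    (hwv : w =ᵐ[intervalMeasure H] v) {x : ℝ} (hx : x ∈ Icc (-H) H) : contRep H v x = w x := by
  have h : ∃ w : ℝ → ℝ, ContinuousOn w (Icc (-H) H) ∧ w =ᵐ[intervalMeasure H] v := ⟨w, hw, hwv⟩
  unfold contRep
  rw [dif_pos h]
  refine Measure.eqOn_Icc_of_ae_eq (μ := volume) (by linarith) ?_ h.choose_spec.1 hw hx
  rw [← Measure.restrict_congr_set Ioo_ae_eq_Icc]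
  exact h.choose_spec.2.trans hwv.symm

lemma ACL2.weakDeriv_ae (hH : 0 < H) {v w : ℝ → ℝ} (hv : ACL2 H v)
    (hvw : v =ᵐ[intervalMeasure H] w) : weakDeriv H w =ᵐ[intervalMeasure H] deriv v := by
  have hw : MemH1 H w :=
    ⟨(memLp_congr_ae hvw).1 (hv.memLp_self hH), deriv v, hv.memLp,
      (hv.isWeakDeriv hH).congr hvw EventuallyEq.rfl⟩
  exact hw.weakDeriv_spec.2.unique ((hv.isWeakDeriv hH).congr hvw EventuallyEq.rfl)
    (integrable_of_memLp_two hw.weakDeriv_spec.1) (integrable_of_memLp_two hv.memLp)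

/-- Subtracting from `v` the primitive of its weak derivative leaves a function with zero weak
derivative, hence a constant. From here on classical derivatives of absolutely continuous
representatives replace `weakDeriv` and `contRep`. -/
lemma MemH1.exists_ACL2 (hH : 0 < H) {v : ℝ → ℝ} (hv : MemH1 H v) :
    ∃ w, ACL2 H w ∧ w =ᵐ[intervalMeasure H] v ∧ deriv w =ᵐ[intervalMeasure H] weakDeriv H v ∧
      ∀ x ∈ Icc (-H) H, contRep H v x = w x := by
  obtain ⟨hv1, g, hg, hvg⟩ := hv
  have hgi := (integrable_of_memLp_two hg)
  have hle : -H ≤ H := by linarith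
  set P : ℝ → ℝ := fun y => ∫ t in (-H)..y, g t with hP
  have hPac : AbsolutelyContinuousOnInterval P (-H) H :=
    (intervalIntegrable_of_integrable hH hgi).absolutelyContinuousOnInterval_intervalIntegral
      left_mem_uIcc
  have hPd : deriv P =ᵐ[intervalMeasure H] g := by
    apply ae_intervalMeasure
    filter_upwards [(intervalIntegrable_of_integrable hH hgi).ae_hasDerivAt_integral] with y hy hy'
    refine (hy ?_ (-H) left_mem_uIcc).deriv
    rw [uIcc_of_le hle]; exact Ioo_subset_Icc_self hy'
  have hPL : ACL2 H P := ⟨hPac, (memLp_congr_ae hPd).2 hg⟩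
  have hz : IsWeakDeriv H (fun y => v y - P y) 0 := by
    intro φ h1 h2 h3
    have hd : Continuous (deriv φ) := h1.continuous_deriv (by norm_cast)
    simp only [sub_mul]
    rw [integral_sub (integrable_mul_test (integrable_of_memLp_two hv1) hd h2.deriv)
      (integrable_mul_test (integrable_of_memLp_two (hPL.memLp_self hH)) hd h2.deriv), hvg φ h1 h2 h3,
      ((hPL.isWeakDeriv hH).congr EventuallyEq.rfl hPd) φ h1 h2 h3]
    simp
  obtain ⟨c, hc⟩ := ae_eq_const_of_isWeakDeriv_zero hH
    ((integrable_of_memLp_two hv1).sub (integrable_of_memLp_two (hPL.memLp_self hH))) hz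
  have hder : deriv (fun y => c + P y) = deriv P := by
    ext y; rw [deriv_const_add]
  have hw : ACL2 H (fun y => c + P y) := by
    refine ⟨?_, by rw [hder]; exact hPL.memLp⟩
    exact AbsolutelyContinuousOnInterval.add
      (LipschitzWith.const c).lipschitzOnWith.absolutelyContinuousOnInterval hPac
  have hwv : (fun y => c + P y) =ᵐ[intervalMeasure H] v := by
    filter_upwards [hc] with y hy
    rw [Pi.sub_apply] at hy
    linarith
  exact ⟨_, hw, hwv, (hw.weakDeriv_ae hH hwv).symm,
    fun x hx => contRep_eq hH (hw.continuousOn hH) hwv hx⟩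

/-- Absolute continuity is inherited by functions with smaller increments. -/
lemma absolutelyContinuousOnInterval_of_dist_le {v P : ℝ → ℝ} {a b : ℝ}
    (hP : AbsolutelyContinuousOnInterval P a b)
    (h : ∀ x ∈ uIcc a b, ∀ y ∈ uIcc a b, dist (v x) (v y) ≤ dist (P x) (P y)) :
    AbsolutelyContinuousOnInterval v a b := by
  rw [absolutelyContinuousOnInterval_iff] at hP ⊢
  intro ε hε
  obtain ⟨δ, hδ, hE⟩ := hP ε hε
  refine ⟨δ, hδ, fun E hE1 hE2 => lt_of_le_of_lt (Finset.sum_le_sum fun i hi => ?_) (hE E hE1 hE2)⟩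
  exact h _ (hE1.1 i hi).1 _ (hE1.1 i hi).2

/-- At points where `F` is not differentiable `deriv F y` is 0 by convention, so no
differentiability of `F` is required. -/
lemma abs_deriv_le_of_eventually {F h : ℝ → ℝ} {y d K : ℝ} (hK : 0 ≤ K) (hh : HasDerivAt h d y)
    (hF : ∀ᶠ x in 𝓝 y, |F x - F y| ≤ K * |h x - h y|) : |deriv F y| ≤ K * |d| := by
  by_cases hd : DifferentiableAt ℝ F y
  · have h1 := (hasDerivAt_iff_tendsto_slope.1 hd.hasDerivAt).abs
    have h2 := (hasDerivAt_iff_tendsto_slope.1 hh).abs.const_mul K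
    refine le_of_tendsto_of_tendsto h1 h2 ?_
    filter_upwards [nhdsWithin_le_nhds hF] with x hx
    rw [slope_def_field, slope_def_field, abs_div, abs_div, mul_div_assoc']
    gcongr
  · rw [deriv_zero_of_not_differentiableAt hd, abs_zero]; positivity

/-- A function whose increments are bounded by those of an `ACL2` function is `ACL2`, with
derivative bounded accordingly. -/
lemma ACL2.of_abs_sub_le (hH : 0 < H) {f F : ℝ → ℝ} {K : ℝ} (hK : 0 ≤ K) (hf : ACL2 H f)
    (h : ∀ x ∈ Icc (-H) H, ∀ y ∈ Icc (-H) H, |F x - F y| ≤ K * |f x - f y|) :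
    ACL2 H F ∧ ∀ᵐ y ∂(intervalMeasure H), |deriv F y| ≤ K * |deriv f y| := by
  have hle : -H ≤ H := by linarith
  have hae : ∀ᵐ y ∂(intervalMeasure H), |deriv F y| ≤ K * |deriv f y| := by
    filter_upwards [hf.ae_differentiableAt hH,
      ae_intervalMeasure (Eventually.of_forall fun x (hx : x ∈ Ioo (-H) H) => hx)] with y hy hyI
    refine abs_deriv_le_of_eventually hK hy.hasDerivAt ?_
    filter_upwards [Ioo_mem_nhds hyI.1 hyI.2] with x hx
    exact h x (Ioo_subset_Icc_self hx) y (Ioo_subset_Icc_self hyI)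
  refine ⟨⟨?_, ?_⟩, hae⟩
  · refine absolutelyContinuousOnInterval_of_dist_le (hf.ac.const_mul K) fun x hx y hy => ?_
    rw [uIcc_of_le hle] at hx hy
    simpa [Real.dist_eq, ← mul_sub, abs_mul, abs_of_nonneg hK] using h x hx y hy
  · refine (hf.memLp.const_mul K).of_le (measurable_deriv F).aestronglyMeasurable ?_
    filter_upwards [hae] with y hy
    simpa [abs_mul, abs_of_nonneg hK] using hy

end

/-! ### One-sided traces, Lebesgue points and mollification. -/

section

variable {H : ℝ}

/-- The family `I` stands for either `Ioo x (x + r)` or `Ioo (x - r) x`, so that left and right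
traces are treated at once. -/
lemma lintegral_le_of_trace {v : ℝ → ℝ} {c : ℝ} {I : ℝ → Set ℝ}
    (h : Tendsto (fun r : ℝ => (∫⁻ y in I r, ENNReal.ofReal |v y - c|) / ENNReal.ofReal r)
      (𝓝[>] 0) (𝓝 0)) {η : ℝ} (hη : 0 < η) :
    ∀ᶠ r in 𝓝[>] (0 : ℝ), ∫⁻ y in I r, ENNReal.ofReal |v y - c| ≤ ENNReal.ofReal (η * r) := by
  have h1 : ∀ᶠ r in 𝓝[>] (0 : ℝ),
      (∫⁻ y in I r, ENNReal.ofReal |v y - c|) / ENNReal.ofReal r < ENNReal.ofReal η :=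
    h.eventually_lt_const (by simpa using hη)
  filter_upwards [h1, self_mem_nhdsWithin] with r hr hr0
  have hr0' : (0 : ℝ) < r := hr0
  rw [ENNReal.ofReal_mul hη.le]
  refine (ENNReal.div_le_iff_le_mul (Or.inl ?_) (Or.inl ENNReal.ofReal_ne_top)).1 hr.le
  simpa using hr0'

lemma trace_of_lintegral_le {v : ℝ → ℝ} {c : ℝ} {I : ℝ → Set ℝ}
    (h : ∀ η > 0, ∀ᶠ r in 𝓝[>] (0 : ℝ),
      ∫⁻ y in I r, ENNReal.ofReal |v y - c| ≤ ENNReal.ofReal (η * r)) :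
    Tendsto (fun r : ℝ => (∫⁻ y in I r, ENNReal.ofReal |v y - c|) / ENNReal.ofReal r)
      (𝓝[>] 0) (𝓝 0) := by
  rw [ENNReal.tendsto_nhds_zero]
  intro ε hε
  obtain ⟨η, hη0, hηε⟩ : ∃ η : ℝ, 0 < η ∧ ENNReal.ofReal η ≤ ε := by
    rcases eq_or_ne ε ⊤ with rfl | hε'
    · exact ⟨1, one_pos, le_top⟩
    · exact ⟨ε.toReal, ENNReal.toReal_pos hε.ne' hε', (ENNReal.ofReal_toReal hε').le⟩
  filter_upwards [h η hη0, self_mem_nhdsWithin] with r hr hr0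
  have hr0' : (0 : ℝ) < r := hr0
  refine le_trans ?_ hηε
  refine ENNReal.div_le_of_le_mul ?_
  rwa [← ENNReal.ofReal_mul hη0.le]

lemma ae_restrict_Ioo_of_ae {p : ℝ → Prop} (h : ∀ᵐ y ∂(intervalMeasure H), p y) {s t : ℝ}
    (hs : -H ≤ s) (ht : t ≤ H) : ∀ᵐ y ∂(volume.restrict (Ioo s t)), p y :=
  ae_restrict_of_ae_restrict_of_subset (Ioo_subset_Ioo hs ht) h

lemma exists_mem_Ioo_of_ae {p : ℝ → Prop} (h : ∀ᵐ y ∂(intervalMeasure H), p y) {s t : ℝ}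
    (hs : -H ≤ s) (ht : t ≤ H) (hst : s < t) : ∃ y ∈ Ioo s t, p y := by
  by_contra hcon
  push Not at hcon
  have h2 := ae_restrict_Ioo_of_ae h hs ht
  rw [ae_restrict_iff' measurableSet_Ioo] at h2
  have h3 : volume (Ioo s t) = 0 := by
    refine measure_mono_null ?_ h2
    intro y hy h'
    exact hcon y hy (h' hy)
  rw [Real.volume_Ioo, ENNReal.ofReal_eq_zero] at h3
  linarith

/-- Within any set of full measure there are points at which a function is close to its trace. -/
lemma exists_close_of_trace {v : ℝ → ℝ} {c : ℝ} {I : ℝ → Set ℝ} (hI : ∀ r, MeasurableSet (I r))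
    (hvol : ∀ r, volume (I r) = ENNReal.ofReal r)
    (h : Tendsto (fun r : ℝ => (∫⁻ y in I r, ENNReal.ofReal |v y - c|) / ENNReal.ofReal r)
      (𝓝[>] 0) (𝓝 0)) {p : ℝ → Prop}
    (hp : ∀ᶠ r in 𝓝[>] (0 : ℝ), ∀ᵐ y ∂(volume.restrict (I r)), p y) {η : ℝ} (hη : 0 < η) :
    ∀ᶠ r in 𝓝[>] (0 : ℝ), ∃ y ∈ I r, p y ∧ |v y - c| < η := by
  filter_upwards [lintegral_le_of_trace h (half_pos hη), hp, self_mem_nhdsWithin] with r hr hpr hr0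
  have hr0' : (0 : ℝ) < r := hr0
  -- Chebyshev: if |v - c| ≥ η almost everywhere on `I r`, the integral is at least η r, against the
  -- bound η r / 2.
  by_contra hcon
  push Not at hcon
  have h1 : ∫⁻ _ in I r, ENNReal.ofReal η ≤ ∫⁻ y in I r, ENNReal.ofReal |v y - c| := by
    refine lintegral_mono_ae ?_
    rw [ae_restrict_iff' (hI r)] at hpr ⊢
    filter_upwards [hpr] with y hy hyI
    exact ENNReal.ofReal_le_ofReal (hcon y hyI (hy hyI))
  rw [lintegral_const, Measure.restrict_apply_univ, hvol, ← ENNReal.ofReal_mul hη.le] at h1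
  have h2 := h1.trans hr
  rw [ENNReal.ofReal_le_ofReal_iff (by positivity)] at h2
  nlinarith

lemma eventually_small {b : ℝ} (hb : 0 < b) : ∀ᶠ r in 𝓝[>] (0 : ℝ), 0 < r ∧ r < b :=
  Ioo_mem_nhdsGT hb

lemma exists_close_of_rightTrace {v : ℝ → ℝ} {x c : ℝ} (hx : x ∈ Ico (-H) H)
    (h : HasRightTrace v x c) {p : ℝ → Prop} (hp : ∀ᵐ y ∂(intervalMeasure H), p y) {η : ℝ}
    (hη : 0 < η) : ∀ᶠ r in 𝓝[>] (0 : ℝ), ∃ y ∈ Ioo x (x + r), p y ∧ |v y - c| < η := by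
  refine exists_close_of_trace (fun _ => measurableSet_Ioo) (fun r => by simp) h ?_ hη
  filter_upwards [eventually_small (sub_pos.2 hx.2)] with r hr
  exact ae_restrict_Ioo_of_ae hp hx.1 (by linarith [hr.2])

lemma exists_close_of_leftTrace {v : ℝ → ℝ} {x c : ℝ} (hx : x ∈ Ioc (-H) H)
    (h : HasLeftTrace v x c) {p : ℝ → Prop} (hp : ∀ᵐ y ∂(intervalMeasure H), p y) {η : ℝ}
    (hη : 0 < η) : ∀ᶠ r in 𝓝[>] (0 : ℝ), ∃ y ∈ Ioo (x - r) x, p y ∧ |v y - c| < η := by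
  refine exists_close_of_trace (fun _ => measurableSet_Ioo) (fun r => by simp) h ?_ hη
  filter_upwards [eventually_small (sub_pos.2 hx.1)] with r hr
  exact ae_restrict_Ioo_of_ae hp (by linarith [hr.2]) hx.2

/-- Almost every point is a Lebesgue point from both sides. -/
lemma ae_hasTrace {v : ℝ → ℝ} (hv : Integrable v (intervalMeasure H)) :
    ∀ᵐ x ∂(intervalMeasure H), HasLeftTrace v x (v x) ∧ HasRightTrace v x (v x) := by
  apply ae_intervalMeasure
  set f : ℝ → ℝ := (Ioo (-H) H).indicator v with hf
  have hfi : LocallyIntegrable f volume :=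
    ((integrable_indicator_iff measurableSet_Ioo).2 hv).locallyIntegrable
  -- Intervals having x as an endpoint belong to the Vitali family, so Lebesgue differentiation
  -- applies to one-sided averages directly.
  filter_upwards [(IsUnifLocDoublingMeasure.vitaliFamily (volume : Measure ℝ)
    1).ae_tendsto_lintegral_enorm_sub_div hfi] with x hx hxI
  have hnear : ∀ y ∈ Ioo (-H) H, ‖f y - f x‖ₑ = ENNReal.ofReal |v y - v x| := by
    intro y hy
    rw [hf, indicator_of_mem hy, indicator_of_mem hxI, Real.enorm_eq_ofReal_abs]
  constructor
  · have h1 : Tendsto (fun r : ℝ => x - r) (𝓝[>] 0) (𝓝[<] x) := by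
      refine tendsto_nhdsWithin_iff.2 ⟨?_, ?_⟩
      · have : Tendsto (fun r : ℝ => x - r) (𝓝 0) (𝓝 (x - 0)) :=
          (continuous_const.sub continuous_id).tendsto 0
        rw [sub_zero] at this
        exact this.mono_left nhdsWithin_le_nhds
      · filter_upwards [self_mem_nhdsWithin] with r hr
        have : (0 : ℝ) < r := hr
        simpa using this
    refine ((hx.comp (Real.tendsto_Icc_vitaliFamily_left x)).comp h1).congr' ?_
    filter_upwards [eventually_small (b := x - -H) (by linarith [hxI.1])] with r hr
    simp only [Function.comp]
    rw [Real.volume_Icc, sub_sub_cancel, ← restrict_Ioo_eq_restrict_Icc]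
    congr 1
    refine setLIntegral_congr_fun measurableSet_Ioo fun y hy => ?_
    exact hnear y ⟨by linarith [hy.1, hr.2], by linarith [hy.2, hxI.2]⟩
  · have h1 : Tendsto (fun r : ℝ => x + r) (𝓝[>] 0) (𝓝[>] x) := by
      refine tendsto_nhdsWithin_iff.2 ⟨?_, ?_⟩
      · have : Tendsto (fun r : ℝ => x + r) (𝓝 0) (𝓝 (x + 0)) :=
          (continuous_const.add continuous_id).tendsto 0
        rw [add_zero] at this
        exact this.mono_left nhdsWithin_le_nhds
      · filter_upwards [self_mem_nhdsWithin] with r hr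
        have : (0 : ℝ) < r := hr
        simpa using this
    refine ((hx.comp (Real.tendsto_Icc_vitaliFamily_right x)).comp h1).congr' ?_
    filter_upwards [eventually_small (b := H - x) (by linarith [hxI.2])] with r hr
    simp only [Function.comp]
    rw [Real.volume_Icc, add_sub_cancel_left, ← restrict_Ioo_eq_restrict_Icc]
    congr 1
    refine setLIntegral_congr_fun measurableSet_Ioo fun y hy => ?_
    exact hnear y ⟨by linarith [hy.1, hxI.1], by linarith [hy.2, hr.2]⟩

/-- The bump of integral one supported in `[-r, r]`. -/
def smoothBump (r : ℝ) (hr : 0 < r) : ContDiffBump (0 : ℝ) := ⟨r / 2, r, by linarith, by linarith⟩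

lemma smoothBump_le {r : ℝ} (hr : 0 < r) (y : ℝ) : (smoothBump r hr).normed volume y ≤ 1 / r := by
  refine ((smoothBump r hr).normed_le_div_measure_closedBall_rIn volume y).trans_eq ?_
  rw [Real.closedBall_eq_Icc, measureReal_def, Real.volume_Icc,
    ENNReal.toReal_ofReal (by simp only [smoothBump]; linarith)]
  simp only [smoothBump]
  congr 1; ring

lemma smoothBump_eq_zero {r : ℝ} (hr : 0 < r) {y : ℝ} (hy : r ≤ |y|) :
    (smoothBump r hr).normed volume y = 0 := by
  by_contra h
  have h1 : y ∈ Function.support ((smoothBump r hr).normed volume) := h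
  rw [ContDiffBump.support_normed_eq, Real.ball_eq_Ioo] at h1
  have : |y| < r := by
    rw [abs_lt]; simp only [smoothBump, mem_Ioo] at h1; constructor <;> linarith [h1.1, h1.2]
  linarith

/-- The kernel has mass one, is bounded by 1/r and is supported within distance r of x, so the
deviation of the mollified value from c is controlled by the two one-sided averages of |v - c|. -/
lemma abs_integral_smoothBump_sub_le {v : ℝ → ℝ} (hv : Integrable v (intervalMeasure H)) {x c r : ℝ}
    (hr : 0 < r) (h1 : -H < x - r) (h2 : x + r < H) :
    ENNReal.ofReal |∫ y, v y * (smoothBump r hr).normed volume (y - x) ∂(intervalMeasure H) - c|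
      ≤ ENNReal.ofReal (1 / r) * (∫⁻ y in Ioo (x - r) x, ENNReal.ofReal |v y - c|) +
        ENNReal.ofReal (1 / r) * ∫⁻ y in Ioo x (x + r), ENNReal.ofReal |v y - c| := by
  set ρ : ℝ → ℝ := fun y => (smoothBump r hr).normed volume (y - x) with hρ
  have hρc : Continuous ρ := (smoothBump r hr).continuous_normed.comp (by fun_prop)
  have hρ0 : ∀ y, 0 ≤ ρ y := fun y => (smoothBump r hr).nonneg_normed _
  have hρ1 : ∀ y, ρ y ≤ 1 / r := fun y => smoothBump_le hr _
  have hρb : ∀ y, ‖ρ y‖ ≤ 1 / r := fun y => by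
    rw [Real.norm_eq_abs, abs_of_nonneg (hρ0 y)]; exact hρ1 y
  have hρs : ∀ y, y ∉ Ioo (x - r) (x + r) → ρ y = 0 := by
    intro y hy
    apply smoothBump_eq_zero hr
    by_contra h
    rw [not_le, abs_lt] at h
    exact hy ⟨by linarith [h.1], by linarith [h.2]⟩
  have hone : ∫ y, ρ y ∂(intervalMeasure H) = 1 := by
    rw [intervalMeasure, setIntegral_eq_integral_of_forall_compl_eq_zero]
    · rw [hρ, integral_sub_right_eq_self (fun y => (smoothBump r hr).normed volume y) x,
        ContDiffBump.integral_normed]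
    · intro y hy
      exact hρs y fun h => hy ⟨by linarith [h.1], by linarith [h.2]⟩
  have e1 : ∫ y, v y * ρ y ∂(intervalMeasure H) - c
      = ∫ y, (v y - c) * ρ y ∂(intervalMeasure H) := by
    simp only [sub_mul]
    rw [integral_sub (hv.mul_bdd hρc.aestronglyMeasurable (Eventually.of_forall hρb)),
      integral_const_mul, hone, mul_one]
    exact (integrable_const c).mul_bdd hρc.aestronglyMeasurable (Eventually.of_forall hρb)
  rw [e1, ← Real.enorm_eq_ofReal_abs]
  refine (enorm_integral_le_lintegral_enorm _).trans ?_
  have e2 : ∫⁻ y, ‖(v y - c) * ρ y‖ₑ ∂(intervalMeasure H)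
      ≤ ∫⁻ y in Ioo (x - r) (x + r), ENNReal.ofReal (1 / r) * ENNReal.ofReal |v y - c| := by
    rw [← lintegral_indicator measurableSet_Ioo]
    refine (setLIntegral_le_lintegral _ _).trans (lintegral_mono fun y => ?_)
    by_cases hy : y ∈ Ioo (x - r) (x + r)
    · rw [indicator_of_mem hy, Real.enorm_eq_ofReal_abs, ← ENNReal.ofReal_mul (by positivity),
        abs_mul, abs_of_nonneg (hρ0 y), mul_comm]
      exact ENNReal.ofReal_le_ofReal (mul_le_mul_of_nonneg_right (hρ1 y) (abs_nonneg _))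
    · simp [hρs y hy]
  refine e2.trans ?_
  have e3 : (Ioo (x - r) (x + r) : Set ℝ) =ᵐ[volume] (Ioo (x - r) x ∪ Ioo x (x + r) : Set ℝ) := by
    have : (Ioo (x - r) (x + r) : Set ℝ) = Ioo (x - r) x ∪ Ico x (x + r) :=
      (Ioo_union_Ico_eq_Ioo (by linarith) (by linarith)).symm
    rw [this]
    exact Filter.EventuallyEq.union EventuallyEq.rfl Ioo_ae_eq_Ico.symm
  rw [lintegral_const_mul' _ _ ENNReal.ofReal_ne_top, setLIntegral_congr e3, ← mul_add]
  gcongr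
  exact lintegral_union_le _ _ _

lemma tendsto_integral_smoothBump {v : ℝ → ℝ} (hv : Integrable v (intervalMeasure H)) {x c : ℝ}
    (hx : x ∈ Ioo (-H) H) (hl : HasLeftTrace v x c) (hr : HasRightTrace v x c) {η : ℝ}
    (hη : 0 < η) : ∀ᶠ r in 𝓝[>] (0 : ℝ), ∀ hr : 0 < r,
      |∫ y, v y * (smoothBump r hr).normed volume (y - x) ∂(intervalMeasure H) - c| ≤ η := by
  have hb : 0 < min (x - -H) (H - x) := lt_min (by linarith [hx.1]) (by linarith [hx.2])
  filter_upwards [lintegral_le_of_trace hl (half_pos hη), lintegral_le_of_trace hr (half_pos hη),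
    eventually_small hb] with r hr1 hr2 hr3 hr0
  have hb1 := lt_of_lt_of_le hr3.2 (min_le_left _ _)
  have hb2 := lt_of_lt_of_le hr3.2 (min_le_right _ _)
  have := abs_integral_smoothBump_sub_le hv (c := c) hr0 (by linarith : -H < x - r) (by linarith)
  have h4 : ENNReal.ofReal (1 / r) * ENNReal.ofReal (η / 2 * r) = ENNReal.ofReal (η / 2) := by
    rw [← ENNReal.ofReal_mul (by positivity)]; congr 1; field_simp
  have h5 := this.trans (add_le_add (mul_le_mul_right hr1 _) (mul_le_mul_right hr2 _))
  rw [h4, ← ENNReal.ofReal_add (by positivity) (by positivity), add_halves] at h5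
  exact (ENNReal.ofReal_le_ofReal_iff hη.le).1 h5

end

/-! ### From distributional to pointwise variation. -/

section

variable {H : ℝ}

/-- The antiderivative of the smooth bump: a smooth step of width `2 r`. -/
def smoothStep (r : ℝ) (hr : 0 < r) (t : ℝ) : ℝ :=
  ∫ y in (-r)..t, (smoothBump r hr).normed volume y

section smoothStep

variable {r : ℝ} (hr : 0 < r)

lemma hasDerivAt_smoothStep (t : ℝ) :
    HasDerivAt (smoothStep r hr) ((smoothBump r hr).normed volume t) t :=
  intervalIntegral.integral_hasDerivAt_right
    ((smoothBump r hr).continuous_normed.intervalIntegrable _ _)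
    ((smoothBump r hr).continuous_normed.stronglyMeasurableAtFilter _ _)
    (smoothBump r hr).continuous_normed.continuousAt

lemma monotone_smoothStep : Monotone (smoothStep r hr) :=
  monotone_of_deriv_nonneg (fun t => (hasDerivAt_smoothStep hr t).differentiableAt) fun t => by
    rw [(hasDerivAt_smoothStep hr t).deriv]; exact (smoothBump r hr).nonneg_normed _

lemma smoothStep_of_le {t : ℝ} (ht : t ≤ -r) : smoothStep r hr t = 0 := by
  unfold smoothStep
  rw [intervalIntegral.integral_congr (g := fun _ => 0)]
  · simp
  · intro y hy
    rw [uIcc_of_ge ht] at hy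
    apply smoothBump_eq_zero hr
    rw [abs_of_nonpos (by linarith [hy.2])]; linarith [hy.2]

lemma smoothStep_of_ge {t : ℝ} (ht : r ≤ t) : smoothStep r hr t = 1 := by
  unfold smoothStep
  rw [intervalIntegral.integral_eq_integral_of_support_subset, ContDiffBump.integral_normed]
  intro y hy
  by_contra h
  refine hy (smoothBump_eq_zero hr ?_)
  by_contra h'
  rw [not_le, abs_lt] at h'
  exact h ⟨h'.1, by linarith [h'.2]⟩

lemma smoothStep_mem (t : ℝ) : smoothStep r hr t ∈ Icc (0 : ℝ) 1 := by
  constructor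
  · rw [← smoothStep_of_le hr (min_le_right t (-r))]
    exact monotone_smoothStep hr (min_le_left _ _)
  · rw [← smoothStep_of_ge hr (le_max_right t r)]
    exact monotone_smoothStep hr (le_max_left _ _)

end smoothStep

lemma integrable_mul_smoothBump {v : ℝ → ℝ} (hv : Integrable v (intervalMeasure H)) {r : ℝ}
    (hr : 0 < r) (x : ℝ) :
    Integrable (fun y => v y * (smoothBump r hr).normed volume (y - x)) (intervalMeasure H) := by
  have hc : Continuous fun y => (smoothBump r hr).normed volume (y - x) :=
    (smoothBump r hr).continuous_normed.comp (by fun_prop)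
  refine hv.mul_bdd (c := 1 / r) hc.aestronglyMeasurable (Eventually.of_forall fun y => ?_)
  rw [Real.norm_eq_abs, abs_of_nonneg ((smoothBump r hr).nonneg_normed _)]
  exact smoothBump_le hr _

/-- The variation along a finite monotone family of two-sided Lebesgue points is bounded by the
distributional total variation. -/
lemma sum_abs_sub_le_of_memBV {v : ℝ → ℝ} (hv : Integrable v (intervalMeasure H)) {C : ℝ}
    (hC : ∀ φ : ℝ → ℝ, ContDiff ℝ 1 φ → HasCompactSupport φ → tsupport φ ⊆ Ioo (-H) H →
      (∀ y, |φ y| ≤ 1) → ∫ y, v y * deriv φ y ∂(intervalMeasure H) ≤ C)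
    {x : ℕ → ℝ} (hx : Monotone x) (hxI : ∀ i, x i ∈ Ioo (-H) H)
    (hl : ∀ i, HasLeftTrace v (x i) (v (x i))) (hr : ∀ i, HasRightTrace v (x i) (v (x i))) (n : ℕ) :
    ∑ i ∈ Finset.range n, |v (x (i + 1)) - v (x i)| ≤ C := by
  obtain ⟨s, hs1, hs2⟩ : ∃ s : ℕ → ℝ, (∀ i, |s i| ≤ 1) ∧
      ∀ i, s i * (v (x i) - v (x (i + 1))) = |v (x (i + 1)) - v (x i)| := by
    refine ⟨fun i => if v (x i) - v (x (i + 1)) ≥ 0 then 1 else -1, fun i => ?_, fun i => ?_⟩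
    · simp only
      split_ifs <;> simp
    · simp only
      split_ifs with h
      · rw [abs_of_nonpos (by linarith)]; ring
      · rw [abs_of_nonneg (by linarith)]; ring
  refine le_of_forall_pos_le_add fun η hη => ?_
  -- Each of the n increments uses two mollified values, so the total error is 2 n η' ≤ η.
  set η' : ℝ := η / (2 * (n + 1)) with hη'
  have hη'0 : 0 < η' := by positivity
  have hev : ∀ᶠ r in 𝓝[>] (0 : ℝ), ∀ i ∈ Finset.range (n + 1), ∀ hr : 0 < r,
      |∫ y, v y * (smoothBump r hr).normed volume (y - x i) ∂(intervalMeasure H) - v (x i)| ≤ η' :=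
    (Filter.eventually_all_finset _).2 fun i _ =>
      tendsto_integral_smoothBump hv (hxI i) (hl i) (hr i) hη'0
  have hb : 0 < min (x 0 - -H) (H - x n) :=
    lt_min (by linarith [(hxI 0).1]) (by linarith [(hxI n).2])
  obtain ⟨r, hr1, hr0, hr3⟩ := (hev.and (eventually_small hb)).exists
  have hb1 := lt_of_lt_of_le hr3 (min_le_left _ _)
  have hb2 := lt_of_lt_of_le hr3 (min_le_right _ _)
  set S := smoothStep r hr0 with hS
  set ρ : ℝ → ℝ := (smoothBump r hr0).normed volume with hρ
  -- A smoothed step function equal to about s i between x i and x (i + 1). Its modulus is at most 1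
  -- by telescoping of the monotone steps, and ∫ v φ' is a signed sum of increments of mollified
  -- values of v.
  set φ : ℝ → ℝ := fun y => ∑ i ∈ Finset.range n, s i * (S (y - x i) - S (y - x (i + 1))) with hφ
  have hφd : ∀ y, HasDerivAt φ (∑ i ∈ Finset.range n, s i * (ρ (y - x i) - ρ (y - x (i + 1)))) y := by
    intro y
    refine HasDerivAt.fun_sum fun i _ => ?_
    have h1 : ∀ j, HasDerivAt (fun y => S (y - x j)) (ρ (y - x j)) y := fun j =>
      (hasDerivAt_smoothStep hr0 (y - x j)).comp_sub_const y (x j)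
    exact ((h1 i).sub (h1 (i + 1))).const_mul (s i)
  have hφderiv : deriv φ = fun y => ∑ i ∈ Finset.range n, s i * (ρ (y - x i) - ρ (y - x (i + 1))) :=
    funext fun y => (hφd y).deriv
  have hρc : Continuous ρ := (smoothBump r hr0).continuous_normed
  have hφs : ContDiff ℝ 1 φ := by
    rw [contDiff_one_iff_deriv]
    refine ⟨fun y => (hφd y).differentiableAt, ?_⟩
    rw [hφderiv]
    refine continuous_finsetSum _ fun i _ => ?_
    fun_prop
  have hφ0 : ∀ y, y ∉ Icc (x 0 - r) (x n + r) → φ y = 0 := by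
    intro y hy
    refine Finset.sum_eq_zero fun i hi => ?_
    have hin : i + 1 ≤ n := Finset.mem_range.1 hi
    have e1 := hx (Nat.zero_le i)
    have e2 := hx (Nat.zero_le (i + 1))
    have e3 := hx hin
    have e4 := hx ((Nat.le_succ i).trans hin)
    rw [mem_Icc, not_and_or, not_le, not_le] at hy
    rcases hy with hy | hy
    · rw [hS, smoothStep_of_le hr0 (by linarith), smoothStep_of_le hr0 (by linarith)]; simp
    · rw [hS, smoothStep_of_ge hr0 (by linarith), smoothStep_of_ge hr0 (by linarith)]; simp
  have hφt : tsupport φ ⊆ Icc (x 0 - r) (x n + r) := by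
    apply closure_minimal _ isClosed_Icc
    intro y hy
    by_contra h'
    exact hy (hφ0 y h')
  have hφc : HasCompactSupport φ := isCompact_Icc.of_isClosed_subset (isClosed_tsupport _) hφt
  have hφ1 : ∀ y, |φ y| ≤ 1 := by
    intro y
    calc |φ y| ≤ ∑ i ∈ Finset.range n, |s i * (S (y - x i) - S (y - x (i + 1)))| :=
          Finset.abs_sum_le_sum_abs _ _
      _ ≤ ∑ i ∈ Finset.range n, (S (y - x i) - S (y - x (i + 1))) := by
          refine Finset.sum_le_sum fun i _ => ?_
          have h1 : 0 ≤ S (y - x i) - S (y - x (i + 1)) :=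
            sub_nonneg.2 (monotone_smoothStep hr0 (by linarith [hx (Nat.le_succ i)]))
          rw [abs_mul, abs_of_nonneg h1]
          exact mul_le_of_le_one_left h1 (hs1 i)
      _ = S (y - x 0) - S (y - x n) := Finset.sum_range_sub' (fun i => S (y - x i)) n
      _ ≤ 1 := by linarith [(smoothStep_mem hr0 (y - x 0)).2, (smoothStep_mem hr0 (y - x n)).1]
  have key := hC φ hφs hφc (hφt.trans fun y hy => ⟨by linarith [hy.1], by linarith [hy.2]⟩) hφ1
  set V : ℕ → ℝ := fun i => ∫ y, v y * ρ (y - x i) ∂(intervalMeasure H) with hV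
  have e1 : ∫ y, v y * deriv φ y ∂(intervalMeasure H)
      = ∑ i ∈ Finset.range n, s i * (V i - V (i + 1)) := by
    have hi : ∀ i, Integrable (fun y => v y * ρ (y - x i)) (intervalMeasure H) :=
      fun i => integrable_mul_smoothBump hv hr0 (x i)
    have hi' : ∀ i, Integrable (fun y => s i * (v y * ρ (y - x i) - v y * ρ (y - x (i + 1))))
      (intervalMeasure H) := fun i => ((hi i).sub (hi (i + 1))).const_mul (s i)
    have : ∀ y, v y * deriv φ y
        = ∑ i ∈ Finset.range n, s i * (v y * ρ (y - x i) - v y * ρ (y - x (i + 1))) := by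
      intro y
      rw [hφderiv, Finset.mul_sum]
      exact Finset.sum_congr rfl fun i _ => by ring
    simp only [this]
    rw [integral_finsetSum _ fun i _ => hi' i]
    refine Finset.sum_congr rfl fun i _ => ?_
    rw [integral_const_mul, integral_sub (hi i) (hi (i + 1))]
  rw [e1] at key
  have hVv : ∀ i ∈ Finset.range n, |v (x (i + 1)) - v (x i)| ≤ s i * (V i - V (i + 1)) + 2 * η' := by
    intro i hi
    have hin := Finset.mem_range.1 hi
    have h1 := abs_le.1 (hr1 i (Finset.mem_range.2 (by omega)) hr0)
    have h2 := abs_le.1 (hr1 (i + 1) (Finset.mem_range.2 (by omega)) hr0)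
    have h3 : |s i * ((v (x i) - v (x (i + 1))) - (V i - V (i + 1)))| ≤ 2 * η' := by
      rw [abs_mul]
      refine (mul_le_of_le_one_left (abs_nonneg _) (hs1 i)).trans ?_
      rw [abs_le]
      simp only [hV, hρ]
      constructor <;> linarith [h1.1, h1.2, h2.1, h2.2]
    have h4 := (le_abs_self _).trans h3
    rw [mul_sub, hs2] at h4
    linarith
  have h5 := Finset.sum_le_sum hVv
  rw [Finset.sum_add_distrib, Finset.sum_const, Finset.card_range, nsmul_eq_mul] at h5
  have h6 : (n : ℝ) * (2 * η') ≤ η := by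
    rw [hη']
    have : (n : ℝ) * (2 * (η / (2 * (n + 1)))) = η * (n / (n + 1)) := by field_simp
    rw [this]
    exact mul_le_of_le_one_right hη.le ((div_le_one (by positivity)).2 (by linarith))
  linarith

/-- Only points where v equals both of its traces are admitted: there mollification recovers the
pointwise value, so the distributional bound controls the pointwise variation. -/
lemma boundedVariationOn_of_memBV {v : ℝ → ℝ} (hv : MemBV H v) {G : Set ℝ} (hG : G ⊆ Ioo (-H) H)
    (ht : ∀ x ∈ G, HasLeftTrace v x (v x) ∧ HasRightTrace v x (v x)) : BoundedVariationOn v G := by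
  obtain ⟨hvi, C, hC⟩ := hv
  have : eVariationOn v G ≤ ENNReal.ofReal C := by
    refine iSup_le ?_
    rintro ⟨n, x, hx, hxG⟩
    simp only [edist_dist, Real.dist_eq]
    rw [← ENNReal.ofReal_sum_of_nonneg fun i _ => abs_nonneg _]
    exact ENNReal.ofReal_le_ofReal (sum_abs_sub_le_of_memBV hvi hC hx (fun i => hG (hxG i))
      (fun i => (ht _ (hxG i)).1) (fun i => (ht _ (hxG i)).2) n)
  exact ne_top_of_le_ne_top ENNReal.ofReal_ne_top this

lemma exists_tendsto_Iio_of_boundedVariationOn {v : ℝ → ℝ} {G : Set ℝ}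
    (hv : BoundedVariationOn v G) (x : ℝ) : ∃ ℓ, Tendsto v (𝓝[G ∩ Iio x] x) (𝓝 ℓ) := by
  rcases (G ∩ Iio x).eq_empty_or_nonempty with h | hne
  · rw [h]; exact ⟨0, by simp⟩
  refine (hv.mono inter_subset_left).exists_tendsto_left_of_filter _ (fun y hy => ?_) hne
  have h1 : Ioi y ∈ 𝓝[G ∩ Iio x] x := nhdsWithin_le_nhds (Ioi_mem_nhds hy.2)
  filter_upwards [h1, self_mem_nhdsWithin] with z hz hz' using ⟨hz', (mem_Ioi.1 hz).le⟩

lemma exists_tendsto_Ioi_of_boundedVariationOn {v : ℝ → ℝ} {G : Set ℝ}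
    (hv : BoundedVariationOn v G) (x : ℝ) : ∃ ℓ, Tendsto v (𝓝[G ∩ Ioi x] x) (𝓝 ℓ) := by
  -- Reflection reduces right limits to left limits.
  have h1 : BoundedVariationOn (fun y => v (-y)) (Neg.neg ⁻¹' G) := by
    refine ne_top_of_le_ne_top hv (eVariationOn.comp_le_of_antitoneOn v Neg.neg ?_ ?_)
    · intro a _ b _ hab; exact neg_le_neg hab
    · intro y hy; exact hy
  obtain ⟨ℓ, hℓ⟩ := exists_tendsto_Iio_of_boundedVariationOn h1 (-x)
  refine ⟨ℓ, ?_⟩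
  have h2 : Tendsto (fun y : ℝ => -y) (𝓝[G ∩ Ioi x] x) (𝓝[Neg.neg ⁻¹' G ∩ Iio (-x)] (-x)) := by
    refine tendsto_nhdsWithin_iff.2 ⟨?_, ?_⟩
    · exact (continuous_neg.tendsto x).mono_left nhdsWithin_le_nhds
    · filter_upwards [self_mem_nhdsWithin] with y hy
      exact ⟨by simpa using hy.1, by simpa using hy.2⟩
  have := hℓ.comp h2
  simpa [Function.comp_def] using this

end

/-! ### Functions with one-sided limits, and the structure of the limiting class. -/

section

variable {H : ℝ}

section limits

variable {v : ℝ → ℝ} {G : Set ℝ}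

lemma nhdsWithin_inter_Ioi_neBot (hG : ∀ᵐ y ∂(intervalMeasure H), y ∈ G) {x : ℝ}
    (hx : x ∈ Ico (-H) H) : (𝓝[G ∩ Ioi x] x).NeBot := by
  rw [← mem_closure_iff_nhdsWithin_neBot, Metric.mem_closure_iff]
  intro ε hε
  obtain ⟨y, hy, hyG⟩ := exists_mem_Ioo_of_ae hG hx.1 (min_le_right (x + ε) H)
    (lt_min (by linarith) hx.2)
  refine ⟨y, ⟨hyG, hy.1⟩, ?_⟩
  rw [dist_comm, Real.dist_eq, abs_of_pos (by linarith [hy.1])]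
  linarith [hy.2.trans_le (min_le_left _ _)]

lemma nhdsWithin_inter_Iio_neBot (hG : ∀ᵐ y ∂(intervalMeasure H), y ∈ G) {x : ℝ}
    (hx : x ∈ Ioc (-H) H) : (𝓝[G ∩ Iio x] x).NeBot := by
  rw [← mem_closure_iff_nhdsWithin_neBot, Metric.mem_closure_iff]
  intro ε hε
  obtain ⟨y, hy, hyG⟩ := exists_mem_Ioo_of_ae hG (le_max_right (x - ε) (-H)) hx.2
    (max_lt (by linarith) hx.1)
  refine ⟨y, ⟨hyG, hy.2⟩, ?_⟩
  rw [Real.dist_eq, abs_of_pos (by linarith [hy.2])]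
  linarith [(le_max_left _ _).trans_lt hy.1]

lemma lintegral_abs_sub_le_of_forall {s t c η : ℝ} (hη : 0 ≤ η)
    (h : ∀ᵐ y ∂(volume.restrict (Ioo s t)), |v y - c| ≤ η) :
    ∫⁻ y in Ioo s t, ENNReal.ofReal |v y - c| ≤ ENNReal.ofReal (η * (t - s)) := by
  refine (lintegral_mono_ae (h.mono fun y hy => ENNReal.ofReal_le_ofReal hy)).trans ?_
  rw [lintegral_const, Measure.restrict_apply_univ, Real.volume_Ioo, ← ENNReal.ofReal_mul hη]

lemma hasRightTrace_of_tendsto (hG : ∀ᵐ y ∂(intervalMeasure H), y ∈ G) {x ℓ : ℝ}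
    (hx : x ∈ Ico (-H) H) (h : Tendsto v (𝓝[G ∩ Ioi x] x) (𝓝 ℓ)) : HasRightTrace v x ℓ := by
  refine trace_of_lintegral_le (I := fun r => Ioo x (x + r)) fun η hη => ?_
  obtain ⟨δ, hδ, hδ'⟩ := Metric.mem_nhdsWithin_iff.1 (h (Metric.closedBall_mem_nhds ℓ hη))
  filter_upwards [eventually_small (lt_min hδ (sub_pos.2 hx.2))] with r hr
  have h1 := lt_of_lt_of_le hr.2 (min_le_left _ _)
  have h2 := lt_of_lt_of_le hr.2 (min_le_right _ _)
  refine (lintegral_abs_sub_le_of_forall hη.le ?_).trans_eq (by rw [add_sub_cancel_left])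
  have h3 := ae_restrict_Ioo_of_ae hG hx.1 (by linarith : x + r ≤ H)
  rw [ae_restrict_iff' measurableSet_Ioo] at h3 ⊢
  filter_upwards [h3] with y hy hyI
  refine hδ' ⟨?_, hy hyI, hyI.1⟩
  rw [Metric.mem_ball, Real.dist_eq, abs_of_pos (by linarith [hyI.1])]
  linarith [hyI.2]

lemma hasLeftTrace_of_tendsto (hG : ∀ᵐ y ∂(intervalMeasure H), y ∈ G) {x ℓ : ℝ}
    (hx : x ∈ Ioc (-H) H) (h : Tendsto v (𝓝[G ∩ Iio x] x) (𝓝 ℓ)) : HasLeftTrace v x ℓ := by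
  refine trace_of_lintegral_le (I := fun r => Ioo (x - r) x) fun η hη => ?_
  obtain ⟨δ, hδ, hδ'⟩ := Metric.mem_nhdsWithin_iff.1 (h (Metric.closedBall_mem_nhds ℓ hη))
  filter_upwards [eventually_small (lt_min hδ (sub_pos.2 hx.1))] with r hr
  have h1 := lt_of_lt_of_le hr.2 (min_le_left _ _)
  have h2 := lt_of_lt_of_le hr.2 (min_le_right _ _)
  refine (lintegral_abs_sub_le_of_forall hη.le ?_).trans_eq (by rw [sub_sub_cancel])
  have h3 := ae_restrict_Ioo_of_ae hG (by linarith : -H ≤ x - r) hx.2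
  rw [ae_restrict_iff' measurableSet_Ioo] at h3 ⊢
  filter_upwards [h3] with y hy hyI
  refine hδ' ⟨?_, hy hyI, hyI.2⟩
  rw [Metric.mem_ball, Real.dist_eq, abs_of_neg (by linarith [hyI.2])]
  linarith [hyI.1]

lemma eq_of_hasRightTrace_of_tendsto (hG : ∀ᵐ y ∂(intervalMeasure H), y ∈ G) {x c ℓ : ℝ}
    (hx : x ∈ Ico (-H) H) (hc : HasRightTrace v x c) (h : Tendsto v (𝓝[G ∩ Ioi x] x) (𝓝 ℓ)) :
    c = ℓ := by
  refine eq_of_forall_dist_le fun η hη => ?_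
  obtain ⟨δ, hδ, hδ'⟩ := Metric.mem_nhdsWithin_iff.1 (h (Metric.closedBall_mem_nhds ℓ (half_pos hη)))
  obtain ⟨r, ⟨y, hy, hyG, hyc⟩, hr⟩ :=
    ((exists_close_of_rightTrace hx hc hG (half_pos hη)).and (eventually_small hδ)).exists
  have h1 : |v y - ℓ| ≤ η / 2 := by
    refine hδ' ⟨?_, hyG, hy.1⟩
    rw [Metric.mem_ball, Real.dist_eq, abs_of_pos (by linarith [hy.1])]
    linarith [hy.2, hr.2]
  rw [Real.dist_eq]
  rw [abs_le] at h1 ⊢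
  rw [abs_lt] at hyc
  constructor <;> linarith [h1.1, h1.2, hyc.1, hyc.2]

lemma eq_of_hasLeftTrace_of_tendsto (hG : ∀ᵐ y ∂(intervalMeasure H), y ∈ G) {x c ℓ : ℝ}
    (hx : x ∈ Ioc (-H) H) (hc : HasLeftTrace v x c) (h : Tendsto v (𝓝[G ∩ Iio x] x) (𝓝 ℓ)) :
    c = ℓ := by
  refine eq_of_forall_dist_le fun η hη => ?_
  obtain ⟨δ, hδ, hδ'⟩ := Metric.mem_nhdsWithin_iff.1 (h (Metric.closedBall_mem_nhds ℓ (half_pos hη)))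
  obtain ⟨r, ⟨y, hy, hyG, hyc⟩, hr⟩ :=
    ((exists_close_of_leftTrace hx hc hG (half_pos hη)).and (eventually_small hδ)).exists
  have h1 : |v y - ℓ| ≤ η / 2 := by
    refine hδ' ⟨?_, hyG, hy.2⟩
    rw [Metric.mem_ball, Real.dist_eq, abs_of_neg (by linarith [hy.2])]
    linarith [hy.1, hr.2]
  rw [Real.dist_eq]
  rw [abs_le] at h1 ⊢
  rw [abs_lt] at hyc
  constructor <;> linarith [h1.1, h1.2, hyc.1, hyc.2]

lemma rightTrace_spec {x : ℝ} (h : ∃ c, HasRightTrace v x c) :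
    HasRightTrace v x (rightTrace v x) := by
  unfold rightTrace; rw [dif_pos h]; exact h.choose_spec

lemma leftTrace_spec {x : ℝ} (h : ∃ c, HasLeftTrace v x c) :
    HasLeftTrace v x (leftTrace v x) := by
  unfold leftTrace; rw [dif_pos h]; exact h.choose_spec

end limits

/-- `v` has one-sided limits along a set `G` of full measure, given by its traces. -/
structure Regulated (H : ℝ) (v : ℝ → ℝ) (G : Set ℝ) : Prop where
  ae_mem : ∀ᵐ y ∂(intervalMeasure H), y ∈ G
  right : ∀ x ∈ Ico (-H) H, Tendsto v (𝓝[G ∩ Ioi x] x) (𝓝 (rightTrace v x))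
  left : ∀ x ∈ Ioc (-H) H, Tendsto v (𝓝[G ∩ Iio x] x) (𝓝 (leftTrace v x))

namespace Regulated

variable {v : ℝ → ℝ} {G : Set ℝ}

/-- A limit along a set of full measure is a trace, and traces are unique, so any existing limit is
the value selected by `rightTrace` or `leftTrace`. -/
lemma of_exists (hG : ∀ᵐ y ∂(intervalMeasure H), y ∈ G)
    (hr : ∀ x ∈ Ico (-H) H, ∃ ℓ, Tendsto v (𝓝[G ∩ Ioi x] x) (𝓝 ℓ))
    (hl : ∀ x ∈ Ioc (-H) H, ∃ ℓ, Tendsto v (𝓝[G ∩ Iio x] x) (𝓝 ℓ)) : Regulated H v G := by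
  refine ⟨hG, fun x hx => ?_, fun x hx => ?_⟩
  · obtain ⟨ℓ, hℓ⟩ := hr x hx
    have := eq_of_hasRightTrace_of_tendsto hG hx
      (rightTrace_spec ⟨ℓ, hasRightTrace_of_tendsto hG hx hℓ⟩) hℓ
    rwa [this]
  · obtain ⟨ℓ, hℓ⟩ := hl x hx
    have := eq_of_hasLeftTrace_of_tendsto hG hx
      (leftTrace_spec ⟨ℓ, hasLeftTrace_of_tendsto hG hx hℓ⟩) hℓ
    rwa [this]

variable (h : Regulated H v G)
include h

lemma hasRightTrace {x : ℝ} (hx : x ∈ Ico (-H) H) : HasRightTrace v x (rightTrace v x) :=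
  hasRightTrace_of_tendsto h.ae_mem hx (h.right x hx)

lemma hasLeftTrace {x : ℝ} (hx : x ∈ Ioc (-H) H) : HasLeftTrace v x (leftTrace v x) :=
  hasLeftTrace_of_tendsto h.ae_mem hx (h.left x hx)

lemma rightTrace_eq {x c : ℝ} (hx : x ∈ Ico (-H) H) (hc : HasRightTrace v x c) :
    rightTrace v x = c :=
  (eq_of_hasRightTrace_of_tendsto h.ae_mem hx hc (h.right x hx)).symm

lemma leftTrace_eq {x c : ℝ} (hx : x ∈ Ioc (-H) H) (hc : HasLeftTrace v x c) :
    leftTrace v x = c :=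
  (eq_of_hasLeftTrace_of_tendsto h.ae_mem hx hc (h.left x hx)).symm

lemma mem_of_forall {s t : ℝ} (hs : -H ≤ s) (ht : t ≤ H) {K : Set ℝ} (hK : IsClosed K)
    (hvK : ∀ y ∈ G, y ∈ Ioo s t → v y ∈ K) {x : ℝ} (hx : x ∈ Ioo s t) :
    rightTrace v x ∈ K ∧ leftTrace v x ∈ K := by
  have hx1 : x ∈ Ico (-H) H := ⟨by linarith [hx.1], by linarith [hx.2]⟩
  have hx2 : x ∈ Ioc (-H) H := ⟨by linarith [hx.1], by linarith [hx.2]⟩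
  have := nhdsWithin_inter_Ioi_neBot h.ae_mem hx1
  have := nhdsWithin_inter_Iio_neBot h.ae_mem hx2
  have hnear : Ioo s t ∈ 𝓝 x := Ioo_mem_nhds hx.1 hx.2
  constructor
  · refine hK.mem_of_tendsto (h.right x hx1) ?_
    filter_upwards [nhdsWithin_le_nhds hnear, self_mem_nhdsWithin] with y hy hy'
    exact hvK y hy'.1 hy
  · refine hK.mem_of_tendsto (h.left x hx2) ?_
    filter_upwards [nhdsWithin_le_nhds hnear, self_mem_nhdsWithin] with y hy hy'
    exact hvK y hy'.1 hy

lemma eventually_right {x : ℝ} (hx : x ∈ Ico (-H) H) {η : ℝ} (hη : 0 < η) :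
    ∀ᶠ y in 𝓝[>] x, |rightTrace v y - rightTrace v x| ≤ η ∧ |leftTrace v y - rightTrace v x| ≤ η := by
  obtain ⟨δ, hδ, hδ'⟩ := Metric.mem_nhdsWithin_iff.1 (h.right x hx (Metric.closedBall_mem_nhds _ hη))
  have hlt : x < min (x + δ) H := lt_min (by linarith) hx.2
  filter_upwards [Ioo_mem_nhdsGT hlt] with y hy
  refine h.mem_of_forall hx.1 (min_le_right _ _) Metric.isClosed_closedBall (fun z hz hzI => ?_) hy
  refine hδ' ⟨?_, hz, hzI.1⟩
  rw [Metric.mem_ball, Real.dist_eq, abs_of_pos (by linarith [hzI.1])]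
  linarith [hzI.2.trans_le (min_le_left _ _)]

lemma eventually_left {x : ℝ} (hx : x ∈ Ioc (-H) H) {η : ℝ} (hη : 0 < η) :
    ∀ᶠ y in 𝓝[<] x, |rightTrace v y - leftTrace v x| ≤ η ∧ |leftTrace v y - leftTrace v x| ≤ η := by
  obtain ⟨δ, hδ, hδ'⟩ := Metric.mem_nhdsWithin_iff.1 (h.left x hx (Metric.closedBall_mem_nhds _ hη))
  have hlt : max (x - δ) (-H) < x := max_lt (by linarith) hx.1
  filter_upwards [Ioo_mem_nhdsLT hlt] with y hy
  refine h.mem_of_forall (le_max_right _ _) hx.2 Metric.isClosed_closedBall (fun z hz hzI => ?_) hy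
  refine hδ' ⟨?_, hz, hzI.2⟩
  rw [Metric.mem_ball, Real.dist_eq, abs_of_neg (by linarith [hzI.2])]
  linarith [(le_max_left _ _).trans_lt hzI.1]

lemma tendsto_rightTrace_right {x : ℝ} (hx : x ∈ Ico (-H) H) :
    Tendsto (rightTrace v) (𝓝[>] x) (𝓝 (rightTrace v x)) :=
  Metric.tendsto_nhds.2 fun η hη => (h.eventually_right hx (half_pos hη)).mono fun y hy => by
    rw [Real.dist_eq]; linarith [hy.1]

lemma tendsto_rightTrace_left {x : ℝ} (hx : x ∈ Ioc (-H) H) :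
    Tendsto (rightTrace v) (𝓝[<] x) (𝓝 (leftTrace v x)) :=
  Metric.tendsto_nhds.2 fun η hη => (h.eventually_left hx (half_pos hη)).mono fun y hy => by
    rw [Real.dist_eq]; linarith [hy.1]

lemma leftTrace_eq_rightTrace {x : ℝ} (hx : x ∈ Ioo (-H) H) (hJ : x ∉ jumpSet H v) :
    leftTrace v x = rightTrace v x := by
  by_contra hne
  exact hJ ⟨hx, _, _, hne, h.hasLeftTrace (Ioo_subset_Ioc_self hx),
    h.hasRightTrace (Ioo_subset_Ico_self hx)⟩

lemma leftTrace_ne_rightTrace {x : ℝ} (hJ : x ∈ jumpSet H v) :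
    leftTrace v x ≠ rightTrace v x := by
  obtain ⟨hx, cl, cr, hne, hl, hr⟩ := hJ
  rwa [h.leftTrace_eq (Ioo_subset_Ioc_self hx) hl, h.rightTrace_eq (Ioo_subset_Ico_self hx) hr]

/-- The function `rightTrace v` has the left and right traces of v as its one-sided limits, and
these coincide off the jump set. -/
lemma continuousAt_rightTrace {x : ℝ} (hx : x ∈ Ioo (-H) H) (hJ : x ∉ jumpSet H v) :
    ContinuousAt (rightTrace v) x := by
  rw [continuousAt_iff_punctured_nhds, ← Set.Iio_union_Ioi, nhdsWithin_union, tendsto_sup]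
  refine ⟨?_, h.tendsto_rightTrace_right (Ioo_subset_Ico_self hx)⟩
  rw [← h.leftTrace_eq_rightTrace hx hJ]
  exact h.tendsto_rightTrace_left (Ioo_subset_Ioc_self hx)

/-- Only finitely many jumps exceed a given height. -/
lemma finite_jumps {η : ℝ} (hη : 0 < η) :
    {x | x ∈ Ioo (-H) H ∧ η ≤ |rightTrace v x - leftTrace v x|}.Finite := by
  by_contra hinf
  -- Infinitely many large jumps would accumulate at some x in the closed interval. On each side of
  -- x all traces lie within η/3 of the same one-sided limit, so jumps there are at most 2η/3.
  obtain ⟨x, hx, hacc⟩ := Set.Infinite.exists_accPt_of_subset_isCompact hinf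
    (isCompact_Icc (a := -H) (b := H)) fun x hx => Ioo_subset_Icc_self hx.1
  rw [accPt_iff_frequently_nhdsNE] at hacc
  refine hacc ?_
  rw [← Set.Iio_union_Ioi, nhdsWithin_union, eventually_sup]
  have hη3 : 0 < η / 3 := by positivity
  constructor
  · rcases eq_or_lt_of_le hx.1 with h1 | h1
    · filter_upwards [self_mem_nhdsWithin] with y hy hy'
      rw [← h1] at hy
      exact absurd hy'.1.1 (not_lt.2 (mem_Iio.1 hy).le)
    · filter_upwards [h.eventually_left ⟨h1, hx.2⟩ hη3] with y hy hy'
      have h3 := abs_sub_le (rightTrace v y) (leftTrace v x) (leftTrace v y)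
      rw [abs_sub_comm (leftTrace v x)] at h3
      linarith [hy.1, hy.2, hy'.2]
  · rcases eq_or_lt_of_le hx.2 with h1 | h1
    · filter_upwards [self_mem_nhdsWithin] with y hy hy'
      rw [h1] at hy
      exact absurd hy'.1.2 (not_lt.2 (mem_Ioi.1 hy).le)
    · filter_upwards [h.eventually_right ⟨hx.1, h1⟩ hη3] with y hy hy'
      have h3 := abs_sub_le (rightTrace v y) (rightTrace v x) (leftTrace v y)
      rw [abs_sub_comm (rightTrace v x)] at h3
      linarith [hy.1, hy.2, hy'.2]

omit h in
lemma rightTrace_ae_eq (h : Regulated H v G) (hv : Integrable v (intervalMeasure H)) :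
    rightTrace v =ᵐ[intervalMeasure H] v := by
  filter_upwards [ae_hasTrace hv,
    ae_intervalMeasure (Eventually.of_forall fun x (hx : x ∈ Ioo (-H) H) => hx)] with x hx hxI
  exact h.rightTrace_eq (Ioo_subset_Ico_self hxI) hx.2

lemma rightTrace_sq {f : ℝ → ℝ} (hf : ContinuousOn f (Icc (-H) H))
    (hfG : ∀ y ∈ G, y ∈ Icc (-H) H ∧ v y ^ 2 + f y ^ 2 = 1) {x : ℝ} (hx : x ∈ Ico (-H) H) :
    rightTrace v x ^ 2 + f x ^ 2 = 1 := by
  have := nhdsWithin_inter_Ioi_neBot h.ae_mem hx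
  have h1 : Tendsto f (𝓝[G ∩ Ioi x] x) (𝓝 (f x)) :=
    (hf x (Ico_subset_Icc_self hx)).mono_left (nhdsWithin_mono _ fun y hy => (hfG y hy.1).1)
  have h2 := ((h.right x hx).pow 2).add (h1.pow 2)
  refine tendsto_nhds_unique h2 (tendsto_const_nhds.congr' ?_)
  filter_upwards [self_mem_nhdsWithin] with y hy using (hfG y hy.1).2.symm

lemma leftTrace_sq {f : ℝ → ℝ} (hf : ContinuousOn f (Icc (-H) H))
    (hfG : ∀ y ∈ G, y ∈ Icc (-H) H ∧ v y ^ 2 + f y ^ 2 = 1) {x : ℝ} (hx : x ∈ Ioc (-H) H) :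
    leftTrace v x ^ 2 + f x ^ 2 = 1 := by
  have := nhdsWithin_inter_Iio_neBot h.ae_mem hx
  have h1 : Tendsto f (𝓝[G ∩ Iio x] x) (𝓝 (f x)) :=
    (hf x (Ioc_subset_Icc_self hx)).mono_left (nhdsWithin_mono _ fun y hy => (hfG y hy.1).1)
  have h2 := ((h.left x hx).pow 2).add (h1.pow 2)
  refine tendsto_nhds_unique h2 (tendsto_const_nhds.congr' ?_)
  filter_upwards [self_mem_nhdsWithin] with y hy using (hfG y hy.1).2.symm

end Regulated

/-- If d² ≠ 1 then v = v³ / (1 - f²) near the limit. If d² = 1 the constraint forces v² → 0. -/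
lemma exists_tendsto_of_cube {v f : ℝ → ℝ} {l : Filter ℝ} {ℓ d : ℝ}
    (h3 : Tendsto (fun y => v y ^ 3) l (𝓝 ℓ)) (hf : Tendsto f l (𝓝 d))
    (h : ∀ᶠ y in l, v y ^ 2 + f y ^ 2 = 1) : ∃ ℓ', Tendsto v l (𝓝 ℓ') := by
  have h1 : Tendsto (fun y => 1 - f y ^ 2) l (𝓝 (1 - d ^ 2)) := (hf.pow 2).const_sub 1
  by_cases hd : 1 - d ^ 2 = 0
  · refine ⟨0, ?_⟩
    rw [hd] at h1
    have h2 : Tendsto (fun y => v y ^ 2) l (𝓝 0) := h1.congr' (h.mono fun y hy => by linarith)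
    have h4 := h2.sqrt
    rw [Real.sqrt_zero] at h4
    refine (tendsto_zero_iff_abs_tendsto_zero _).2 (h4.congr fun y => ?_)
    rw [Real.sqrt_sq_eq_abs]; rfl
  · refine ⟨ℓ / (1 - d ^ 2), (h3.div h1 hd).congr' ?_⟩
    filter_upwards [h, h1.eventually_ne hd] with y hy hy'
    rw [Pi.div_apply]
    have : 1 - f y ^ 2 = v y ^ 2 := by linarith
    rw [this] at hy' ⊢
    field_simp

/-- The structure of the first component of a field in the limiting class. -/
lemma exists_regulated {a : ℝ} {u : ℝ → ℝ × ℝ} (hu : MemA0 H a u) {f : ℝ → ℝ}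
    (hf : ContinuousOn f (Icc (-H) H)) (hfu : f =ᵐ[intervalMeasure H] fun y => (u y).2) :
    Integrable (fun y => (u y).1) (intervalMeasure H) ∧
    ∃ G, Regulated H (fun y => (u y).1) G ∧
      ∀ y ∈ G, y ∈ Icc (-H) H ∧ (u y).1 ^ 2 + f y ^ 2 = 1 := by
  obtain ⟨hBV, -, -, -, h1⟩ := hu
  set v : ℝ → ℝ := fun y => (u y).1 with hv
  have hsq : ∀ᵐ y ∂(intervalMeasure H), v y ^ 2 + f y ^ 2 = 1 := by
    filter_upwards [h1, hfu] with y hy hy'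
    rw [hy']; exact hy
  have hfm : AEStronglyMeasurable f (intervalMeasure H) :=
    (hf.mono Ioo_subset_Icc_self).aestronglyMeasurable measurableSet_Ioo
  -- Measurability is known only for v³. The quotient v³ / (1 - f²) equals v also where v = 0,
  -- because 0 / 0 = 0.
  have hvm : AEStronglyMeasurable v (intervalMeasure H) := by
    have : AEMeasurable (fun y => v y ^ 3 / (1 - f y ^ 2)) (intervalMeasure H) :=
      hBV.1.aestronglyMeasurable.aemeasurable.div
        ((hfm.aemeasurable.pow_const 2).const_sub 1)
    refine this.aestronglyMeasurable.congr ?_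
    filter_upwards [hsq] with y hy
    have e : 1 - f y ^ 2 = v y ^ 2 := by linarith
    rw [e]
    rcases eq_or_ne (v y) 0 with h0 | h0
    · simp [h0]
    · field_simp
  have hvi : Integrable v (intervalMeasure H) := by
    refine Integrable.of_bound hvm 1 ?_
    filter_upwards [hsq] with y hy
    rw [Real.norm_eq_abs, ← sq_le_one_iff_abs_le_one]
    nlinarith [sq_nonneg (f y)]
  refine ⟨hvi, {y | y ∈ Ioo (-H) H ∧ v y ^ 2 + f y ^ 2 = 1 ∧
    HasLeftTrace (fun y => v y ^ 3) y (v y ^ 3) ∧ HasRightTrace (fun y => v y ^ 3) y (v y ^ 3)}, ?_,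
    fun y hy => ⟨Ioo_subset_Icc_self hy.1, hy.2.1⟩⟩
  set G := {y | y ∈ Ioo (-H) H ∧ v y ^ 2 + f y ^ 2 = 1 ∧
    HasLeftTrace (fun y => v y ^ 3) y (v y ^ 3) ∧ HasRightTrace (fun y => v y ^ 3) y (v y ^ 3)}
    with hG
  have hGae : ∀ᵐ y ∂(intervalMeasure H), y ∈ G := by
    filter_upwards [hsq, ae_hasTrace hBV.1,
      ae_intervalMeasure (Eventually.of_forall fun x (hx : x ∈ Ioo (-H) H) => hx)] with y h2 h3 h4
    exact ⟨h4, h2, h3.1, h3.2⟩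
  have hGBV : BoundedVariationOn (fun y => v y ^ 3) G :=
    boundedVariationOn_of_memBV hBV (fun y hy => hy.1) fun y hy => hy.2.2
  refine Regulated.of_exists hGae (fun x hx => ?_) (fun x hx => ?_)
  · obtain ⟨ℓ, hℓ⟩ := exists_tendsto_Ioi_of_boundedVariationOn hGBV x
    refine exists_tendsto_of_cube hℓ ((hf x (Ico_subset_Icc_self hx)).mono_left
      (nhdsWithin_mono _ fun y hy => Ioo_subset_Icc_self hy.1.1)) ?_
    filter_upwards [self_mem_nhdsWithin] with y hy using hy.1.2.1
  · obtain ⟨ℓ, hℓ⟩ := exists_tendsto_Iio_of_boundedVariationOn hGBV x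
    refine exists_tendsto_of_cube hℓ ((hf x (Ioc_subset_Icc_self hx)).mono_left
      (nhdsWithin_mono _ fun y hy => Ioo_subset_Icc_self hy.1.1)) ?_
    filter_upwards [self_mem_nhdsWithin] with y hy using hy.1.2.1

end

/-! ### The Modica–Mortola lower bound for a single wall and for finitely many walls. -/

section

variable {H : ℝ}

lemma ACL2.aemeasurable (hH : 0 < H) {w : ℝ → ℝ} (hw : ACL2 H w) :
    AEMeasurable w (intervalMeasure H) := (hw.memLp_self hH).aestronglyMeasurable.aemeasurable

/-- The Modica–Mortola part of the energy density of `(w₁, w₂)`. -/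
def wallDensity (ε : ℝ) (w₁ w₂ : ℝ → ℝ) (y : ℝ) : ℝ :=
  1 / 2 * (ε * (deriv w₁ y ^ 2 + deriv w₂ y ^ 2) + (1 / ε) * (w₁ y ^ 2 + w₂ y ^ 2 - 1) ^ 2)

lemma wallDensity_nonneg {ε : ℝ} (hε : 0 < ε) (w₁ w₂ : ℝ → ℝ) (y : ℝ) :
    0 ≤ wallDensity ε w₁ w₂ y := by
  unfold wallDensity; positivity

lemma aemeasurable_wallDensity (hH : 0 < H) {ε : ℝ} {w₁ w₂ : ℝ → ℝ} (h₁ : ACL2 H w₁)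
    (h₂ : ACL2 H w₂) : AEMeasurable (wallDensity ε w₁ w₂) (intervalMeasure H) := by
  have m1 := (measurable_deriv w₁).aemeasurable (μ := intervalMeasure H)
  have m2 := (measurable_deriv w₂).aemeasurable (μ := intervalMeasure H)
  have m3 := h₁.aemeasurable hH
  have m4 := h₂.aemeasurable hH
  unfold wallDensity
  fun_prop

lemma energyEps_eq (hH : 0 < H) {L ε : ℝ} (hL : 0 < L) (hε : 0 < ε) {u : ℝ → ℝ × ℝ} {w₁ w₂ : ℝ → ℝ}
    (h₁ : ACL2 H w₁) (h₂ : ACL2 H w₂) (e₁ : w₁ =ᵐ[intervalMeasure H] fun y => (u y).1)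
    (e₂ : w₂ =ᵐ[intervalMeasure H] fun y => (u y).2) :
    energyEps H L ε u
      = ENNReal.ofReal (L / 2) * ∫⁻ y, ENNReal.ofReal (deriv w₂ y ^ 2) ∂(intervalMeasure H)
        + ∫⁻ y, ENNReal.ofReal (wallDensity ε w₁ w₂ y) ∂(intervalMeasure H) := by
  have m2 : AEMeasurable (fun y => ENNReal.ofReal (deriv w₂ y ^ 2)) (intervalMeasure H) :=
    ((measurable_deriv w₂).pow_const 2).ennreal_ofReal.aemeasurable
  have h2 : (1 / 2 : ℝ≥0∞) = ENNReal.ofReal (1 / 2) := by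
    rw [ENNReal.ofReal_div_of_pos (by norm_num)]; simp
  unfold energyEps
  rw [h2, ← lintegral_const_mul' _ _ ENNReal.ofReal_ne_top,
    ← lintegral_const_mul' _ _ ENNReal.ofReal_ne_top,
    ← lintegral_add_left' (m2.const_mul _)]
  refine lintegral_congr_ae ?_
  filter_upwards [e₁, e₂, h₁.weakDeriv_ae hH e₁, h₂.weakDeriv_ae hH e₂] with y h3 h4 h5 h6
  rw [← ENNReal.ofReal_mul (by positivity), ← ENNReal.ofReal_mul (by positivity),
    ← ENNReal.ofReal_add (by positivity) (wallDensity_nonneg hε _ _ _)]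
  simp only [h5, h6]
  rw [← h3, ← h4]
  unfold wallDensity
  congr 1; ring

section wall

/-- G is a primitive of the positive part of k - s². The truncation makes G monotone, so
overshooting ±z loses nothing, and the increment over [-z, z] is at least ∫ (k - s²) = 2kz - 2z³/3.
-/
lemma exists_wall_potential {k : ℝ} (hk : 0 ≤ k) :
    ∃ G : ℝ → ℝ, (∀ x, HasDerivAt G (max (k - x ^ 2) 0) x) ∧
      (∀ x y, |G x - G y| ≤ k * |x - y|) ∧
      ∀ z x y, 0 ≤ z → x ≤ -z → z ≤ y → 2 * k * z - 2 * z ^ 3 / 3 ≤ G y - G x := by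
  have hc : Continuous fun s : ℝ => max (k - s ^ 2) 0 := by fun_prop
  set G : ℝ → ℝ := fun x => ∫ s in (0 : ℝ)..x, max (k - s ^ 2) 0 with hG
  have hd : ∀ x, HasDerivAt G (max (k - x ^ 2) 0) x := fun x =>
    intervalIntegral.integral_hasDerivAt_right (hc.intervalIntegrable _ _)
      (hc.stronglyMeasurableAtFilter _ _) hc.continuousAt
  have hmono : Monotone G := monotone_of_deriv_nonneg (fun t => (hd t).differentiableAt) fun t => by
    rw [(hd t).deriv]; exact le_max_right _ _
  refine ⟨G, hd, fun x y => ?_, fun z x y hz hx hy => ?_⟩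
  · have := convex_univ.norm_image_sub_le_of_norm_hasDerivWithin_le (C := k)
      (fun x _ => (hd x).hasDerivWithinAt) (fun x _ => ?_) (mem_univ y) (mem_univ x)
    · simpa using this
    · rw [Real.norm_eq_abs, abs_of_nonneg (le_max_right _ _)]
      exact max_le (by nlinarith [sq_nonneg x]) hk
  · have h1 : G z - G (-z) = ∫ s in (-z)..z, max (k - s ^ 2) 0 :=
      intervalIntegral.integral_interval_sub_left (hc.intervalIntegrable _ _)
        (hc.intervalIntegrable _ _)
    have h2 : ∫ s in (-z)..z, (k - s ^ 2) ≤ ∫ s in (-z)..z, max (k - s ^ 2) 0 :=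
      intervalIntegral.integral_mono_on (by linarith)
        ((continuous_const.sub (continuous_pow 2)).intervalIntegrable _ _)
        (hc.intervalIntegrable _ _) fun s _ => le_max_left _ _
    have h3 : ∫ s in (-z)..z, (k - s ^ 2) = 2 * k * z - 2 * z ^ 3 / 3 := by
      rw [intervalIntegral.integral_sub (continuous_const.intervalIntegrable _ _)
        ((continuous_pow 2).intervalIntegrable _ _), integral_pow,
        intervalIntegral.integral_const, smul_eq_mul]
      norm_num
      ring
    have h4 := hmono hx
    have h5 := hmono hy
    linarith

/-- Lower bound for the energy of a transition of `w₁` from `-z` to `z`. -/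
lemma le_lintegral_wallDensity (hH : 0 < H) {ε : ℝ} (hε : 0 < ε) {w₁ w₂ : ℝ → ℝ} (h₁ : ACL2 H w₁)
    {p q k z s t : ℝ} (hp : -H ≤ p) (hq : q ≤ H) (hk : 0 ≤ k) (hz : 0 ≤ z)
    (hw : ∀ y ∈ Icc p q, k ≤ 1 - w₂ y ^ 2) (hs : s ∈ Icc p q) (ht : t ∈ Icc p q)
    (hs1 : w₁ s ≤ -z) (ht1 : z ≤ w₁ t) :
    ENNReal.ofReal (2 * k * z - 2 * z ^ 3 / 3)
      ≤ ∫⁻ y in Ioo p q, ENNReal.ofReal (wallDensity ε w₁ w₂ y) := by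
  obtain ⟨G, hGd, hGl, hG⟩ := exists_wall_potential hk
  have hsub : Icc p q ⊆ Icc (-H) H := Icc_subset_Icc hp hq
  have hGw : ACL2 H (fun y => G (w₁ y)) :=
    (h₁.of_abs_sub_le hH hk fun x _ y _ => hGl (w₁ x) (w₁ y)).1
  have h1 := hG z _ _ hz hs1 ht1
  have h2 := hGw.sub_eq_integral hH (hsub hs) (hsub ht)
  rw [h2] at h1
  have h3 : uIoc s t ⊆ Icc p q := fun y hy => by
    have := uIcc_subset_Icc hs ht (uIoc_subset_uIcc hy); exact this
  calc ENNReal.ofReal (2 * k * z - 2 * z ^ 3 / 3)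
      ≤ ENNReal.ofReal ‖∫ y in s..t, deriv (fun y => G (w₁ y)) y‖ :=
        ENNReal.ofReal_le_ofReal (h1.trans (le_abs_self _))
    _ ≤ ∫⁻ y in uIoc s t, ‖deriv (fun y => G (w₁ y)) y‖ₑ := by
        rw [intervalIntegral.norm_intervalIntegral_eq, ofReal_norm]
        exact enorm_integral_le_lintegral_enorm _
    _ ≤ ∫⁻ y in Icc p q, ‖deriv (fun y => G (w₁ y)) y‖ₑ := lintegral_mono_set h3
    _ = ∫⁻ y in Ioo p q, ‖deriv (fun y => G (w₁ y)) y‖ₑ := by rw [restrict_Ioo_eq_restrict_Icc]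
    _ ≤ ∫⁻ y in Ioo p q, ENNReal.ofReal (wallDensity ε w₁ w₂ y) := by
        refine lintegral_mono_ae ?_
        have := ae_restrict_Ioo_of_ae (h₁.ae_differentiableAt hH) hp hq
        rw [ae_restrict_iff' measurableSet_Ioo] at this ⊢
        filter_upwards [this] with y hy hyI
        have hd := ((hGd (w₁ y)).comp y (hy hyI).hasDerivAt).deriv
        rw [Real.enorm_eq_ofReal_abs]
        refine ENNReal.ofReal_le_ofReal ?_
        have hd' : deriv (fun y => G (w₁ y)) y = max (k - w₁ y ^ 2) 0 * deriv w₁ y := hd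
        rw [hd', abs_mul, abs_of_nonneg (le_max_right _ _)]
        -- The lower bound k for 1 - w₂² on the window replaces the moving well by a fixed one.
        have h6 : max (k - w₁ y ^ 2) 0 ≤ |w₁ y ^ 2 + w₂ y ^ 2 - 1| := by
          refine max_le ?_ (abs_nonneg _)
          have := hw y (Ioo_subset_Icc_self hyI)
          have := neg_abs_le (w₁ y ^ 2 + w₂ y ^ 2 - 1)
          linarith
        have h7 := mul_le_mul_of_nonneg_right h6 (abs_nonneg (deriv w₁ y))
        refine h7.trans ?_
        unfold wallDensity
        set A := |w₁ y ^ 2 + w₂ y ^ 2 - 1| with hA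
        set B := |deriv w₁ y| with hB
        have e1 : (w₁ y ^ 2 + w₂ y ^ 2 - 1) ^ 2 = A ^ 2 := (sq_abs _).symm
        have e2 : deriv w₁ y ^ 2 = B ^ 2 := (sq_abs _).symm
        rw [e1, e2]
        -- Young's inequality with weight ε; equality would mean equipartition, ε |w₁'| = |w₁² + w₂²
        -- - 1|.
        have e3 : A * B ≤ 1 / 2 * (ε * B ^ 2 + 1 / ε * A ^ 2) := by
          have : 1 / 2 * (ε * B ^ 2 + 1 / ε * A ^ 2) - A * B
              = (1 / (2 * ε)) * (ε * B - A) ^ 2 := by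
            field_simp; ring
          have h8 : 0 ≤ (1 / (2 * ε)) * (ε * B - A) ^ 2 := by positivity
          linarith
        have e4 : 0 ≤ ε * deriv w₂ y ^ 2 := by positivity
        linarith

end wall

/-- Fields of bounded energy along a filter, converging to a field with components `v`, `f`. -/
structure ConvergingFields {ι : Type*} (H a M : ℝ) (l : Filter ι) (ε : ι → ℝ) (w₁ w₂ : ι → ℝ → ℝ)
    (v f : ℝ → ℝ) : Prop where
  pos : ∀ᶠ n in l, 0 < ε n
  ac₁ : ∀ n, ACL2 H (w₁ n)
  ac₂ : ∀ n, ACL2 H (w₂ n)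
  left_eq : ∀ n, w₁ n (-H) = -√(1 - a ^ 2)
  right_eq : ∀ n, w₁ n H = √(1 - a ^ 2)
  conv₁ : Tendsto (fun n => ∫⁻ y, ENNReal.ofReal |w₁ n y - v y| ∂(intervalMeasure H)) l (𝓝 0)
  conv₂ : ∀ x ∈ Icc (-H) H, Tendsto (fun n => w₂ n x) l (𝓝 (f x))
  bound : ∀ᶠ n in l, ∫ y, deriv (w₂ n) y ^ 2 ∂(intervalMeasure H) ≤ M

namespace ConvergingFields

variable {ι : Type*} {a M : ℝ} {l : Filter ι} {ε : ι → ℝ} {w₁ w₂ : ι → ℝ → ℝ} {v f : ℝ → ℝ}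

/-- If |w₁ n - c| ≥ η on all of `I r`, then η r is at most the integral of |v - c| plus that of |w₁
n - v|, each of which is at most η r / 4 for suitable r and eventually in n. -/
lemma exists_close (h : ConvergingFields H a M l ε w₁ w₂ v f)
    (hH : 0 < H) (hvm : AEMeasurable v (intervalMeasure H)) {I : ℝ → Set ℝ} {c : ℝ}
    (hI : ∀ r, MeasurableSet (I r)) (hvol : ∀ r, volume (I r) = ENNReal.ofReal r)
    (htr : Tendsto (fun r : ℝ => (∫⁻ y in I r, ENNReal.ofReal |v y - c|) / ENNReal.ofReal r)
      (𝓝[>] 0) (𝓝 0)) {η b : ℝ} (hη : 0 < η) (hb : 0 < b)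
    (hIb : ∀ r, 0 < r → r < b → I r ⊆ Ioo (-H) H) :
    ∃ r, 0 < r ∧ r < b ∧ ∀ᶠ n in l, ∃ y ∈ I r, |w₁ n y - c| < η := by
  obtain ⟨r, hr1, hr0, hrb⟩ :=
    ((lintegral_le_of_trace htr (by positivity : 0 < η / 4)).and (eventually_small hb)).exists
  refine ⟨r, hr0, hrb, ?_⟩
  have hpos : 0 < ENNReal.ofReal (η / 4 * r) := ENNReal.ofReal_pos.2 (by positivity)
  filter_upwards [h.conv₁.eventually_lt_const hpos] with n hn
  by_contra hcon
  push Not at hcon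
  have hle : volume.restrict (I r) ≤ intervalMeasure H := Measure.restrict_mono (hIb r hr0 hrb) le_rfl
  have hm : AEMeasurable (fun y => ENNReal.ofReal |w₁ n y - v y|) (volume.restrict (I r)) :=
    (((((h.ac₁ n).aemeasurable hH).sub hvm).abs).ennreal_ofReal).mono_measure hle
  have h1 : ∫⁻ _ in I r, ENNReal.ofReal η ≤
      ∫⁻ y in I r, (ENNReal.ofReal |v y - c| + ENNReal.ofReal |w₁ n y - v y|) := by
    refine lintegral_mono_ae ((ae_restrict_iff' (hI r)).2 (Eventually.of_forall fun y hy => ?_))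
    rw [← ENNReal.ofReal_add (abs_nonneg _) (abs_nonneg _)]
    refine ENNReal.ofReal_le_ofReal ((hcon y hy).trans ?_)
    have := abs_sub_le (w₁ n y) (v y) c
    linarith
  rw [lintegral_add_right' _ hm, lintegral_const, Measure.restrict_apply_univ, hvol,
    ← ENNReal.ofReal_mul hη.le] at h1
  have h2 := h1.trans (add_le_add hr1 ((lintegral_mono' hle le_rfl).trans hn.le))
  rw [← ENNReal.ofReal_add (by positivity) (by positivity),
    ENNReal.ofReal_le_ofReal_iff (by positivity)] at h2
  nlinarith

/-- Integrates |w'| ≤ τ + |w'|²/τ. With τ large and then |y - x| small, this gives equicontinuity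
depending only on M. -/
lemma abs_sub_le_of_bound (hH : 0 < H) {w : ℝ → ℝ} (hw : ACL2 H w)
    (hM : ∫ y, deriv w y ^ 2 ∂(intervalMeasure H) ≤ M) {x y τ : ℝ} (hτ : 0 < τ)
    (hx : x ∈ Icc (-H) H) (hy : y ∈ Icc (-H) H) : |w y - w x| ≤ τ * |y - x| + M / τ := by
  wlog hxy : x ≤ y generalizing x y
  · have := this hy hx (le_of_not_ge hxy)
    rwa [abs_sub_comm, abs_sub_comm y x]
  have hint : Integrable (fun t => deriv w t ^ 2) (intervalMeasure H) := hw.memLp.integrable_sq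
  have hsubset : Ioc x y ⊆ Icc (-H) H := fun t ht => ⟨by linarith [hx.1, ht.1], ht.2.trans hy.2⟩
  have hint2 : IntegrableOn (fun t => deriv w t ^ 2) (Ioc x y) := by
    refine IntegrableOn.mono_set (t := Icc (-H) H) ?_ hsubset
    rw [IntegrableOn, ← restrict_Ioo_eq_restrict_Icc]; exact hint
  have hintτ : IntegrableOn (fun t => τ + (1 / τ) * deriv w t ^ 2) (Ioc x y) :=
    (integrable_const τ).add (hint2.const_mul _)
  rw [hw.sub_eq_integral hH hx hy]
  have h1 := intervalIntegral.norm_integral_le_integral_norm (μ := volume) (f := deriv w) hxy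
  have h2 : ∫ t in x..y, ‖deriv w t‖ ≤ ∫ t in x..y, (τ + (1 / τ) * deriv w t ^ 2) := by
    refine intervalIntegral.integral_mono_on hxy
      (intervalIntegrable_of_mem hH (integrable_of_memLp_two hw.memLp) hx hy).norm
      ((intervalIntegrable_iff_integrableOn_Ioc_of_le hxy).2 hintτ) fun t _ => ?_
    rw [Real.norm_eq_abs, ← sq_abs]
    have : τ + 1 / τ * |deriv w t| ^ 2 - |deriv w t|
        = (1 / τ) * ((τ - |deriv w t| / 2) ^ 2 + 3 / 4 * |deriv w t| ^ 2) := by field_simp; ring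
    have h8 : 0 ≤ (1 / τ) * ((τ - |deriv w t| / 2) ^ 2 + 3 / 4 * |deriv w t| ^ 2) := by positivity
    linarith
  have h3 : ∫ t in x..y, (τ + (1 / τ) * deriv w t ^ 2) ≤ τ * (y - x) + M / τ := by
    rw [intervalIntegral.integral_of_le hxy, integral_add (integrable_const τ) (hint2.const_mul _),
      integral_const_mul]
    have h4 : ∫ t in Ioc x y, deriv w t ^ 2 ≤ M := by
      refine le_trans ?_ hM
      have e : ∫ t, deriv w t ^ 2 ∂(intervalMeasure H) = ∫ t in Icc (-H) H, deriv w t ^ 2 := by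
        rw [← restrict_Ioo_eq_restrict_Icc]; rfl
      rw [e]
      refine setIntegral_mono_set ?_ (Eventually.of_forall fun t => sq_nonneg _)
        hsubset.eventuallyLE
      rw [IntegrableOn, ← restrict_Ioo_eq_restrict_Icc]; exact hint
    have h5 : (1 / τ) * ∫ t in Ioc x y, deriv w t ^ 2 ≤ M / τ := by
      rw [div_mul_eq_mul_div, one_mul]; gcongr
    have h6 : ∫ _ in Ioc x y, τ = τ * (y - x) := by
      rw [setIntegral_const, measureReal_def, Real.volume_Ioc, ENNReal.toReal_ofReal (by linarith),
        smul_eq_mul, mul_comm]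
    rw [h6]; linarith
  rw [abs_of_nonneg (by linarith : 0 ≤ y - x)]
  exact h1.trans (h2.trans h3)

/-- The first component of the fields changes sign near `x`, between the extreme values allowed by
the limit. -/
def WallAt (H : ℝ) (l : Filter ι) (w₁ : ι → ℝ → ℝ) (f : ℝ → ℝ) (x : ℝ) : Prop :=
  ∀ r > 0, ∀ lam > 0, ∀ᶠ n in l, ∃ s ∈ Icc (max (x - r) (-H)) (min (x + r) H),
    ∃ t ∈ Icc (max (x - r) (-H)) (min (x + r) H),
      w₁ n s ≤ -(√(1 - f x ^ 2) - lam) ∧ √(1 - f x ^ 2) - lam ≤ w₁ n t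

/-- At lam = 0 the lower bound for a transition equals 2c³ - 2c³/3 = 4c³/3; continuity does the
rest. -/
lemma exists_lam {c η : ℝ} (hc : 0 < c) (hη : 0 < η) : ∃ lam, 0 < lam ∧ lam < c ∧ 0 < c ^ 2 - lam ∧
    4 / 3 * c ^ 3 - η ≤ 2 * (c ^ 2 - lam) * (c - lam) - 2 * (c - lam) ^ 3 / 3 := by
  have hcont : Continuous fun lam : ℝ => 2 * (c ^ 2 - lam) * (c - lam) - 2 * (c - lam) ^ 3 / 3 := by
    fun_prop
  have h1 : ∀ᶠ lam in 𝓝[>] (0 : ℝ),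
      4 / 3 * c ^ 3 - η < 2 * (c ^ 2 - lam) * (c - lam) - 2 * (c - lam) ^ 3 / 3 :=
    nhdsWithin_le_nhds (hcont.continuousAt.eventually_const_lt (by simp; nlinarith))
  obtain ⟨lam, h2, h3⟩ := (h1.and (eventually_small (lt_min hc (by positivity : 0 < c ^ 2)))).exists
  exact ⟨lam, h3.1, h3.2.trans_le (min_le_left _ _),
    sub_pos.2 (h3.2.trans_le (min_le_right _ _)), h2.le⟩

lemma eventually_wall (h : ConvergingFields H a M l ε w₁ w₂ v f) (hH : 0 < H) {x : ℝ}
    (hx : x ∈ Icc (-H) H) (hw : WallAt H l w₁ f x) {η : ℝ} (hη : 0 < η) :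
    ∀ᶠ r in 𝓝[>] (0 : ℝ), ∀ᶠ n in l,
      ENNReal.ofReal (4 / 3 * √(1 - f x ^ 2) ^ 3 - η)
        ≤ ∫⁻ y in Ioo (max (x - r) (-H)) (min (x + r) H),
          ENNReal.ofReal (wallDensity (ε n) (w₁ n) (w₂ n) y) := by
  rcases (Real.sqrt_nonneg (1 - f x ^ 2)).eq_or_lt with hc | hc
  · rw [← hc]
    refine Eventually.of_forall fun r => Eventually.of_forall fun n => ?_
    rw [ENNReal.ofReal_of_nonpos (by norm_num; exact hη.le)]
    exact zero_le
  set c := √(1 - f x ^ 2) with hcdef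
  have hcsq : c ^ 2 = 1 - f x ^ 2 := Real.sq_sqrt (Real.sqrt_pos.1 hc).le
  obtain ⟨lam, hl0, hlc, hl2, hl3⟩ := exists_lam hc hη
  obtain ⟨μ, hμ0, hμ⟩ : ∃ μ > 0, ∀ s, |s - f x| < μ → c ^ 2 - lam ≤ 1 - s ^ 2 := by
    have hcont : Continuous fun s : ℝ => 1 - s ^ 2 := by fun_prop
    have h1 : ∀ᶠ s in 𝓝 (f x), c ^ 2 - lam < 1 - s ^ 2 :=
      hcont.continuousAt.eventually_const_lt (by rw [hcsq]; linarith)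
    obtain ⟨μ, hμ0, hμ⟩ := Metric.eventually_nhds_iff.1 h1
    exact ⟨μ, hμ0, fun s hs => (hμ (by rwa [Real.dist_eq])).le⟩
  -- This makes M / τ ≤ μ/4, and r < μ / (4τ) makes τ |y - x| ≤ μ/4. A third μ/4 comes from
  -- convergence at x, so w₂ n stays within μ of f x on the window.
  set τ : ℝ := 4 * (|M| + 1) / μ with hτ
  have hτ0 : 0 < τ := by positivity
  have hMτ : M / τ ≤ μ / 4 := by
    rw [hτ, div_div_eq_mul_div, div_le_div_iff₀ (by positivity) (by norm_num)]
    nlinarith [le_abs_self M, abs_nonneg M]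
  filter_upwards [eventually_small (by positivity : 0 < μ / (4 * τ))] with r hr
  filter_upwards [h.pos, h.bound, hw r hr.1 lam hl0,
    (Metric.tendsto_nhds.1 (h.conv₂ x hx)) (μ / 4) (by positivity)] with n h1 h2 h3 h4
  obtain ⟨s, hs, t, ht, hs1, ht1⟩ := h3
  refine (ENNReal.ofReal_le_ofReal hl3).trans ?_
  refine le_lintegral_wallDensity hH h1 (h.ac₁ n) (le_max_right _ _) (min_le_right _ _) hl2.le
    (by linarith) (fun y hy => hμ _ ?_) hs ht hs1 ht1
  have hyH : y ∈ Icc (-H) H := ⟨(le_max_right _ _).trans hy.1, hy.2.trans (min_le_right _ _)⟩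
  have hyx : |y - x| ≤ r := by
    rw [abs_le]
    constructor
    · linarith [(le_max_left _ _).trans hy.1]
    · linarith [hy.2.trans (min_le_left _ _)]
  have h5 := abs_sub_le_of_bound hH (h.ac₂ n) h2 hτ0 hx hyH
  rw [Real.dist_eq] at h4
  have h6 : τ * |y - x| ≤ μ / 4 := by
    calc τ * |y - x| ≤ τ * (μ / (4 * τ)) := by gcongr; exact hyx.trans hr.2.le
      _ = μ / 4 := by field_simp
  have h7 := abs_sub_le (w₂ n y) (w₂ n x) (f x)
  linarith

lemma sum_wall_le (h : ConvergingFields H a M l ε w₁ w₂ v f) (hH : 0 < H) (F : Finset ℝ)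
    (hF : ∀ x ∈ F, x ∈ Icc (-H) H ∧ WallAt H l w₁ f x) {η : ℝ} (hη : 0 < η) :
    ∀ᶠ n in l, ∑ x ∈ F, ENNReal.ofReal (4 / 3 * √(1 - f x ^ 2) ^ 3) ≤
      ∫⁻ y, ENNReal.ofReal (wallDensity (ε n) (w₁ n) (w₂ n) y) ∂(intervalMeasure H)
        + ENNReal.ofReal η := by
  set η' : ℝ := η / (F.card + 1) with hη'
  have hη'0 : 0 < η' := by positivity
  -- With r below half of all mutual distances the windows are disjoint, so the separate lower
  -- bounds add up.
  have hsep : ∀ᶠ r in 𝓝[>] (0 : ℝ), ∀ q ∈ F.offDiag, r < |q.1 - q.2| / 2 := by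
    refine (Filter.eventually_all_finset _).2 fun q hq => ?_
    rw [Finset.mem_offDiag] at hq
    have : 0 < |q.1 - q.2| / 2 := by
      have := abs_pos.2 (sub_ne_zero.2 hq.2.2); positivity
    exact (eventually_small this).mono fun r hr => hr.2
  have hev : ∀ᶠ r in 𝓝[>] (0 : ℝ), ∀ x ∈ F, ∀ᶠ n in l,
      ENNReal.ofReal (4 / 3 * √(1 - f x ^ 2) ^ 3 - η')
        ≤ ∫⁻ y in Ioo (max (x - r) (-H)) (min (x + r) H),
          ENNReal.ofReal (wallDensity (ε n) (w₁ n) (w₂ n) y) :=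
    (Filter.eventually_all_finset _).2 fun x hx => h.eventually_wall hH (hF x hx).1 (hF x hx).2 hη'0
  obtain ⟨r, hr1, hr2, hr0⟩ := (hsep.and (hev.and self_mem_nhdsWithin)).exists
  have hr2' := (Filter.eventually_all_finset F).2 hr2
  filter_upwards [hr2'] with n hn
  set I : ℝ → Set ℝ := fun x => Ioo (max (x - r) (-H)) (min (x + r) H) with hI
  have hdisj : (F : Set ℝ).PairwiseDisjoint I := by
    intro x hx y hy hxy
    refine Set.disjoint_left.2 fun z hz1 hz2 => ?_
    have h3 := hr1 (x, y) (Finset.mem_offDiag.2 ⟨hx, hy, hxy⟩)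
    have a1 := (le_max_left _ _).trans_lt hz1.1
    have a2 := hz1.2.trans_le (min_le_left _ _)
    have a3 := (le_max_left _ _).trans_lt hz2.1
    have a4 := hz2.2.trans_le (min_le_left _ _)
    have : |x - y| < 2 * r := abs_lt.2 ⟨by linarith, by linarith⟩
    simp only at h3
    linarith
  calc ∑ x ∈ F, ENNReal.ofReal (4 / 3 * √(1 - f x ^ 2) ^ 3)
      ≤ ∑ x ∈ F, ((∫⁻ y in I x, ENNReal.ofReal (wallDensity (ε n) (w₁ n) (w₂ n) y))
          + ENNReal.ofReal η') := by
        refine Finset.sum_le_sum fun x hx => ?_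
        have e : 4 / 3 * √(1 - f x ^ 2) ^ 3 = (4 / 3 * √(1 - f x ^ 2) ^ 3 - η') + η' := by ring
        rw [e]
        exact ENNReal.ofReal_add_le.trans (add_le_add (hn x hx) le_rfl)
    _ ≤ (∫⁻ y in ⋃ x ∈ F, I x, ENNReal.ofReal (wallDensity (ε n) (w₁ n) (w₂ n) y))
          + ENNReal.ofReal η := by
        rw [Finset.sum_add_distrib, lintegral_biUnion_finset hdisj fun _ _ => measurableSet_Ioo]
        refine add_le_add le_rfl ?_
        rw [Finset.sum_const, nsmul_eq_mul, ← ENNReal.ofReal_natCast,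
          ← ENNReal.ofReal_mul (by positivity)]
        refine ENNReal.ofReal_le_ofReal ?_
        have : (F.card : ℝ) * (η / (F.card + 1)) = η * (F.card / (F.card + 1)) := by field_simp
        rw [hη', this]
        exact mul_le_of_le_one_right hη.le ((div_le_one (by positivity)).2 (by linarith))
    _ ≤ _ := by
        refine add_le_add (lintegral_mono_set ?_) le_rfl
        refine iUnion₂_subset fun x _ => Ioo_subset_Ioo (le_max_right _ _) (min_le_right _ _)

end ConvergingFields

end

/-! ### The limiting energy in terms of wall costs, and the liminf inequality. -/

section

variable {H : ℝ}

/-- The continuous representative `f` of the second component of a field in the limiting class,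
and a set `G` along which the first component has one-sided limits. -/
structure LimitField (H a : ℝ) (u : ℝ → ℝ × ℝ) (f : ℝ → ℝ) (G : Set ℝ) : Prop where
  ac : ACL2 H f
  ae_eq : f =ᵐ[intervalMeasure H] fun y => (u y).2
  deriv_ae : deriv f =ᵐ[intervalMeasure H] weakDeriv H fun y => (u y).2
  contRep_eq : ∀ x ∈ Icc (-H) H, contRep H (fun y => (u y).2) x = f x
  left_eq : f (-H) = a
  right_eq : f H = a
  integrable : Integrable (fun y => (u y).1) (intervalMeasure H)
  reg : Regulated H (fun y => (u y).1) G
  memG : ∀ y ∈ G, y ∈ Icc (-H) H ∧ (u y).1 ^ 2 + f y ^ 2 = 1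

lemma MemA0.exists_limitField (hH : 0 < H) {a : ℝ} {u : ℝ → ℝ × ℝ} (hu : MemA0 H a u) :
    ∃ f G, LimitField H a u f G := by
  obtain ⟨f, h1, h2, h3, h4⟩ := hu.2.1.exists_ACL2 hH
  obtain ⟨h5, G, h6, h7⟩ := exists_regulated hu (h1.continuousOn hH) h2
  refine ⟨f, G, h1, h2, h3, h4, ?_, ?_, h5, h6, h7⟩
  · rw [← h4 _ (left_mem_Icc.2 (by linarith))]; exact hu.2.2.1
  · rw [← h4 _ (right_mem_Icc.2 (by linarith))]; exact hu.2.2.2.1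

/-- The energy of an optimal transition at the point `x`. -/
def wallCost (f : ℝ → ℝ) (x : ℝ) : ℝ≥0∞ := ENNReal.ofReal (4 / 3 * √(1 - f x ^ 2) ^ 3)

lemma sqrt_pow_three_eq {t : ℝ} (ht : 0 ≤ t) : t ^ (3 / 2 : ℝ) = √t ^ 3 := by
  rw [Real.sqrt_eq_rpow, ← Real.rpow_natCast, ← Real.rpow_mul ht]; norm_num

lemma eq_or_eq_neg_sqrt {c f : ℝ} (h : c ^ 2 + f ^ 2 = 1) : c = √(1 - f ^ 2) ∨ c = -√(1 - f ^ 2) := by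
  apply sq_eq_sq_iff_eq_or_eq_neg.1
  rw [Real.sq_sqrt (by nlinarith [sq_nonneg c])]; linarith

namespace LimitField

variable {a : ℝ} {u : ℝ → ℝ × ℝ} {f : ℝ → ℝ} {G : Set ℝ} (h : LimitField H a u f G)
include h

lemma right_sq (hH : 0 < H) {x : ℝ} (hx : x ∈ Ico (-H) H) :
    rightTrace (fun y => (u y).1) x ^ 2 + f x ^ 2 = 1 :=
  h.reg.rightTrace_sq (h.ac.continuousOn hH) h.memG hx

lemma left_sq (hH : 0 < H) {x : ℝ} (hx : x ∈ Ioc (-H) H) :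
    leftTrace (fun y => (u y).1) x ^ 2 + f x ^ 2 = 1 :=
  h.reg.leftTrace_sq (h.ac.continuousOn hH) h.memG hx

open scoped Classical in
-- The boundary traces are ±√(1 - a²). Either the boundary value is attained and the term vanishes,
-- or the sign is wrong and the term is (2√(1 - a²))³/6, exactly the cost of an interior wall.
lemma energyZero_eq (hH : 0 < H) (ha : |a| < 1) (L : ℝ) : energyZero H L a u
    = ENNReal.ofReal (L / 2) * ∫⁻ y, ENNReal.ofReal (deriv f y ^ 2) ∂(intervalMeasure H)
      + ∑' x : jumpSet H (fun y => (u y).1), wallCost f x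
      + (if rightTrace (fun y => (u y).1) (-H) = √(1 - a ^ 2) then wallCost f (-H) else 0)
      + (if leftTrace (fun y => (u y).1) H = -√(1 - a ^ 2) then wallCost f H else 0) := by
  have hapos : 0 < 1 - a ^ 2 := by rw [sub_pos, sq_lt_one_iff_abs_lt_one]; exact ha
  have hc : 0 < √(1 - a ^ 2) := Real.sqrt_pos.2 hapos
  unfold energyZero
  congr 1
  · congr 1
    · congr 1
      · congr 1
        refine lintegral_congr_ae ?_
        filter_upwards [h.deriv_ae] with y hy
        rw [hy]
      · rw [← ENNReal.tsum_mul_left]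
        refine tsum_congr fun x => ?_
        have hx : (x : ℝ) ∈ Ioo (-H) H := x.2.1
        rw [h.contRep_eq _ (Ioo_subset_Icc_self hx), sqrt_pow_three_eq,
          ← ENNReal.ofReal_mul (by norm_num)]
        · rfl
        · have := h.right_sq hH (Ioo_subset_Ico_self hx)
          nlinarith [sq_nonneg (rightTrace (fun y => (u y).1) x)]
    · have h1 := eq_or_eq_neg_sqrt (h.right_sq hH (left_mem_Ico.2 (by linarith : -H < H)))
      rw [h.left_eq] at h1
      unfold wallCost
      rw [h.left_eq]
      rcases h1 with h1 | h1
      · rw [if_pos h1, h1, abs_of_pos (by linarith)]; congr 1; ring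
      · rw [if_neg (by rw [h1]; linarith), h1]; simp
  · have h1 := eq_or_eq_neg_sqrt (h.left_sq hH (right_mem_Ioc.2 (by linarith : -H < H)))
    rw [h.right_eq] at h1
    unfold wallCost
    rw [h.right_eq]
    rcases h1 with h1 | h1
    · rw [if_neg (by rw [h1]; linarith), h1]; simp
    · rw [if_pos h1, h1, abs_of_neg (by linarith)]; congr 1; ring

end LimitField

lemma MemA1.exists_ACL2 (hH : 0 < H) {a : ℝ} {v : ℝ → ℝ × ℝ} (hv : MemA1 H a v) :
    ∃ w₁ w₂, ACL2 H w₁ ∧ ACL2 H w₂ ∧ (w₁ =ᵐ[intervalMeasure H] fun y => (v y).1) ∧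
      (w₂ =ᵐ[intervalMeasure H] fun y => (v y).2) ∧ w₁ (-H) = -√(1 - a ^ 2) ∧ w₂ (-H) = a ∧
      w₁ H = √(1 - a ^ 2) := by
  obtain ⟨h1, h2, h3, h4, h5, -⟩ := hv
  obtain ⟨w₁, a1, a2, -, a4⟩ := h1.exists_ACL2 hH
  obtain ⟨w₂, b1, b2, -, b4⟩ := h2.exists_ACL2 hH
  have hl : -H ∈ Icc (-H) H := left_mem_Icc.2 (by linarith)
  have hr : H ∈ Icc (-H) H := right_mem_Icc.2 (by linarith)
  exact ⟨w₁, w₂, a1, b1, a2, b2, by rw [← a4 _ hl, h3], by rw [← b4 _ hl, h4], by rw [← a4 _ hr, h5]⟩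

lemma tendsto_lintegral_of_strongL2 {ι : Type*} {l : Filter ι} {v : ι → ℝ → ℝ} {w : ℝ → ℝ}
    (hv : ∀ n, AEStronglyMeasurable (v n) (intervalMeasure H))
    (hw : AEStronglyMeasurable w (intervalMeasure H)) (h : StrongL2Tendsto H l v w) :
    Tendsto (fun n => ∫⁻ y, ENNReal.ofReal |v n y - w y| ∂(intervalMeasure H)) l (𝓝 0) := by
  have h1 : Tendsto (fun n => eLpNorm (fun y => v n y - w y) 2 (intervalMeasure H) *
      (intervalMeasure H univ) ^ (1 / (1 : ℝ≥0∞).toReal - 1 / (2 : ℝ≥0∞).toReal)) l (𝓝 0) := by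
    have := ENNReal.Tendsto.mul_const h (b := (intervalMeasure H univ) ^
      (1 / (1 : ℝ≥0∞).toReal - 1 / (2 : ℝ≥0∞).toReal)) (Or.inr ?_)
    · simpa using this
    · exact ENNReal.rpow_ne_top_of_nonneg (by norm_num) (measure_ne_top _ _)
  refine tendsto_of_tendsto_of_tendsto_of_le_of_le tendsto_const_nhds h1 (fun _ => zero_le)
    fun n => ?_
  have := eLpNorm_le_eLpNorm_mul_rpow_measure_univ (p := 1) (q := 2) (by norm_num)
    ((hv n).sub hw)
  rw [eLpNorm_one_eq_lintegral_enorm] at this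
  simp only [Real.enorm_eq_ofReal_abs, Pi.sub_apply] at this
  exact this

section liminf

variable {ι : Type*} {l : Filter ι} {a M : ℝ} {ε : ι → ℝ} {w₁ w₂ : ι → ℝ → ℝ} {u : ℝ → ℝ × ℝ}
  {f : ℝ → ℝ} {G : Set ℝ}

lemma exists_close_right (hH : 0 < H) (hf : LimitField H a u f G)
    (h : ConvergingFields H a M l ε w₁ w₂ (fun y => (u y).1) f) {x c : ℝ} (hx : x ∈ Ico (-H) H)
    (hc : HasRightTrace (fun y => (u y).1) x c) {r lam : ℝ} (hr : 0 < r) (hl : 0 < lam) :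
    ∀ᶠ n in l, ∃ y ∈ Icc (max (x - r) (-H)) (min (x + r) H), |w₁ n y - c| < lam := by
  obtain ⟨r', h1, h2, h3⟩ := h.exists_close hH hf.integrable.aestronglyMeasurable.aemeasurable
    (I := fun r => Ioo x (x + r)) (fun _ => measurableSet_Ioo) (fun r => by simp) hc hl
    (lt_min hr (sub_pos.2 hx.2)) fun s hs1 hs2 y hy => ⟨by linarith [hy.1, hx.1], by
      linarith [hy.2, hs2.trans_le (min_le_right _ _)]⟩
  have h4 := h2.trans_le (min_le_left _ _)
  have h5 := h2.trans_le (min_le_right _ _)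
  filter_upwards [h3] with n ⟨y, hy, hyc⟩
  exact ⟨y, ⟨max_le (by linarith [hy.1]) (by linarith [hy.1, hx.1]),
    le_min (by linarith [hy.2]) (by linarith [hy.2])⟩, hyc⟩

lemma exists_close_left (hH : 0 < H) (hf : LimitField H a u f G)
    (h : ConvergingFields H a M l ε w₁ w₂ (fun y => (u y).1) f) {x c : ℝ} (hx : x ∈ Ioc (-H) H)
    (hc : HasLeftTrace (fun y => (u y).1) x c) {r lam : ℝ} (hr : 0 < r) (hl : 0 < lam) :
    ∀ᶠ n in l, ∃ y ∈ Icc (max (x - r) (-H)) (min (x + r) H), |w₁ n y - c| < lam := by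
  obtain ⟨r', h1, h2, h3⟩ := h.exists_close hH hf.integrable.aestronglyMeasurable.aemeasurable
    (I := fun r => Ioo (x - r) x) (fun _ => measurableSet_Ioo) (fun r => by simp) hc hl
    (lt_min hr (sub_pos.2 hx.1)) fun s hs1 hs2 y hy => ⟨by
      linarith [hy.1, hs2.trans_le (min_le_right _ _)], by linarith [hy.2, hx.2]⟩
  have h4 := h2.trans_le (min_le_left _ _)
  have h5 := h2.trans_le (min_le_right _ _)
  filter_upwards [h3] with n ⟨y, hy, hyc⟩
  exact ⟨y, ⟨max_le (by linarith [hy.1]) (by linarith [hy.1]),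
    le_min (by linarith [hy.2]) (by linarith [hy.2, hx.2])⟩, hyc⟩

/-- The two traces have equal squares 1 - f² but differ, so they are opposite, and nearby values of
w₁ n approach both. -/
lemma wallAt_of_mem_jumpSet (hH : 0 < H) (hf : LimitField H a u f G)
    (h : ConvergingFields H a M l ε w₁ w₂ (fun y => (u y).1) f) {x : ℝ}
    (hx : x ∈ jumpSet H fun y => (u y).1) : ConvergingFields.WallAt H l w₁ f x := by
  intro r hr lam hlam
  have hx1 := Ioo_subset_Ico_self hx.1
  have hx2 := Ioo_subset_Ioc_self hx.1
  have hne := hf.reg.leftTrace_ne_rightTrace hx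
  have h1 := exists_close_right hH hf h hx1 (hf.reg.hasRightTrace hx1) hr hlam
  have h2 := exists_close_left hH hf h hx2 (hf.reg.hasLeftTrace hx2) hr hlam
  filter_upwards [h1, h2] with n ⟨s, hs, hs'⟩ ⟨t, ht, ht'⟩
  rw [abs_lt] at hs' ht'
  rcases eq_or_eq_neg_sqrt (hf.right_sq hH hx1) with e1 | e1 <;>
    rcases eq_or_eq_neg_sqrt (hf.left_sq hH hx2) with e2 | e2
  · exact absurd (e2.trans e1.symm) hne
  · exact ⟨t, ht, s, hs, by linarith [ht'.2], by linarith [hs'.1]⟩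
  · exact ⟨s, hs, t, ht, by linarith [hs'.2], by linarith [ht'.1]⟩
  · exact absurd (e2.trans e1.symm) hne

/-- The prescribed value w₁ n (-H) = -√(1 - a²) serves as one end of the transition and the trace of
the limit as the other. -/
lemma wallAt_left (hH : 0 < H) (hf : LimitField H a u f G)
    (h : ConvergingFields H a M l ε w₁ w₂ (fun y => (u y).1) f)
    (hx : rightTrace (fun y => (u y).1) (-H) = √(1 - a ^ 2)) :
    ConvergingFields.WallAt H l w₁ f (-H) := by
  intro r hr lam hlam
  have hx1 : -H ∈ Ico (-H) H := left_mem_Ico.2 (by linarith)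
  filter_upwards [exists_close_right hH hf h hx1 (hf.reg.hasRightTrace hx1) hr hlam]
    with n ⟨s, hs, hs'⟩
  rw [abs_lt] at hs'
  refine ⟨-H, ⟨max_le (by linarith) le_rfl, le_min (by linarith) (by linarith)⟩, s, hs, ?_, ?_⟩
  · rw [h.left_eq, hf.left_eq]; linarith
  · rw [hf.left_eq]; linarith [hs'.1]

lemma wallAt_right (hH : 0 < H) (hf : LimitField H a u f G)
    (h : ConvergingFields H a M l ε w₁ w₂ (fun y => (u y).1) f)
    (hx : leftTrace (fun y => (u y).1) H = -√(1 - a ^ 2)) :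
    ConvergingFields.WallAt H l w₁ f H := by
  intro r hr lam hlam
  have hx1 : H ∈ Ioc (-H) H := right_mem_Ioc.2 (by linarith)
  filter_upwards [exists_close_left hH hf h hx1 (hf.reg.hasLeftTrace hx1) hr hlam]
    with n ⟨s, hs, hs'⟩
  rw [abs_lt] at hs'
  refine ⟨s, hs, H, ⟨max_le (by linarith) (by linarith), le_min (by linarith) le_rfl⟩, ?_, ?_⟩
  · rw [hf.right_eq]; linarith [hs'.2]
  · rw [h.right_eq, hf.right_eq]; linarith

open scoped Classical in
-- Interior jumps and boundary walls sit at distinct points, so all of them form one finite set to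
-- which the estimate for finitely many walls applies.
lemma sum_jumps_le (hH : 0 < H) (hf : LimitField H a u f G)
    (h : ConvergingFields H a M l ε w₁ w₂ (fun y => (u y).1) f)
    (F : Finset (jumpSet H fun y => (u y).1)) {η : ℝ} (hη : 0 < η) :
    ∀ᶠ n in l, ∑ x ∈ F, wallCost f x
      + (if rightTrace (fun y => (u y).1) (-H) = √(1 - a ^ 2) then wallCost f (-H) else 0)
      + (if leftTrace (fun y => (u y).1) H = -√(1 - a ^ 2) then wallCost f H else 0)
      ≤ ∫⁻ y, ENNReal.ofReal (wallDensity (ε n) (w₁ n) (w₂ n) y) ∂(intervalMeasure H)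
        + ENNReal.ofReal η := by
  set F₀ : Finset ℝ := F.map (Function.Embedding.subtype _) with hF₀
  set F₁ : Finset ℝ := if rightTrace (fun y => (u y).1) (-H) = √(1 - a ^ 2) then {-H} else ∅ with hF₁
  set F₂ : Finset ℝ := if leftTrace (fun y => (u y).1) H = -√(1 - a ^ 2) then {H} else ∅ with hF₂
  have m0 : ∀ x ∈ F₀, x ∈ jumpSet H fun y => (u y).1 := by
    intro x hx
    obtain ⟨y, -, rfl⟩ := Finset.mem_map.1 hx
    exact y.2
  have m1 : ∀ x ∈ F₁, x = -H ∧ rightTrace (fun y => (u y).1) (-H) = √(1 - a ^ 2) := by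
    intro x hx
    rw [hF₁] at hx
    split_ifs at hx with hif
    · exact ⟨Finset.mem_singleton.1 hx, hif⟩
    · simp at hx
  have m2 : ∀ x ∈ F₂, x = H ∧ leftTrace (fun y => (u y).1) H = -√(1 - a ^ 2) := by
    intro x hx
    rw [hF₂] at hx
    split_ifs at hx with hif
    · exact ⟨Finset.mem_singleton.1 hx, hif⟩
    · simp at hx
  have d1 : Disjoint F₀ F₁ := Finset.disjoint_left.2 fun x hx hx' =>
    absurd (m0 x hx).1.1 (by rw [(m1 x hx').1]; exact lt_irrefl _)
  have d2 : Disjoint (F₀ ∪ F₁) F₂ := Finset.disjoint_left.2 fun x hx hx' => by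
    rcases Finset.mem_union.1 hx with hx | hx
    · exact absurd (m0 x hx).1.2 (by rw [(m2 x hx').1]; exact lt_irrefl _)
    · have := (m1 x hx).1; rw [(m2 x hx').1] at this; linarith
  have := h.sum_wall_le hH (F₀ ∪ F₁ ∪ F₂) (fun x hx => ?_) hη
  · refine this.mono fun n hn => le_trans (le_of_eq ?_) hn
    rw [Finset.sum_union d2, Finset.sum_union d1, hF₀, Finset.sum_map]
    congr 1
    · congr 1
      rw [hF₁]; split_ifs
      · rw [Finset.sum_singleton]; rfl
      · simp
    · rw [hF₂]; split_ifs
      · rw [Finset.sum_singleton]; rfl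
      · simp
  · rcases Finset.mem_union.1 hx with hx | hx
    · rcases Finset.mem_union.1 hx with hx | hx
      · exact ⟨Ioo_subset_Icc_self (m0 x hx).1, wallAt_of_mem_jumpSet hH hf h (m0 x hx)⟩
      · obtain ⟨rfl, h3⟩ := m1 x hx
        exact ⟨left_mem_Icc.2 (by linarith), wallAt_left hH hf h h3⟩
    · obtain ⟨rfl, h3⟩ := m2 x hx
      exact ⟨right_mem_Icc.2 (by linarith), wallAt_right hH hf h h3⟩

lemma lintegral_sq_eq {g : ℝ → ℝ} (hg : MemLp g 2 (intervalMeasure H)) :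
    ∫⁻ y, ENNReal.ofReal (g y ^ 2) ∂(intervalMeasure H)
      = ENNReal.ofReal (∫ y, g y ^ 2 ∂(intervalMeasure H)) :=
  (ofReal_integral_eq_lintegral_ofReal hg.integrable_sq
    (Eventually.of_forall fun _ => sq_nonneg _)).symm

/-- Weak lower semicontinuity of the `L²` norm. -/
lemma eventually_lintegral_sq_le {g : ι → ℝ → ℝ} {g₀ : ℝ → ℝ}
    (hg : ∀ n, MemLp (g n) 2 (intervalMeasure H)) (hg₀ : MemLp g₀ 2 (intervalMeasure H))
    (h : Tendsto (fun n => ∫ y, g n y * g₀ y ∂(intervalMeasure H)) l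
      (𝓝 (∫ y, g₀ y * g₀ y ∂(intervalMeasure H)))) {η : ℝ} (hη : 0 < η) :
    ∀ᶠ n in l, ∫⁻ y, ENNReal.ofReal (g₀ y ^ 2) ∂(intervalMeasure H)
      ≤ ∫⁻ y, ENNReal.ofReal (g n y ^ 2) ∂(intervalMeasure H) + ENNReal.ofReal η := by
  filter_upwards [h.eventually_const_lt (by linarith :
    ∫ y, g₀ y * g₀ y ∂(intervalMeasure H) - η / 2 < _)] with n hn
  rw [lintegral_sq_eq hg₀, lintegral_sq_eq (hg n),
    ← ENNReal.ofReal_add (integral_nonneg fun y => sq_nonneg _) hη.le]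
  refine ENNReal.ofReal_le_ofReal ?_
  have i1 := (hg n).integrable_sq
  have i2 := hg₀.integrable_sq
  have i3 : Integrable (fun y => g n y * g₀ y) (intervalMeasure H) := (hg n).integrable_mul hg₀
  -- Expanding this square bounds ∫ gₙ² below by 2 ∫ gₙ g₀ - ∫ g₀², which exceeds ∫ g₀² - η.
  have h1 : 0 ≤ ∫ y, (g n y - g₀ y) ^ 2 ∂(intervalMeasure H) := integral_nonneg fun _ => sq_nonneg _
  have h2 : ∫ y, (g n y - g₀ y) ^ 2 ∂(intervalMeasure H)
      = ∫ y, g n y ^ 2 ∂(intervalMeasure H) - 2 * ∫ y, g n y * g₀ y ∂(intervalMeasure H)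
        + ∫ y, g₀ y ^ 2 ∂(intervalMeasure H) := by
    rw [← integral_const_mul, ← integral_sub i1 (i3.const_mul 2), ← integral_add]
    · congr 1; ext y; ring
    · exact i1.sub (i3.const_mul 2)
    · exact i2
  have h3 : ∫ y, g₀ y * g₀ y ∂(intervalMeasure H) = ∫ y, g₀ y ^ 2 ∂(intervalMeasure H) := by
    congr 1; ext y; ring
  rw [h3] at hn
  linarith

/-- The lower bound along filters. -/
theorem energyZero_le_liminf [l.NeBot] {L : ℝ} (hH : 0 < H) (hL : 0 < L) (ha : |a| < 1)
    (hu : MemA0 H a u) {v : ι → ℝ → ℝ × ℝ} (hε : ∀ᶠ n in l, 0 < ε n)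
    (hv : ∀ n, MemA1 H a (v n)) (hvu : HatTendsto H l v u) :
    energyZero H L a u ≤ liminf (fun n => energyEps H L (ε n) (v n)) l := by
  classical
  obtain ⟨f, G, hf⟩ := hu.exists_limitField hH
  choose w₁ w₂ a1 a2 e1 e2 b1 b2 b3 using fun n => (hv n).exists_ACL2 hH
  refine le_of_forall_gt_imp_ge_of_dense fun B hB => ?_
  rcases eq_or_ne B ⊤ with rfl | hBtop
  · exact le_top
  have hfreq : ∃ᶠ n in l, energyEps H L (ε n) (v n) < B := frequently_lt_of_liminf_lt (by isBoundedDefault) hB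
  -- Restricting the filter to indices of energy below B plays the role of passing to a subsequence
  -- of bounded energy.
  set l' := l ⊓ 𝓟 {n | energyEps H L (ε n) (v n) < B} with hl'
  have : l'.NeBot := by
    rw [hl', inf_principal_neBot_iff]
    intro U hU
    obtain ⟨n, h1, h2⟩ := (hfreq.and_eventually hU).exists
    exact ⟨n, h2, h1⟩
  have hle : l' ≤ l := inf_le_left
  have hE : ∀ᶠ n in l', energyEps H L (ε n) (v n) < B :=
    mem_inf_of_right (mem_principal_self _)
  have hderiv : ∀ n, deriv (w₂ n) =ᵐ[intervalMeasure H] weakDeriv H fun y => (v n y).2 :=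
    fun n => ((a2 n).weakDeriv_ae hH (e2 n)).symm
  have hweak : ∀ ψ : ℝ → ℝ, MemLp ψ 2 (intervalMeasure H) →
      Tendsto (fun n => ∫ y, deriv (w₂ n) y * ψ y ∂(intervalMeasure H)) l
      (𝓝 (∫ y, deriv f y * ψ y ∂(intervalMeasure H))) := by
    intro ψ hψ
    have h1 := hvu.1.2.2 ψ hψ
    have h2 : ∫ y, deriv f y * ψ y ∂(intervalMeasure H)
        = ∫ y, weakDeriv H (fun y => (u y).2) y * ψ y ∂(intervalMeasure H) :=
      integral_congr_ae (hf.deriv_ae.mono fun y hy => by simp only [hy])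
    rw [h2]
    refine h1.congr fun n => integral_congr_ae ((hderiv n).mono fun y hy => by simp only [hy])
  have hEeq : ∀ᶠ n in l', energyEps H L (ε n) (v n)
      = ENNReal.ofReal (L / 2) * ∫⁻ y, ENNReal.ofReal (deriv (w₂ n) y ^ 2) ∂(intervalMeasure H)
        + ∫⁻ y, ENNReal.ofReal (wallDensity (ε n) (w₁ n) (w₂ n) y) ∂(intervalMeasure H) := by
    filter_upwards [hle hε] with n hn
    exact energyEps_eq hH hL hn (a1 n) (a2 n) (e1 n) (e2 n)
  -- The constant 2B/L comes from (L/2) ∫ (w₂')² ≤ B.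
  have hconv : ConvergingFields H a (2 / L * B.toReal) l' ε w₁ w₂ (fun y => (u y).1) f := by
    refine ⟨hle hε, a1, a2, b1, b3, ?_, ?_, ?_⟩
    · have h1 := tendsto_lintegral_of_strongL2 (w := fun y => (u y).1)
        (fun n => (((a1 n).memLp_self hH).aestronglyMeasurable.congr (e1 n)))
        hf.integrable.aestronglyMeasurable hvu.2.1
      refine (h1.mono_left hle).congr fun n => lintegral_congr_ae ?_
      filter_upwards [e1 n] with y hy
      rw [hy]
    · intro x hx
      -- Testing weak convergence of the derivatives with the indicator of (-H, x) gives pointwise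
      -- convergence of w₂, since all values at -H equal a.
      have hψ : MemLp ((Ioo (-H) x).indicator fun _ => (1 : ℝ)) 2 (intervalMeasure H) :=
        (memLp_const 1).indicator measurableSet_Ioo
      have h2 : ∀ w : ℝ → ℝ, ACL2 H w →
          ∫ y, deriv w y * (Ioo (-H) x).indicator (fun _ => (1 : ℝ)) y ∂(intervalMeasure H)
            = w x - w (-H) := by
        intro w hw
        rw [hw.sub_eq_integral hH (left_mem_Icc.2 (by linarith)) hx,
          intervalIntegral.integral_of_le hx.1, integral_Ioc_eq_integral_Ioo]
        have h3 : ∀ y, deriv w y * (Ioo (-H) x).indicator (fun _ => (1 : ℝ)) y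
            = (Ioo (-H) x).indicator (deriv w) y := by
          intro y
          by_cases hy : y ∈ Ioo (-H) x
          · simp [hy]
          · simp [hy]
        simp only [h3]
        rw [integral_indicator measurableSet_Ioo, intervalMeasure,
          Measure.restrict_restrict measurableSet_Ioo,
          inter_eq_left.2 (Ioo_subset_Ioo le_rfl hx.2)]
      have h3 := (hweak _ hψ).mono_left hle
      simp only [h2 _ (a2 _), h2 _ hf.ac, b2, hf.left_eq] at h3
      simpa using h3.add_const a
    · filter_upwards [hE, hEeq] with n h1 h2
      rw [h2, lintegral_sq_eq (a2 n).memLp, ← ENNReal.ofReal_mul (by positivity)] at h1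
      have h3 := (le_self_add.trans h1.le)
      rw [ENNReal.ofReal_le_iff_le_toReal hBtop] at h3
      rw [div_mul_eq_mul_div, le_div_iff₀ hL]
      linarith
  have key : ∀ F : Finset (jumpSet H fun y => (u y).1),
      ENNReal.ofReal (L / 2) * ∫⁻ y, ENNReal.ofReal (deriv f y ^ 2) ∂(intervalMeasure H)
        + ∑ x ∈ F, wallCost f x
        + (if rightTrace (fun y => (u y).1) (-H) = √(1 - a ^ 2) then wallCost f (-H) else 0)
        + (if leftTrace (fun y => (u y).1) H = -√(1 - a ^ 2) then wallCost f H else 0) ≤ B := by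
    intro F
    refine ENNReal.le_of_forall_pos_le_add fun η hη _ => ?_
    have hη0 : (0 : ℝ) < η := hη
    -- The error is split as η/2 for the walls and η/L for ∫ (w₂')², which becomes η/2 after
    -- multiplication by L/2.
    have h1 := sum_jumps_le hH hf hconv F (half_pos hη0)
    have h2 := eventually_lintegral_sq_le (fun n => (a2 n).memLp) hf.ac.memLp
      ((hweak _ hf.ac.memLp).mono_left hle) (by positivity : 0 < η / L)
    obtain ⟨n, h3, h4, h5, h6⟩ := (h1.and (h2.and (hE.and hEeq))).exists
    have h7 := mul_le_mul_right h4 (ENNReal.ofReal (L / 2))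
    rw [mul_add, ← ENNReal.ofReal_mul (by positivity)] at h7
    have e : L / 2 * (η / L) = (η : ℝ) / 2 := by field_simp
    rw [e] at h7
    have h8 := add_le_add h7 h3
    rw [add_assoc, add_assoc, ← add_assoc (∑ x ∈ F, wallCost f x)]
    refine h8.trans ?_
    have h9 : (η : ℝ≥0∞) = ENNReal.ofReal (η / 2) + ENNReal.ofReal (η / 2) := by
      rw [← ENNReal.ofReal_add (by positivity) (by positivity), add_halves, ENNReal.ofReal_coe_nnreal]
    rw [h9, add_add_add_comm, ← h6]
    gcongr
  rw [hf.energyZero_eq hH ha]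
  have hsum : Tendsto (fun F : Finset (jumpSet H fun y => (u y).1) => ∑ x ∈ F, wallCost f x) atTop
      (𝓝 (∑' x : jumpSet H fun y => (u y).1, wallCost f x)) := ENNReal.summable.hasSum
  exact le_of_tendsto' (((hsum.const_add _).add_const _).add_const _) key

end liminf

end

/-! ### Tools for the construction: lattice operations, the tanh profile, a regularised square root.
-/

section

variable {H : ℝ}

lemma ae_mem_Ioo : ∀ᵐ y ∂(intervalMeasure H), y ∈ Ioo (-H) H :=
  ae_intervalMeasure (Eventually.of_forall fun _ hx => hx)

namespace ACL2

variable {f g : ℝ → ℝ}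

lemma id : ACL2 H (fun y => y) := by
  refine ⟨LipschitzWith.id.lipschitzOnWith.absolutelyContinuousOnInterval, ?_⟩
  have : deriv (fun y : ℝ => y) = fun _ => 1 := by ext y; simp
  rw [this]
  exact memLp_const 1

lemma of_lipschitz (hH : 0 < H) {K : ℝ} (hK : 0 ≤ K) (h : ∀ x y, |f x - f y| ≤ K * |x - y|) :
    ACL2 H f := (ACL2.id.of_abs_sub_le hH hK fun x _ y _ => h x y).1

lemma sub (hH : 0 < H) (hf : ACL2 H f) (hg : ACL2 H g) : ACL2 H (fun y => f y - g y) := by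
  refine ⟨hf.ac.sub hg.ac, (memLp_congr_ae ?_).2 (hf.memLp.sub hg.memLp)⟩
  filter_upwards [hf.ae_differentiableAt hH, hg.ae_differentiableAt hH] with y h1 h2
  exact deriv_fun_sub h1 h2

lemma abs (hH : 0 < H) (hf : ACL2 H f) : ACL2 H (fun y => |f y|) :=
  (hf.of_abs_sub_le hH zero_le_one fun x _ y _ => by
    rw [one_mul]; exact abs_abs_sub_abs_le _ _).1

lemma min (hH : 0 < H) (hf : ACL2 H f) (hg : ACL2 H g) : ACL2 H (fun y => min (f y) (g y)) := by
  have h1 : ACL2 H (fun y => -f y) :=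
    (hf.of_abs_sub_le hH zero_le_one fun x _ y _ => by
      rw [one_mul, neg_sub_neg, abs_sub_comm]).1
  have h2 : ACL2 H (fun y => 1 / 2 * ((g y - -f y) - |f y - g y|)) :=
    ((((hg.sub hH h1).sub hH ((hf.sub hH hg).abs hH))).of_abs_sub_le hH
      (by norm_num : (0 : ℝ) ≤ 1 / 2) fun x _ y _ => by
        rw [← mul_sub, abs_mul, abs_of_pos (by norm_num : (0 : ℝ) < 1 / 2)]).1
  have : (fun y => Min.min (f y) (g y)) = fun y => 1 / 2 * ((g y - -f y) - |f y - g y|) := by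
    ext y
    rcases le_total (f y) (g y) with h | h
    · rw [min_eq_left h, abs_of_nonpos (by linarith)]; ring
    · rw [min_eq_right h, abs_of_nonneg (by linarith)]; ring
  rw [this]; exact h2

end ACL2

/-- Differentiable functions that touch from one side have the same derivative. -/
lemma deriv_eq_of_touching {f g : ℝ → ℝ} {y : ℝ} (hf : DifferentiableAt ℝ f y)
    (hg : DifferentiableAt ℝ g y) (hle : ∀ᶠ x in 𝓝 y, g x ≤ f x) (heq : g y = f y) :
    deriv g y = deriv f y := by
  have hmin : IsLocalMin (fun x => f x - g x) y := by
    filter_upwards [hle] with x hx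
    rw [heq]; linarith
  have := hmin.deriv_eq_zero
  rw [deriv_fun_sub hf hg] at this
  linarith

section profile

/-- The optimal transition profile between `-C` and `C`. -/
def wallProfile (C ε y : ℝ) : ℝ := C * Real.tanh (C * y / ε)

variable {C ε : ℝ}

lemma hasDerivAt_tanh (x : ℝ) : HasDerivAt Real.tanh (1 - Real.tanh x ^ 2) x := by
  have h := (Real.hasDerivAt_sinh x).div (Real.hasDerivAt_cosh x) (Real.cosh_pos x).ne'
  have e : Real.tanh = Real.sinh / Real.cosh := by
    ext y; rw [Pi.div_apply, Real.tanh_eq_sinh_div_cosh]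
  rw [e]
  refine h.congr_deriv ?_
  have := (Real.cosh_pos x).ne'
  rw [Pi.div_apply]
  field_simp

lemma monotone_tanh : Monotone Real.tanh :=
  monotone_of_deriv_nonneg (fun x => (hasDerivAt_tanh x).differentiableAt) fun x => by
    rw [(hasDerivAt_tanh x).deriv]
    nlinarith [Real.tanh_lt_one x, Real.neg_one_lt_tanh x]

/-- The profile σ solves ε σ' = C² - σ², the equipartition equation for which Young's inequality is
sharp. -/
lemma hasDerivAt_wallProfile (y : ℝ) :
    HasDerivAt (wallProfile C ε) ((C ^ 2 - wallProfile C ε y ^ 2) / ε) y := by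
  have h1 : HasDerivAt (fun y : ℝ => C * y / ε) (C * 1 / ε) y :=
    ((hasDerivAt_id y).const_mul C).div_const ε
  have h2 := ((hasDerivAt_tanh (C * y / ε)).comp y h1).const_mul C
  refine h2.congr_deriv ?_
  unfold wallProfile
  ring

lemma abs_wallProfile_le (hC : 0 ≤ C) (y : ℝ) : |wallProfile C ε y| ≤ C := by
  unfold wallProfile
  rw [abs_mul, abs_of_nonneg hC]
  refine mul_le_of_le_one_right hC (abs_le.2 ⟨(Real.neg_one_lt_tanh _).le, (Real.tanh_lt_one _).le⟩)

lemma wallProfile_neg (y : ℝ) : wallProfile C ε (-y) = -wallProfile C ε y := by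
  unfold wallProfile
  rw [mul_neg, neg_div, Real.tanh_neg, mul_neg]

lemma wallProfile_zero : wallProfile C ε 0 = 0 := by simp [wallProfile]

lemma wallProfile_le_abs (hC : 0 ≤ C) (hε : 0 < ε) {ρ y : ℝ} (hy : ρ ≤ |y|) :
    wallProfile C ε ρ ≤ |wallProfile C ε y| := by
  have h1 : wallProfile C ε ρ ≤ wallProfile C ε |y| := by
    unfold wallProfile
    exact mul_le_mul_of_nonneg_left (monotone_tanh (by gcongr)) hC
  refine h1.trans ?_
  rcases abs_choice y with h | h
  · rw [h]; exact le_abs_self _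
  · rw [h, wallProfile_neg]; exact neg_le_abs _

/-- The profile stays strictly below C, hence c < C; at a fixed distance ρ its argument Cρ/ε tends
to infinity. -/
lemma eventually_le_wallProfile {c ρ : ℝ} (hc : 0 ≤ c) (hcC : c < C) (hρ : 0 < ρ) :
    ∀ᶠ ε in 𝓝[>] (0 : ℝ), c ≤ wallProfile C ε ρ := by
  have hC : 0 < C := hc.trans_lt hcC
  obtain ⟨M, -, hM⟩ := Real.tanh_surjOn (show c / C ∈ Ioo (-1) 1 from
    ⟨by linarith [div_nonneg hc hC.le], (div_lt_one hC).2 hcC⟩)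
  have h1 : Tendsto (fun ε : ℝ => C * ρ / ε) (𝓝[>] 0) atTop := by
    simp only [div_eq_mul_inv]
    exact tendsto_inv_nhdsGT_zero.const_mul_atTop (by positivity)
  filter_upwards [h1.eventually_ge_atTop M] with ε hε
  have h2 := monotone_tanh hε
  rw [hM, div_le_iff₀ hC] at h2
  unfold wallProfile
  linarith

lemma abs_wallProfile_sub_le (hC : 0 ≤ C) (hε : 0 < ε) (x y : ℝ) :
    |wallProfile C ε x - wallProfile C ε y| ≤ C ^ 2 / ε * |x - y| := by
  have := convex_univ.norm_image_sub_le_of_norm_hasDerivWithin_le (C := C ^ 2 / ε)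
    (fun x _ => (hasDerivAt_wallProfile (C := C) (ε := ε) x).hasDerivWithinAt) (fun x _ => ?_)
    (mem_univ y) (mem_univ x)
  · simpa using this
  · have h1 := abs_wallProfile_le (ε := ε) hC x
    have h2 : wallProfile C ε x ^ 2 ≤ C ^ 2 := sq_le_sq' (abs_le.1 h1).1 (abs_le.1 h1).2
    rw [Real.norm_eq_abs, abs_of_nonneg (div_nonneg (by linarith) hε.le)]
    gcongr
    nlinarith [sq_nonneg (wallProfile C ε x)]

/-- The energy of the optimal profile. -/
lemma lintegral_wallProfile_le (hH : 0 < H) (hC : 0 ≤ C) (hε : 0 < ε) (p : ℝ) :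
    ∫⁻ y, ENNReal.ofReal ((C ^ 2 - wallProfile C ε (y - p) ^ 2) ^ 2 / ε) ∂(intervalMeasure H)
      ≤ ENNReal.ofReal (4 / 3 * C ^ 3) := by
  set σ : ℝ → ℝ := fun y => wallProfile C ε (y - p) with hσ
  have hd : ∀ y, HasDerivAt σ ((C ^ 2 - σ y ^ 2) / ε) y := fun y =>
    (hasDerivAt_wallProfile (y - p)).comp_sub_const y p
  have hσc : Continuous σ := continuous_iff_continuousAt.2 fun y => (hd y).continuousAt
  -- The integrand is (C² - σ²) σ', so C²σ - σ³/3 is a primitive; its oscillation for |σ| ≤ C is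
  -- 4C³/3.
  have hd2 : ∀ y, HasDerivAt (fun y => C ^ 2 * σ y - σ y ^ 3 / 3) ((C ^ 2 - σ y ^ 2) ^ 2 / ε) y := by
    intro y
    refine (((hd y).const_mul (C ^ 2)).sub (((hd y).pow 3).div_const 3)).congr_deriv ?_
    push_cast
    ring
  have hcont : Continuous fun y => (C ^ 2 - σ y ^ 2) ^ 2 / ε := by fun_prop
  have hint : Integrable (fun y => (C ^ 2 - σ y ^ 2) ^ 2 / ε) (intervalMeasure H) :=
    (hcont.continuousOn.integrableOn_Icc (a := -H) (b := H)).mono_set Ioo_subset_Icc_self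
  rw [← ofReal_integral_eq_lintegral_ofReal hint (Eventually.of_forall fun y => by positivity)]
  refine ENNReal.ofReal_le_ofReal ?_
  rw [integral_intervalMeasure hH, intervalIntegral.integral_eq_sub_of_hasDerivAt
    (fun y _ => hd2 y) (hcont.intervalIntegrable _ _)]
  have hb : ∀ s : ℝ, |s| ≤ C → |C ^ 2 * s - s ^ 3 / 3| ≤ 2 / 3 * C ^ 3 := by
    intro s hs
    obtain ⟨h1, h2⟩ := abs_le.1 hs
    rw [abs_le]
    constructor
    · nlinarith [mul_nonneg (sq_nonneg (s + C)) (by linarith : 0 ≤ 2 * C - s)]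
    · nlinarith [mul_nonneg (sq_nonneg (s - C)) (by linarith : 0 ≤ 2 * C + s)]
  have h1 := abs_le.1 (hb _ (abs_wallProfile_le (ε := ε) hC (H - p)))
  have h2 := abs_le.1 (hb _ (abs_wallProfile_le (ε := ε) hC (-H - p)))
  simp only [hσ]
  linarith [h1.2, h2.1]

end profile

section cutoff

/-- A Lipschitz approximation of the square root from below. -/
def lowerSqrt (θ t : ℝ) : ℝ := min √t (t / θ)

variable {θ : ℝ}

lemma lowerSqrt_of_le (hθ : 0 < θ) {t : ℝ} (ht0 : 0 ≤ t) (ht : t ≤ θ ^ 2) : lowerSqrt θ t = t / θ := by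
  refine min_eq_right ?_
  rw [div_le_iff₀ hθ]
  have h1 : √t ≤ θ := by rw [← Real.sqrt_sq hθ.le]; exact Real.sqrt_le_sqrt ht
  nlinarith [Real.sq_sqrt ht0, Real.sqrt_nonneg t]

lemma lowerSqrt_of_ge (hθ : 0 < θ) {t : ℝ} (ht : θ ^ 2 ≤ t) : lowerSqrt θ t = √t := by
  refine min_eq_left ?_
  rw [le_div_iff₀ hθ]
  have h1 : θ ≤ √t := by rw [← Real.sqrt_sq hθ.le]; exact Real.sqrt_le_sqrt ht
  have h2 := Real.sq_sqrt ((sq_nonneg θ).trans ht)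
  nlinarith [Real.sqrt_nonneg t]

lemma lowerSqrt_nonneg (hθ : 0 < θ) {t : ℝ} (ht : 0 ≤ t) : 0 ≤ lowerSqrt θ t :=
  le_min (Real.sqrt_nonneg t) (div_nonneg ht hθ.le)

lemma lowerSqrt_le (t : ℝ) : lowerSqrt θ t ≤ √t := min_le_left _ _

/-- The regularisation differs from √t only for t ≤ θ², where both squares lie in [0, θ²]. -/
lemma sq_sub_lowerSqrt_le (hθ : 0 < θ) {t : ℝ} (ht : 0 ≤ t) :
    (lowerSqrt θ t ^ 2 - t) ^ 2 ≤ θ ^ 4 := by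
  rcases le_total t (θ ^ 2) with h | h
  · have h1 := lowerSqrt_nonneg hθ ht
    have h2 : lowerSqrt θ t ^ 2 ≤ t := by
      have := pow_le_pow_left₀ h1 (lowerSqrt_le (θ := θ) t) 2
      rwa [Real.sq_sqrt ht] at this
    have h3 : |lowerSqrt θ t ^ 2 - t| ≤ θ ^ 2 := by
      rw [abs_le]; constructor <;> nlinarith [sq_nonneg (lowerSqrt θ t)]
    have := pow_le_pow_left₀ (abs_nonneg _) h3 2
    rw [sq_abs] at this
    linarith [this, (by ring : (θ ^ 2) ^ 2 = θ ^ 4)]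
  · rw [lowerSqrt_of_ge hθ h, Real.sq_sqrt ht, sub_self, zero_pow two_ne_zero]; positivity

/-- The slope is 1/θ on [0, θ²], and √t has slope at most 1/(2θ) beyond; an interval containing θ²
is split there. -/
lemma abs_lowerSqrt_sub_le (hθ : 0 < θ) {s t : ℝ} (hs : 0 ≤ s) (ht : 0 ≤ t) :
    |lowerSqrt θ s - lowerSqrt θ t| ≤ 1 / θ * |s - t| := by
  wlog hst : s ≤ t generalizing s t
  · have := this ht hs (le_of_not_ge hst)
    rwa [abs_sub_comm, abs_sub_comm s]
  have hbig : ∀ s t : ℝ, θ ^ 2 ≤ s → s ≤ t →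
      |√s - √t| ≤ 1 / θ * (t - s) := by
    intro s t hs hst
    have h1 : θ ≤ √s := by rw [← Real.sqrt_sq hθ.le]; exact Real.sqrt_le_sqrt hs
    have h2 := Real.sqrt_le_sqrt hst
    have h3 := Real.sq_sqrt ((sq_nonneg θ).trans hs)
    have h4 := Real.sq_sqrt (((sq_nonneg θ).trans hs).trans hst)
    rw [abs_sub_comm, abs_of_nonneg (by linarith), div_mul_eq_mul_div, one_mul, le_div_iff₀ hθ]
    nlinarith
  have hsmall : ∀ s t : ℝ, s ≤ t → |s / θ - t / θ| = 1 / θ * (t - s) := by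
    intro s t hst
    rw [← sub_div, abs_div, abs_of_nonpos (by linarith), abs_of_pos hθ]; ring
  rw [abs_sub_comm s, abs_of_nonneg (by linarith : 0 ≤ t - s)]
  rcases le_total t (θ ^ 2) with h | h
  · rw [lowerSqrt_of_le hθ hs (hst.trans h), lowerSqrt_of_le hθ ht h]
    exact (hsmall s t hst).le
  · rcases le_total (θ ^ 2) s with h' | h'
    · rw [lowerSqrt_of_ge hθ h', lowerSqrt_of_ge hθ h]
      exact hbig s t h' hst
    · rw [lowerSqrt_of_le hθ hs h', lowerSqrt_of_ge hθ h]
      have h1 := hbig (θ ^ 2) t le_rfl h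
      have h2 := hsmall s (θ ^ 2) h'
      have h3 : √(θ ^ 2) = θ ^ 2 / θ := by rw [Real.sqrt_sq hθ.le]; field_simp
      rw [h3] at h1
      refine (abs_sub_le _ (θ ^ 2 / θ) _).trans ((add_le_add h2.le h1).trans_eq ?_)
      ring

end cutoff

end

/-! ### The field with finitely many walls, for fixed parameters. -/

section

variable {H : ℝ}

lemma ACL2.integral (hH : 0 < H) {g : ℝ → ℝ} (hg : MemLp g 2 (intervalMeasure H)) :
    ACL2 H (fun y => ∫ t in (-H)..y, g t) ∧
      deriv (fun y => ∫ t in (-H)..y, g t) =ᵐ[intervalMeasure H] g := by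
  have hi := intervalIntegrable_of_integrable hH (integrable_of_memLp_two hg)
  have hd : deriv (fun y => ∫ t in (-H)..y, g t) =ᵐ[intervalMeasure H] g := by
    apply ae_intervalMeasure
    filter_upwards [hi.ae_hasDerivAt_integral] with y hy hy'
    refine (hy ?_ (-H) left_mem_uIcc).deriv
    rw [uIcc_of_le (by linarith)]; exact Ioo_subset_Icc_self hy'
  exact ⟨⟨hi.absolutelyContinuousOnInterval_intervalIntegral left_mem_uIcc,
    (memLp_congr_ae hd).2 hg⟩, hd⟩

/-- The sign of a real number, with value `-1` at zero. -/
def signOf (x : ℝ) : ℝ := if 0 < x then 1 else -1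

lemma signOf_of_pos {x : ℝ} (hx : 0 < x) : signOf x = 1 := if_pos hx

lemma signOf_of_nonpos {x : ℝ} (hx : x ≤ 0) : signOf x = -1 := if_neg (not_lt.2 hx)

lemma signOf_sq (x : ℝ) : signOf x ^ 2 = 1 := by
  unfold signOf; split_ifs <;> norm_num

lemma abs_signOf (x : ℝ) : |signOf x| = 1 := by
  unfold signOf; split_ifs <;> norm_num

/-- Multiplication by a sign that changes only at zeros preserves absolute continuity. -/
lemma ACL2.signOf_mul (hH : 0 < H) {m R : ℝ → ℝ} (hm : ACL2 H m)
    (hR : ∀ t ∈ Icc (-H) H, m t ≠ 0 → ContinuousWithinAt R (Icc (-H) H) t ∧ R t ≠ 0) :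
    ACL2 H (fun y => signOf (R y) * m y) ∧
      ∀ᵐ y ∂(intervalMeasure H), |deriv (fun y => signOf (R y) * m y) y| ≤ |deriv m y| := by
  have hm' : MemLp (fun y => |deriv m y|) 2 (intervalMeasure H) := hm.memLp.abs
  obtain ⟨hV, hVd⟩ := ACL2.integral hH hm'
  -- The variation of m, used as a common majorant for the increments of m and of the signed
  -- function.
  set V : ℝ → ℝ := fun y => ∫ t in (-H)..y, |deriv m t| with hVdef
  have hinc : ∀ x ∈ Icc (-H) H, ∀ y ∈ Icc (-H) H, x ≤ y → |m y - m x| ≤ V y - V x := by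
    intro x hx y hy hxy
    have hl : -H ∈ Icc (-H) H := left_mem_Icc.2 (by linarith)
    have hi := integrable_of_memLp_two hm'
    have h1 : V y - V x = ∫ t in x..y, |deriv m t| :=
      intervalIntegral.integral_interval_sub_left (intervalIntegrable_of_mem hH hi hl hy)
        (intervalIntegrable_of_mem hH hi hl hx)
    rw [h1, hm.sub_eq_integral hH hx hy]
    exact intervalIntegral.norm_integral_le_integral_norm (f := deriv m) (μ := volume) hxy
  have hmain : ∀ x ∈ Icc (-H) H, ∀ y ∈ Icc (-H) H, x ≤ y →
      |signOf (R x) * m x - signOf (R y) * m y| ≤ V y - V x := by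
    intro x hx y hy hxy
    have hsub : Icc x y ⊆ Icc (-H) H := Icc_subset_Icc hx.1 hy.2
    -- If m vanishes between x and y, the increment is estimated through that zero. Otherwise R is
    -- continuous without zeros on [x, y], so its sign is constant there.
    by_cases hz : ∃ z ∈ Icc x y, m z = 0
    · obtain ⟨z, hz, hmz⟩ := hz
      have h1 := hinc x hx z (hsub hz) hz.1
      have h2 := hinc z (hsub hz) y hy hz.2
      rw [hmz, zero_sub, abs_neg] at h1
      rw [hmz, sub_zero] at h2
      refine (abs_sub _ _).trans ?_
      rw [abs_mul, abs_mul, abs_signOf, abs_signOf, one_mul, one_mul]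
      linarith
    · push Not at hz
      have hcont : ContinuousOn R (Icc x y) := fun t ht =>
        (hR t (hsub ht) (hz t ht)).1.mono hsub
      have hne : ∀ t ∈ Icc x y, R t ≠ 0 := fun t ht => (hR t (hsub ht) (hz t ht)).2
      have hs : signOf (R x) = signOf (R y) := by
        have hxx := left_mem_Icc.2 hxy
        have hyy := right_mem_Icc.2 hxy
        rcases lt_or_gt_of_ne (hne x hxx) with h1 | h1 <;>
          rcases lt_or_gt_of_ne (hne y hyy) with h2 | h2
        · rw [signOf_of_nonpos h1.le, signOf_of_nonpos h2.le]
        · obtain ⟨t, ht, ht0⟩ := intermediate_value_Icc hxy hcont ⟨h1.le, h2.le⟩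
          exact absurd ht0 (hne t ht)
        · obtain ⟨t, ht, ht0⟩ := intermediate_value_Icc' hxy hcont ⟨h2.le, h1.le⟩
          exact absurd ht0 (hne t ht)
        · rw [signOf_of_pos h1, signOf_of_pos h2]
      rw [hs, ← mul_sub, abs_mul, abs_signOf, one_mul, abs_sub_comm]
      exact hinc x hx y hy hxy
  obtain ⟨h1, h2⟩ := hV.of_abs_sub_le hH zero_le_one (F := fun y => signOf (R y) * m y)
    fun x hx y hy => by
      rw [one_mul]
      rcases le_total x y with h | h
      · rw [abs_sub_comm (V x)]
        exact (hmain x hx y hy h).trans (le_abs_self _)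
      · rw [abs_sub_comm]
        exact (hmain y hy x hx h).trans (le_abs_self _)
  refine ⟨h1, ?_⟩
  filter_upwards [h2, hVd] with y hy hy'
  rwa [hy', one_mul, abs_abs] at hy

/-- The function `χ` cut down to zero at finitely many points by optimal profiles. -/
lemma exists_cut (hH : 0 < H) {χ : ℝ → ℝ} (hχ : ACL2 H χ)
    (hχ0 : ∀ y ∈ Icc (-H) H, 0 ≤ χ y ∧ χ y ≤ 1) {ε ρ : ℝ} (hε : 0 < ε) (hρ : 0 < ρ) {C : ℝ → ℝ}
    (hC : ∀ p, 0 ≤ C p) (P : Finset ℝ)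
    (hP : ∀ p ∈ P, ∀ y ∈ Icc (-H) H, |y - p| < 2 * ρ → χ y ≤ wallProfile (C p) ε ρ) :
    ∃ m, ACL2 H m ∧ (∀ y ∈ Icc (-H) H, 0 ≤ m y ∧ m y ≤ χ y) ∧
      (∀ p ∈ P, p ∈ Icc (-H) H → m p = 0) ∧
      (∀ y ∈ Icc (-H) H, (∀ p ∈ P, ρ ≤ |y - p|) → m y = χ y) ∧
      ∀ᵐ y ∂(intervalMeasure H), (m y = χ y ∧ deriv m y = deriv χ y) ∨
        ∃ p ∈ P, |y - p| < ρ ∧ m y = |wallProfile (C p) ε (y - p)| ∧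
          |deriv m y| ≤ (C p ^ 2 - wallProfile (C p) ε (y - p) ^ 2) / ε := by
  induction P using Finset.induction_on with
  | empty =>
    exact ⟨χ, hχ, fun y hy => ⟨(hχ0 y hy).1, le_rfl⟩, by simp, by simp,
      Eventually.of_forall fun y => Or.inl ⟨rfl, rfl⟩⟩
  | insert q P _ ih =>
    obtain ⟨m, h1, h2, h3, h4, h5⟩ := ih fun p hp => hP p (Finset.mem_insert_of_mem hp)
    have hPq := hP q (Finset.mem_insert_self _ _)
    set σ : ℝ → ℝ := fun y => wallProfile (C q) ε (y - q) with hσ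
    -- A barrier for the minimum. Within ρ of q it is the profile |σ|. Between ρ and 2ρ the profile
    -- alone already exceeds χ by hypothesis, and beyond 2ρ the added term is at least 2, while χ ≤
    -- 1. So taking the minimum changes the function only within ρ of q.
    set s : ℝ → ℝ := fun y => |σ y| + 2 / ρ * max (|y - q| - ρ) 0 with hs
    have hs0 : ∀ y, 0 ≤ s y := fun y => by positivity
    have hsq : s q = 0 := by
      simp only [hs, hσ, sub_self, wallProfile_zero, abs_zero, zero_sub]
      rw [max_eq_right (by linarith)]; ring
    have hsfar : ∀ y ∈ Icc (-H) H, ρ ≤ |y - q| → χ y ≤ s y := by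
      intro y hy hyq
      rcases lt_or_ge |y - q| (2 * ρ) with h | h
      · refine (hPq y hy h).trans ((wallProfile_le_abs (hC q) hε hyq).trans ?_)
        simp only [hs]
        have : 0 ≤ 2 / ρ * max (|y - q| - ρ) 0 := by positivity
        simp only [hσ]
        linarith
      · refine (hχ0 y hy).2.trans ?_
        have h6 : 2 / ρ * ρ ≤ 2 / ρ * max (|y - q| - ρ) 0 := by
          gcongr; exact le_max_of_le_left (by linarith)
        have h7 : 2 / ρ * ρ = 2 := by field_simp
        simp only [hs]
        linarith [abs_nonneg (σ y)]
    have hsnear : ∀ y, |y - q| < ρ → s y = |σ y| := by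
      intro y hy
      simp only [hs]
      rw [max_eq_right (by linarith)]; ring
    have hslip : ACL2 H s := by
      refine ACL2.of_lipschitz hH (K := C q ^ 2 / ε + 2 / ρ) (by positivity) fun x y => ?_
      have e1 := abs_wallProfile_sub_le (hC q) hε (x - q) (y - q)
      rw [sub_sub_sub_cancel_right] at e1
      have e2 : abs (|σ x| - |σ y|) ≤ C q ^ 2 / ε * |x - y| := (abs_abs_sub_abs_le _ _).trans e1
      have e3 : |max (|x - q| - ρ) 0 - max (|y - q| - ρ) 0| ≤ |x - y| := by
        refine (abs_max_sub_max_le_abs _ _ _).trans ?_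
        rw [sub_sub_sub_cancel_right]
        refine (abs_abs_sub_abs_le _ _).trans ?_
        rw [sub_sub_sub_cancel_right]
      have e4 : s x - s y = (|σ x| - |σ y|)
          + 2 / ρ * (max (|x - q| - ρ) 0 - max (|y - q| - ρ) 0) := by simp only [hs]; ring
      rw [e4, add_mul]
      refine (abs_add_le _ _).trans (add_le_add e2 ?_)
      rw [abs_mul, abs_of_pos (by positivity : 0 < 2 / ρ)]
      gcongr
    have hmin := h1.min hH hslip
    refine ⟨fun y => min (m y) (s y), hmin, fun y hy => ⟨le_min (h2 y hy).1 (hs0 y),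
      (min_le_left _ _).trans (h2 y hy).2⟩, ?_, ?_, ?_⟩
    · intro p hp hpI
      rcases Finset.mem_insert.1 hp with rfl | hp
      · simp only [hsq]; exact min_eq_right (h2 _ hpI).1
      · simp only [h3 p hp hpI]; exact min_eq_left (hs0 p)
    · intro y hy hall
      have e1 := h4 y hy fun p hp => hall p (Finset.mem_insert_of_mem hp)
      have e2 := hsfar y hy (hall q (Finset.mem_insert_self _ _))
      simp only [e1]
      exact min_eq_left e2
    · filter_upwards [h5, ae_mem_Ioo, h1.ae_differentiableAt hH, hslip.ae_differentiableAt hH,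
        hmin.ae_differentiableAt hH] with y hy hyI d1 d2 d3
      have hyIcc := Ioo_subset_Icc_self hyI
      rcases le_or_gt (m y) (s y) with h | h
      · have e1 : min (m y) (s y) = m y := min_eq_left h
        have e2 : deriv (fun y => min (m y) (s y)) y = deriv m y :=
          deriv_eq_of_touching d1 d3 (Eventually.of_forall fun x => min_le_left _ _) e1
        simp only [e1, e2]
        rcases hy with hy | ⟨p, hp, hy⟩
        · exact Or.inl hy
        · exact Or.inr ⟨p, Finset.mem_insert_of_mem hp, hy⟩
      · have e1 : min (m y) (s y) = s y := min_eq_right h.le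
        have e2 : deriv (fun y => min (m y) (s y)) y = deriv s y :=
          deriv_eq_of_touching d2 d3 (Eventually.of_forall fun x => min_le_right _ _) e1
        have hyq : |y - q| < ρ := by
          by_contra hcon
          have := hsfar y hyIcc (not_lt.1 hcon)
          linarith [(h2 y hyIcc).2]
        refine Or.inr ⟨q, Finset.mem_insert_self _ _, hyq, ?_, ?_⟩
        · simp only [e1]; exact hsnear y hyq
        · rw [e2]
          have hd : HasDerivAt σ ((C q ^ 2 - σ y ^ 2) / ε) y :=
            (hasDerivAt_wallProfile (y - q)).comp_sub_const y q
          have hloc : ∀ᶠ x in 𝓝 y, |s x - s y| ≤ 1 * |σ x - σ y| := by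
            have hopen : IsOpen {x : ℝ | |x - q| < ρ} := isOpen_lt (by fun_prop) continuous_const
            filter_upwards [hopen.mem_nhds hyq] with x hx
            rw [hsnear x hx, hsnear y hyq, one_mul]
            exact abs_abs_sub_abs_le _ _
          refine (abs_deriv_le_of_eventually zero_le_one hd hloc).trans_eq ?_
          rw [one_mul, abs_of_nonneg]
          have := abs_le.1 (abs_wallProfile_le (ε := ε) (hC q) (y - q))
          refine div_nonneg (sub_nonneg.2 (sq_le_sq' this.1 this.2)) hε.le

/-- A field with finitely many optimal transitions and its energy, for fixed parameters. -/
lemma exists_transition_field (hH : 0 < H) {a : ℝ} {f : ℝ → ℝ} (hf : ACL2 H f)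
    (hf1 : ∀ y ∈ Icc (-H) H, f y ^ 2 ≤ 1) (hfl : f (-H) = a) (hfr : f H = a) {P : Finset ℝ}
    {R : ℝ → ℝ}
    (hR : ∀ t ∈ Icc (-H) H, t ∉ P → f t ^ 2 < 1 →
      ContinuousWithinAt R (Icc (-H) H) t ∧ R t ≠ 0)
    (hRl : R (-H) < 0) (hRr : 0 < R H) {ε θ ρ : ℝ} (hε : 0 < ε) (hθ : 0 < θ)
    (hθa : θ ≤ √(1 - a ^ 2)) (hρ : 0 < ρ) {C : ℝ → ℝ} (hC : ∀ p, 0 ≤ C p)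
    (hP : ∀ p ∈ P, ∀ y ∈ Icc (-H) H, |y - p| < 2 * ρ → √(1 - f y ^ 2) ≤ wallProfile (C p) ε ρ)
    (hPl : ∀ p ∈ P, ρ ≤ |-H - p|) (hPr : ∀ p ∈ P, ρ ≤ |H - p|) :
    ∃ w, ACL2 H w ∧ w (-H) = -√(1 - a ^ 2) ∧ w H = √(1 - a ^ 2) ∧
      ∫⁻ y, ENNReal.ofReal (wallDensity ε w f y) ∂(intervalMeasure H)
        ≤ ENNReal.ofReal (1 / 2 * ε * (1 + 4 / θ ^ 2) * ∫ y, deriv f y ^ 2 ∂(intervalMeasure H)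
            + H * θ ^ 4 / ε)
          + ∑ p ∈ P, ENNReal.ofReal (4 / 3 * C p ^ 3) ∧
      ∀ y ∈ Icc (-H) H, (w y - signOf (R y) * √(1 - f y ^ 2)) ^ 2 ≤ 1 - f y ^ 2 - w y ^ 2 := by
  have hl : -H ∈ Icc (-H) H := left_mem_Icc.2 (by linarith)
  have hr : H ∈ Icc (-H) H := right_mem_Icc.2 (by linarith)
  set χ : ℝ → ℝ := fun y => lowerSqrt θ (1 - f y ^ 2) with hχdef
  have hχ' : ∀ x ∈ Icc (-H) H, ∀ y ∈ Icc (-H) H, |χ x - χ y| ≤ 2 / θ * |f x - f y| := by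
    intro x hx y hy
    have h1 := abs_lowerSqrt_sub_le hθ (sub_nonneg.2 (hf1 x hx)) (sub_nonneg.2 (hf1 y hy))
    refine h1.trans ?_
    have h2 : |(1 - f x ^ 2) - (1 - f y ^ 2)| ≤ 2 * |f x - f y| := by
      have e : (1 - f x ^ 2) - (1 - f y ^ 2) = -(f x + f y) * (f x - f y) := by ring
      rw [e, abs_mul, abs_neg]
      refine mul_le_mul_of_nonneg_right ?_ (abs_nonneg _)
      have h3 := (sq_le_one_iff_abs_le_one (f x)).1 (hf1 x hx)
      have h4 := (sq_le_one_iff_abs_le_one (f y)).1 (hf1 y hy)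
      exact (abs_add_le _ _).trans (by linarith)
    calc 1 / θ * |(1 - f x ^ 2) - (1 - f y ^ 2)| ≤ 1 / θ * (2 * |f x - f y|) := by gcongr
      _ = 2 / θ * |f x - f y| := by ring
  obtain ⟨hχ, hχd⟩ := hf.of_abs_sub_le hH (by positivity) hχ'
  have hχ0 : ∀ y ∈ Icc (-H) H, 0 ≤ χ y ∧ χ y ≤ √(1 - f y ^ 2) := fun y hy =>
    ⟨lowerSqrt_nonneg hθ (sub_nonneg.2 (hf1 y hy)), lowerSqrt_le _⟩
  have hc1 : ∀ y, √(1 - f y ^ 2) ≤ 1 := fun y =>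
    Real.sqrt_le_one.2 (by linarith [sq_nonneg (f y)])
  obtain ⟨m, h1, h2, h3, h4, h5⟩ := exists_cut hH hχ
    (fun y hy => ⟨(hχ0 y hy).1, (hχ0 y hy).2.trans (hc1 y)⟩) hε hρ hC P
    fun p hp y hy hyp => (hχ0 y hy).2.trans (hP p hp y hy hyp)
  -- R may be discontinuous or zero only at points of P or where f² = 1, and m vanishes at all of
  -- them.
  have hm : ∀ t ∈ Icc (-H) H, m t ≠ 0 → ContinuousWithinAt R (Icc (-H) H) t ∧ R t ≠ 0 := by
    intro t ht hmt
    refine hR t ht (fun htP => hmt (h3 t htP ht)) ?_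
    by_contra hcon
    have e : √(1 - f t ^ 2) = 0 := Real.sqrt_eq_zero_of_nonpos (by linarith)
    exact hmt (le_antisymm ((h2 t ht).2.trans ((hχ0 t ht).2.trans e.le)) (h2 t ht).1)
  obtain ⟨hw, hwd⟩ := h1.signOf_mul hH hm
  -- The regularised root is exact at the endpoints, so the boundary values are attained exactly.
  have ha2 : θ ^ 2 ≤ 1 - a ^ 2 := by
    have hpos : 0 < √(1 - a ^ 2) := hθ.trans_le hθa
    have := pow_le_pow_left₀ hθ.le hθa 2
    rwa [Real.sq_sqrt (Real.sqrt_pos.1 hpos).le] at this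
  refine ⟨fun y => signOf (R y) * m y, hw, ?_, ?_, ?_, ?_⟩
  · simp only
    rw [signOf_of_nonpos hRl.le, h4 _ hl hPl, hχdef]
    simp only
    rw [hfl, lowerSqrt_of_ge hθ ha2]; ring
  · simp only
    rw [signOf_of_pos hRr, h4 _ hr hPr, hχdef]
    simp only
    rw [hfr, lowerSqrt_of_ge hθ ha2]; ring
  · set w : ℝ → ℝ := fun y => signOf (R y) * m y with hwdef
    have hwsq : ∀ y, w y ^ 2 = m y ^ 2 := fun y => by
      simp only [hwdef]; rw [mul_pow, signOf_sq, one_mul]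
    set A : ℝ := 1 / 2 * ε * (1 + 4 / θ ^ 2) with hA
    have hA0 : 0 ≤ A := by positivity
    set k : ℝ → ℝ → ℝ := fun p y => (C p ^ 2 - wallProfile (C p) ε (y - p) ^ 2) ^ 2 / ε with hk
    have hk0 : ∀ p y, 0 ≤ k p y := fun p y => by positivity
    -- Away from the walls the regularisation costs a multiple of ε (f')² and at most θ⁴/(2ε).
    -- Inside the wall at p, σ² = m² ≤ 1 - f² ≤ C p ², so the potential term is dominated by (C p ²
    -- - σ²)² and equipartition yields the density `k p`.
    have hpt : ∀ᵐ y ∂(intervalMeasure H),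
        wallDensity ε w f y ≤ A * deriv f y ^ 2 + θ ^ 4 / (2 * ε) + ∑ p ∈ P, k p y := by
      filter_upwards [h5, hwd, hχd, ae_mem_Ioo] with y hy hwy hχy hyI
      have hyI' := Ioo_subset_Icc_self hyI
      have hsum0 : 0 ≤ ∑ p ∈ P, k p y := Finset.sum_nonneg fun p _ => hk0 p y
      have hw2 : deriv w y ^ 2 ≤ deriv m y ^ 2 := sq_le_sq.2 hwy
      unfold wallDensity
      rw [hwsq]
      rcases hy with ⟨e1, e2⟩ | ⟨p, hp, hyp, e1, e2⟩
      · have h6 : deriv m y ^ 2 ≤ 4 / θ ^ 2 * deriv f y ^ 2 := by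
          rw [e2, ← sq_abs (deriv χ y)]
          refine (pow_le_pow_left₀ (abs_nonneg _) hχy 2).trans_eq ?_
          rw [mul_pow, sq_abs, div_pow]; norm_num
        have h7 : (m y ^ 2 + f y ^ 2 - 1) ^ 2 ≤ θ ^ 4 := by
          rw [e1]
          have := sq_sub_lowerSqrt_le hθ (sub_nonneg.2 (hf1 y hyI'))
          have e : χ y ^ 2 + f y ^ 2 - 1 = lowerSqrt θ (1 - f y ^ 2) ^ 2 - (1 - f y ^ 2) := by
            simp only [hχdef]; ring
          rwa [e]
        have h8 : ε * (deriv w y ^ 2 + deriv f y ^ 2)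
            ≤ ε * (4 / θ ^ 2 * deriv f y ^ 2 + deriv f y ^ 2) := by gcongr; exact hw2.trans h6
        have h9 : 1 / ε * (m y ^ 2 + f y ^ 2 - 1) ^ 2 ≤ 1 / ε * θ ^ 4 := by gcongr
        have h10 : A * deriv f y ^ 2 + θ ^ 4 / (2 * ε)
            = 1 / 2 * (ε * (4 / θ ^ 2 * deriv f y ^ 2 + deriv f y ^ 2) + 1 / ε * θ ^ 4) := by
          rw [hA]; field_simp; ring
        linarith
      · set σ := wallProfile (C p) ε (y - p) with hσ
        have hσC : σ ^ 2 ≤ C p ^ 2 := by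
          have := abs_le.1 (abs_wallProfile_le (ε := ε) (hC p) (y - p))
          exact sq_le_sq' this.1 this.2
        have hmσ : m y ^ 2 = σ ^ 2 := by rw [e1, sq_abs]
        have hcsq := Real.sq_sqrt (sub_nonneg.2 (hf1 y hyI'))
        have hmc : m y ^ 2 ≤ 1 - f y ^ 2 := by
          rw [← hcsq]
          exact pow_le_pow_left₀ (h2 y hyI').1 ((h2 y hyI').2.trans (hχ0 y hyI').2) 2
        have hcC : 1 - f y ^ 2 ≤ C p ^ 2 := by
          rw [← hcsq]
          refine pow_le_pow_left₀ (Real.sqrt_nonneg _)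
            ((hP p hp y hyI' (by linarith)).trans ?_) 2
          exact (le_abs_self _).trans (abs_wallProfile_le (hC p) _)
        have h6 : deriv m y ^ 2 ≤ ((C p ^ 2 - σ ^ 2) / ε) ^ 2 := by
          rw [← sq_abs]; exact pow_le_pow_left₀ (abs_nonneg _) e2 2
        have h7 : (m y ^ 2 + f y ^ 2 - 1) ^ 2 ≤ (C p ^ 2 - σ ^ 2) ^ 2 := by
          rw [← neg_sq]
          refine pow_le_pow_left₀ (by linarith) (by linarith) 2
        have h8 : ε * (deriv w y ^ 2 + deriv f y ^ 2)
            ≤ ε * (((C p ^ 2 - σ ^ 2) / ε) ^ 2 + deriv f y ^ 2) :=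
          mul_le_mul_of_nonneg_left (add_le_add (hw2.trans h6) le_rfl) hε.le
        have h9 : 1 / ε * (m y ^ 2 + f y ^ 2 - 1) ^ 2 ≤ 1 / ε * (C p ^ 2 - σ ^ 2) ^ 2 := by gcongr
        have h10 : 1 / 2 * (ε * (((C p ^ 2 - σ ^ 2) / ε) ^ 2 + deriv f y ^ 2)
            + 1 / ε * (C p ^ 2 - σ ^ 2) ^ 2) = k p y + 1 / 2 * ε * deriv f y ^ 2 := by
          simp only [hk]; field_simp; ring
        have h11 : k p y ≤ ∑ p ∈ P, k p y :=
          Finset.single_le_sum (fun p _ => hk0 p y) hp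
        have h12 : 1 / 2 * ε * deriv f y ^ 2 ≤ A * deriv f y ^ 2 := by
          rw [hA]
          refine mul_le_mul_of_nonneg_right ?_ (sq_nonneg _)
          refine le_mul_of_one_le_right (by positivity) ?_
          have : 0 ≤ 4 / θ ^ 2 := by positivity
          linarith
        have h13 : 0 ≤ θ ^ 4 / (2 * ε) := by positivity
        linarith
    have hmk : ∀ p ∈ P, Measurable fun y => ENNReal.ofReal (k p y) := by
      intro p _
      have hc : Continuous (wallProfile (C p) ε) :=
        continuous_iff_continuousAt.2 fun y => (hasDerivAt_wallProfile y).continuousAt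
      have : Continuous (k p) := by simp only [hk]; fun_prop
      exact this.measurable.ennreal_ofReal
    calc ∫⁻ y, ENNReal.ofReal (wallDensity ε w f y) ∂(intervalMeasure H)
        ≤ ∫⁻ y, (ENNReal.ofReal (A * deriv f y ^ 2 + θ ^ 4 / (2 * ε))
            + ∑ p ∈ P, ENNReal.ofReal (k p y)) ∂(intervalMeasure H) := by
          refine lintegral_mono_ae (hpt.mono fun y hy => ?_)
          rw [← ENNReal.ofReal_sum_of_nonneg fun p _ => hk0 p y,
            ← ENNReal.ofReal_add (by positivity) (Finset.sum_nonneg fun p _ => hk0 p y)]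
          exact ENNReal.ofReal_le_ofReal hy
      _ = ∫⁻ y, ENNReal.ofReal (A * deriv f y ^ 2 + θ ^ 4 / (2 * ε)) ∂(intervalMeasure H)
            + ∑ p ∈ P, ∫⁻ y, ENNReal.ofReal (k p y) ∂(intervalMeasure H) := by
          rw [lintegral_add_right _ (Finset.measurable_sum _ hmk), lintegral_finsetSum _ hmk]
      _ ≤ _ := by
          refine add_le_add (le_of_eq ?_) (Finset.sum_le_sum fun p _ =>
            lintegral_wallProfile_le hH (hC p) hε p)
          have hi : Integrable (fun y => A * deriv f y ^ 2) (intervalMeasure H) :=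
            hf.memLp.integrable_sq.const_mul A
          have hi2 : Integrable (fun y => A * deriv f y ^ 2 + θ ^ 4 / (2 * ε)) (intervalMeasure H) :=
            hi.add (integrable_const _)
          rw [← ofReal_integral_eq_lintegral_ofReal hi2
            (Eventually.of_forall fun y => by positivity)]
          congr 1
          rw [integral_add hi (integrable_const _), integral_const_mul, integral_const,
            measureReal_def, intervalMeasure, Measure.restrict_apply_univ, Real.volume_Ioo,
            ENNReal.toReal_ofReal (by linarith), smul_eq_mul]
          congr 1
          field_simp
          ring
  · intro y hy
    have e : (signOf (R y) * m y - signOf (R y) * √(1 - f y ^ 2)) ^ 2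
        = (√(1 - f y ^ 2) - m y) ^ 2 := by
      rw [← mul_sub, mul_pow, signOf_sq]; ring
    simp only
    rw [e, mul_pow, signOf_sq]
    have hcsq := Real.sq_sqrt (sub_nonneg.2 (hf1 y hy))
    have hmc := (h2 y hy).2.trans (hχ0 y hy).2
    -- For 0 ≤ m ≤ c one has (c - m)² ≤ c² - m².
    nlinarith [(h2 y hy).1]

end

/-! ### Recovery for finitely many walls, and selection of near-minimisers. -/

section

variable {H : ℝ}

lemma wallCost_ne_top (f : ℝ → ℝ) (x : ℝ) : wallCost f x ≠ ⊤ := ENNReal.ofReal_ne_top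

/-- Recovery fields for limits with finitely many transitions. -/
lemma eventually_exists_recovery (hH : 0 < H) {a : ℝ} (ha : |a| < 1) {f : ℝ → ℝ} (hf : ACL2 H f)
    (hf1 : ∀ y ∈ Icc (-H) H, f y ^ 2 ≤ 1) (hfl : f (-H) = a) (hfr : f H = a) {P : Finset ℝ}
    (hPI : ∀ p ∈ P, p ∈ Ioo (-H) H) {R : ℝ → ℝ}
    (hR : ∀ t ∈ Icc (-H) H, t ∉ P → f t ^ 2 < 1 →
      ContinuousWithinAt R (Icc (-H) H) t ∧ R t ≠ 0)
    (hRl : R (-H) < 0) (hRr : 0 < R H) {η : ℝ} (hη : 0 < η) :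
    ∀ᶠ ε in 𝓝[>] (0 : ℝ), ∃ w, ACL2 H w ∧ w (-H) = -√(1 - a ^ 2) ∧ w H = √(1 - a ^ 2) ∧
      ∫⁻ y, ENNReal.ofReal (wallDensity ε w f y) ∂(intervalMeasure H)
        ≤ ∑ p ∈ P, wallCost f p + ENNReal.ofReal η ∧
      ∫⁻ y, ENNReal.ofReal ((w y - signOf (R y) * √(1 - f y ^ 2)) ^ 2) ∂(intervalMeasure H)
        ≤ ENNReal.ofReal η := by
  have hc : 0 < √(1 - a ^ 2) :=
    Real.sqrt_pos.2 (by rw [sub_pos, sq_lt_one_iff_abs_lt_one]; exact ha)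
  set N := ∫ y, deriv f y ^ 2 ∂(intervalMeasure H) with hN
  set η' : ℝ := η / (2 * (P.card + 1)) with hη'
  have hη'0 : 0 < η' := by positivity
  -- The profile height is raised by τ above √(1 - f p ²), so that for small ε it passes √(1 - f²)
  -- throughout the window at a finite distance ρ; the extra cost is at most η' per wall.
  obtain ⟨τ, hτ, hτ0⟩ : ∃ τ : ℝ, (∀ p ∈ P,
      4 / 3 * (√(1 - f p ^ 2) + τ) ^ 3 ≤ 4 / 3 * √(1 - f p ^ 2) ^ 3 + η') ∧ 0 < τ := by
    have : ∀ᶠ τ in 𝓝[>] (0 : ℝ), ∀ p ∈ P,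
        4 / 3 * (√(1 - f p ^ 2) + τ) ^ 3 ≤ 4 / 3 * √(1 - f p ^ 2) ^ 3 + η' := by
      refine (Filter.eventually_all_finset _).2 fun p _ => nhdsWithin_le_nhds ?_
      have hcont : Continuous fun τ : ℝ => 4 / 3 * (√(1 - f p ^ 2) + τ) ^ 3 := by fun_prop
      refine (hcont.continuousAt.eventually_lt_const (u := 4 / 3 * √(1 - f p ^ 2) ^ 3 + η') ?_).mono
        fun _ h => h.le
      simp only [add_zero]; linarith
    exact (this.and self_mem_nhdsWithin).exists
  set C : ℝ → ℝ := fun p => √(1 - f p ^ 2) + τ with hCdef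
  have hC : ∀ p, 0 ≤ C p := fun p => by positivity
  obtain ⟨ρ, hρ0, hρ⟩ : ∃ ρ : ℝ, 0 < ρ ∧ ∀ p ∈ P, (∀ y ∈ Icc (-H) H, |y - p| < 2 * ρ →
      √(1 - f y ^ 2) ≤ √(1 - f p ^ 2) + τ / 2) ∧ ρ ≤ |-H - p| ∧ ρ ≤ |H - p| := by
    have : ∀ᶠ ρ in 𝓝[>] (0 : ℝ), ∀ p ∈ P, (∀ y ∈ Icc (-H) H, |y - p| < 2 * ρ →
        √(1 - f y ^ 2) ≤ √(1 - f p ^ 2) + τ / 2) ∧ ρ ≤ |-H - p| ∧ ρ ≤ |H - p| := by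
      refine (Filter.eventually_all_finset _).2 fun p hp => ?_
      have hpI := hPI p hp
      have hcont : ContinuousWithinAt (fun y => √(1 - f y ^ 2)) (Icc (-H) H) p :=
        (((hf.continuousOn hH) p (Ioo_subset_Icc_self hpI)).pow 2 |>.const_sub 1).sqrt
      obtain ⟨δ, hδ, hδ'⟩ := Metric.mem_nhdsWithin_iff.1
        (hcont.eventually_lt_const (u := √(1 - f p ^ 2) + τ / 2) (by linarith))
      have hl : 0 < |-H - p| := abs_pos.2 (by linarith [hpI.1])
      have hr : 0 < |H - p| := abs_pos.2 (by linarith [hpI.2])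
      filter_upwards [eventually_small (half_pos hδ), eventually_small hl, eventually_small hr]
        with ρ h1 h2 h3
      refine ⟨fun y hy hyp => (hδ' ⟨?_, hy⟩ : √(1 - f y ^ 2) < _).le, h2.2.le, h3.2.le⟩
      rw [Metric.mem_ball, Real.dist_eq]; linarith [h1.2]
    obtain ⟨ρ, h1, h2⟩ := (this.and self_mem_nhdsWithin).exists
    exact ⟨ρ, h2, h1⟩
  -- The scale θ² = κ√ε balances the two regularisation errors: H θ⁴/ε = H κ² = η/4 is small but
  -- fixed, while ε/θ² = √ε/κ tends to 0.
  set κ := √(η / (4 * H)) with hκ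
  have hκ0 : 0 < κ := Real.sqrt_pos.2 (by positivity)
  have hκ2 : κ ^ 2 = η / (4 * H) := Real.sq_sqrt (by positivity)
  set B := (∑ p ∈ P, wallCost f p + ENNReal.ofReal η).toReal with hB
  have hBtop : ∑ p ∈ P, wallCost f p + ENNReal.ofReal η ≠ ⊤ :=
    ENNReal.add_ne_top.2 ⟨ENNReal.sum_ne_top.2 fun p _ => wallCost_ne_top f p, ENNReal.ofReal_ne_top⟩
  have hprof : ∀ᶠ ε in 𝓝[>] (0 : ℝ), ∀ p ∈ P, √(1 - f p ^ 2) + τ / 2 ≤ wallProfile (C p) ε ρ :=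
    (Filter.eventually_all_finset _).2 fun p _ =>
      eventually_le_wallProfile (by positivity) (by simp only [hCdef]; linarith) hρ0
  have hθlim : ∀ᶠ ε in 𝓝[>] (0 : ℝ), √(κ * √ε) < √(1 - a ^ 2) := by
    have hcont : Continuous fun ε : ℝ => √(κ * √ε) := by fun_prop
    exact nhdsWithin_le_nhds (hcont.continuousAt.eventually_lt_const (by simpa using hc))
  have hAlim : ∀ᶠ ε in 𝓝[>] (0 : ℝ), 1 / 2 * (ε + 4 * √ε / κ) * N < η / 4 := by
    have hcont : Continuous fun ε : ℝ => 1 / 2 * (ε + 4 * √ε / κ) * N := by fun_prop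
    exact nhdsWithin_le_nhds (hcont.continuousAt.eventually_lt_const (by simpa using hη))
  have hLlim : ∀ᶠ ε in 𝓝[>] (0 : ℝ), √ε * (2 * H) + √ε * B < η := by
    have hcont : Continuous fun ε : ℝ => √ε * (2 * H) + √ε * B := by fun_prop
    exact nhdsWithin_le_nhds (hcont.continuousAt.eventually_lt_const (by simpa using hη))
  filter_upwards [hprof, hθlim, hAlim, hLlim, self_mem_nhdsWithin] with ε e1 e2 e3 e4 e5
  have hε : 0 < ε := e5
  have hsε : 0 < √ε := Real.sqrt_pos.2 hε
  have hsε2 : √ε ^ 2 = ε := Real.sq_sqrt hε.le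
  set θ := √(κ * √ε) with hθ
  have hθ0 : 0 < θ := Real.sqrt_pos.2 (by positivity)
  have hθ2 : θ ^ 2 = κ * √ε := Real.sq_sqrt (by positivity)
  obtain ⟨w, h1, h2, h3, h4, h5⟩ := exists_transition_field hH hf hf1 hfl hfr hR hRl hRr hε hθ0 e2.le
    hρ0 hC (fun p hp y hy hyp => ((hρ p hp).1 y hy hyp).trans (e1 p hp))
    (fun p hp => (hρ p hp).2.1) fun p hp => (hρ p hp).2.2
  have hE : ∫⁻ y, ENNReal.ofReal (wallDensity ε w f y) ∂(intervalMeasure H)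
      ≤ ∑ p ∈ P, wallCost f p + ENNReal.ofReal η := by
    refine h4.trans ?_
    have i1 : 1 / 2 * ε * (1 + 4 / θ ^ 2) * N + H * θ ^ 4 / ε ≤ η / 2 := by
      have i2 : 1 / 2 * ε * (1 + 4 / θ ^ 2) * N = 1 / 2 * (ε + 4 * √ε / κ) * N := by
        rw [hθ2]
        have : ε * (4 / (κ * √ε)) = 4 * √ε / κ := by
          nth_rewrite 1 [← hsε2]; field_simp
        linear_combination (1 / 2 * N) * this
      have i3 : H * θ ^ 4 / ε = η / 4 := by
        have : θ ^ 4 = κ ^ 2 * ε := by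
          rw [show θ ^ 4 = (θ ^ 2) ^ 2 by ring, hθ2, mul_pow, hsε2]
        rw [this, hκ2]; field_simp
      rw [i2, i3]; linarith
    have i4 : ∑ p ∈ P, ENNReal.ofReal (4 / 3 * C p ^ 3)
        ≤ ∑ p ∈ P, wallCost f p + ENNReal.ofReal (η / 2) := by
      calc ∑ p ∈ P, ENNReal.ofReal (4 / 3 * C p ^ 3)
          ≤ ∑ p ∈ P, (wallCost f p + ENNReal.ofReal η') := by
            refine Finset.sum_le_sum fun p hp => ?_
            exact (ENNReal.ofReal_le_ofReal (hτ p hp)).trans ENNReal.ofReal_add_le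
        _ ≤ _ := by
            rw [Finset.sum_add_distrib, Finset.sum_const, nsmul_eq_mul]
            refine add_le_add le_rfl ?_
            rw [← ENNReal.ofReal_natCast, ← ENNReal.ofReal_mul (by positivity)]
            refine ENNReal.ofReal_le_ofReal ?_
            have : (P.card : ℝ) * η' = η / 2 * (P.card / (P.card + 1)) := by
              rw [hη']; field_simp
            rw [this]
            exact mul_le_of_le_one_right (by positivity)
              ((div_le_one (by positivity)).2 (by linarith))
    calc _ ≤ ENNReal.ofReal (η / 2) + (∑ p ∈ P, wallCost f p + ENNReal.ofReal (η / 2)) :=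
          add_le_add (ENNReal.ofReal_le_ofReal i1) i4
      _ = _ := by
          rw [add_left_comm, ← ENNReal.ofReal_add (by positivity) (by positivity), add_halves]
  refine ⟨w, h1, h2, h3, hE, ?_⟩
  have hm : AEMeasurable (wallDensity ε w f) (intervalMeasure H) := aemeasurable_wallDensity hH h1 hf
  calc ∫⁻ y, ENNReal.ofReal ((w y - signOf (R y) * √(1 - f y ^ 2)) ^ 2) ∂(intervalMeasure H)
      ≤ ∫⁻ y, (ENNReal.ofReal √ε + ENNReal.ofReal √ε * ENNReal.ofReal (wallDensity ε w f y))
          ∂(intervalMeasure H) := by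
        refine lintegral_mono_ae ?_
        filter_upwards [ae_mem_Ioo] with y hy
        have hwd := wallDensity_nonneg hε w f y
        rw [← ENNReal.ofReal_mul hsε.le, ← ENNReal.ofReal_add hsε.le (by positivity)]
        refine ENNReal.ofReal_le_ofReal ((h5 y (Ioo_subset_Icc_self hy)).trans ?_)
        -- The squared distance is at most q, and q ≤ √ε + √ε q²/(2ε), where q²/(2ε) is part of the
        -- density. Bounded energy therefore forces L² closeness of order √ε.
        set q := 1 - f y ^ 2 - w y ^ 2 with hq
        have j1 : 1 / (2 * ε) * q ^ 2 ≤ wallDensity ε w f y := by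
          unfold wallDensity
          have : (w y ^ 2 + f y ^ 2 - 1) ^ 2 = q ^ 2 := by rw [hq]; ring
          rw [this]
          have h8 : 0 ≤ ε * (deriv w y ^ 2 + deriv f y ^ 2) := by positivity
          have h9 : 1 / (2 * ε) * q ^ 2 = 1 / 2 * (1 / ε * q ^ 2) := by field_simp
          linarith
        have j2 := mul_le_mul_of_nonneg_left j1 hsε.le
        have j3 : √ε + √ε * (1 / (2 * ε) * q ^ 2) - q
            = (1 / (2 * √ε)) * ((q - √ε) ^ 2 + √ε ^ 2) := by
          have : √ε * (1 / (2 * ε) * q ^ 2) = 1 / (2 * √ε) * q ^ 2 := by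
            nth_rewrite 2 [← hsε2]; field_simp
          rw [this]; field_simp; ring
        have j4 : 0 ≤ (1 / (2 * √ε)) * ((q - √ε) ^ 2 + √ε ^ 2) := by positivity
        linarith
    _ = ENNReal.ofReal √ε * intervalMeasure H univ + ENNReal.ofReal √ε *
          ∫⁻ y, ENNReal.ofReal (wallDensity ε w f y) ∂(intervalMeasure H) := by
        rw [lintegral_add_left measurable_const, lintegral_const,
          lintegral_const_mul' _ _ ENNReal.ofReal_ne_top]
    _ ≤ ENNReal.ofReal √ε * ENNReal.ofReal (2 * H) + ENNReal.ofReal √ε * ENNReal.ofReal B := by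
        refine add_le_add (mul_le_mul_right (le_of_eq ?_) _) (mul_le_mul_right ?_ _)
        · rw [intervalMeasure, Measure.restrict_apply_univ, Real.volume_Ioo]; congr 1; ring
        · rw [hB, ENNReal.ofReal_toReal hBtop]; exact hE
    _ ≤ ENNReal.ofReal η := by
        rw [← ENNReal.ofReal_mul hsε.le, ← ENNReal.ofReal_mul hsε.le,
          ← ENNReal.ofReal_add (by positivity) (mul_nonneg hsε.le ENNReal.toReal_nonneg)]
        exact ENNReal.ofReal_le_ofReal e4.le

/-- Selection of nearly optimal elements. -/
lemma exists_tendsto_zero_of_eventually {W : Type*} {D : ℝ → W → ℝ≥0∞}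
    (h : ∀ η > 0, ∀ᶠ ε in 𝓝[>] (0 : ℝ), ∃ w, D ε w ≤ ENNReal.ofReal η) :
    ∃ w : ℝ → W, Tendsto (fun ε => D ε (w ε)) (𝓝[>] 0) (𝓝 0) := by
  obtain ⟨ε₀, w₀, -⟩ := (h 1 one_pos).exists
  -- For each ε an ε-minimiser of D ε is chosen; it depends on no η, so no diagonal extraction is
  -- needed.
  have hex : ∀ ε : ℝ, ∃ w, 0 < ε → D ε w ≤ (⨅ w, D ε w) + ENNReal.ofReal ε := by
    intro ε
    by_cases hε : 0 < ε
    · rcases eq_or_ne (⨅ w, D ε w) ⊤ with htop | htop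
      · exact ⟨w₀, fun _ => by rw [htop, top_add]; exact le_top⟩
      · obtain ⟨w, hw⟩ := iInf_lt_iff.1
          (ENNReal.lt_add_right htop (ENNReal.ofReal_pos.2 hε).ne')
        exact ⟨w, fun _ => hw.le⟩
    · exact ⟨w₀, fun h => absurd h hε⟩
  choose w hw using hex
  refine ⟨w, ENNReal.tendsto_nhds_zero.2 fun δ hδ => ?_⟩
  obtain ⟨η, hη0, hηδ⟩ : ∃ η : ℝ, 0 < η ∧ ENNReal.ofReal η ≤ δ := by
    rcases eq_or_ne δ ⊤ with rfl | hδ'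
    · exact ⟨1, one_pos, le_top⟩
    · exact ⟨δ.toReal, ENNReal.toReal_pos hδ.ne' hδ', (ENNReal.ofReal_toReal hδ').le⟩
  filter_upwards [h (η / 2) (half_pos hη0), eventually_small (half_pos hη0)] with ε ⟨w', hw'⟩ hε
  calc D ε (w ε) ≤ (⨅ w, D ε w) + ENNReal.ofReal ε := hw ε hε.1
    _ ≤ ENNReal.ofReal (η / 2) + ENNReal.ofReal (η / 2) :=
        add_le_add ((iInf_le _ w').trans hw') (ENNReal.ofReal_le_ofReal hε.2.le)
    _ = ENNReal.ofReal η := by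
        rw [← ENNReal.ofReal_add (by positivity) (by positivity), add_halves]
    _ ≤ δ := hηδ

/-! ### The stretching map, which makes all but finitely many walls disappear. -/

section stretch

/-- The truncation to `[-b, b]`. -/
def truncate (b s : ℝ) : ℝ := max (-b) (min b s)

/-- A map of `[-1, 1]` close to the identity that sends neighbourhoods of `±1` to `±1`. -/
def stretch (δ s : ℝ) : ℝ := truncate 1 ((1 + δ) * s - δ * truncate (1 - δ) s)

lemma truncate_of_abs_le {b s : ℝ} (h : |s| ≤ b) : truncate b s = s := by
  obtain ⟨h1, h2⟩ := abs_le.1 h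
  rw [truncate, min_eq_right h2, max_eq_right h1]

lemma abs_truncate_sub_le (b s t : ℝ) : |truncate b s - truncate b t| ≤ |s - t| := by
  unfold truncate
  rw [max_comm, max_comm (-b), min_comm, min_comm b]
  refine (abs_max_sub_max_le_abs _ _ _).trans ?_
  have := abs_min_sub_min_le_max s b t b
  simpa using this

lemma abs_truncate_le {b : ℝ} (hb : 0 ≤ b) (s : ℝ) : |truncate b s| ≤ b :=
  abs_le.2 ⟨le_max_left _ _, max_le (by linarith) (min_le_left _ _)⟩

variable {δ : ℝ}

lemma abs_stretch_sub_le (hδ : 0 ≤ δ) (s t : ℝ) :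
    |stretch δ s - stretch δ t| ≤ (1 + 2 * δ) * |s - t| := by
  refine (abs_truncate_sub_le _ _ _).trans ?_
  have e : (1 + δ) * s - δ * truncate (1 - δ) s - ((1 + δ) * t - δ * truncate (1 - δ) t)
      = (1 + δ) * (s - t) - δ * (truncate (1 - δ) s - truncate (1 - δ) t) := by ring
  rw [e]
  refine (abs_sub _ _).trans ?_
  rw [abs_mul, abs_mul, abs_of_nonneg hδ, abs_of_nonneg (by linarith : 0 ≤ 1 + δ)]
  have := mul_le_mul_of_nonneg_left (abs_truncate_sub_le (1 - δ) s t) hδ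
  linarith

lemma stretch_of_abs_le (hδ : 0 ≤ δ) {s : ℝ} (hs : |s| ≤ 1 - δ) : stretch δ s = s := by
  unfold stretch
  rw [truncate_of_abs_le hs]
  have : (1 + δ) * s - δ * s = s := by ring
  rw [this, truncate_of_abs_le (by linarith)]

lemma abs_stretch_le (s : ℝ) : |stretch δ s| ≤ 1 := abs_truncate_le zero_le_one _

lemma stretch_neg (s : ℝ) (hδ : δ ≤ 1) : stretch δ (-s) = -stretch δ s := by
  have h : ∀ b s : ℝ, 0 ≤ b → truncate b (-s) = -truncate b s := by
    intro b s hb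
    unfold truncate
    rcases le_total s b with h1 | h1 <;> rcases le_total (-b) s with h2 | h2
    · rw [min_eq_right (by linarith), max_eq_right (by linarith), min_eq_right h1, max_eq_right h2]
    · rw [min_eq_left (by linarith), max_eq_right (by linarith), min_eq_right h1, max_eq_left h2,
        neg_neg]
    · rw [min_eq_right (by linarith), max_eq_left (by linarith), min_eq_left h1,
        max_eq_right (by linarith)]
    · rw [min_eq_right (by linarith), max_eq_left (by linarith), min_eq_left h1,
        max_eq_right (by linarith)]
  unfold stretch
  rw [h _ _ (by linarith), ← h _ _ zero_le_one]
  congr 1; ring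

/-- Beyond 1 - δ the slope is 1 + δ until the value 1 is reached, slightly before s = 1 when δ > 0.
-/
lemma stretch_of_ge (hδ0 : 0 ≤ δ) (hδ : δ ≤ 1) {s : ℝ} (hs : 1 - δ ≤ s) :
    stretch δ s = min 1 (s + δ * (s - (1 - δ))) := by
  unfold stretch
  have h1 : truncate (1 - δ) s = 1 - δ := by
    rw [truncate, min_eq_left hs, max_eq_right (by linarith)]
  rw [h1]
  have h2 : (1 + δ) * s - δ * (1 - δ) = s + δ * (s - (1 - δ)) := by ring
  rw [h2, truncate, max_eq_right]
  refine le_min (by norm_num) ?_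
  nlinarith [mul_nonneg hδ0 (sub_nonneg.2 hs)]

lemma stretch_bounds (hδ0 : 0 ≤ δ) (hδ : δ ≤ 1) {s : ℝ} (hs0 : 0 ≤ s) (hs : s ≤ 1) :
    s ≤ stretch δ s ∧ stretch δ s ≤ s + δ := by
  rcases le_total s (1 - δ) with h | h
  · rw [stretch_of_abs_le hδ0 (by rwa [abs_of_nonneg hs0])]
    exact ⟨le_rfl, by linarith⟩
  · rw [stretch_of_ge hδ0 hδ h]
    have := mul_nonneg hδ0 (sub_nonneg.2 h)
    refine ⟨le_min hs (by linarith), (min_le_right _ _).trans ?_⟩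
    nlinarith

lemma stretch_eq_signed (hδ : δ ≤ 1) (s : ℝ) :
    stretch δ s = stretch δ |s| ∨ stretch δ s = -stretch δ |s| := by
  rcases abs_choice s with h | h
  · rw [h]; exact Or.inl rfl
  · rw [h, stretch_neg _ hδ, neg_neg]; exact Or.inr rfl

/-- Stretching moves values away from 0, which lowers 1 - s² and hence the cost of every wall. -/
lemma sq_le_stretch_sq (hδ0 : 0 ≤ δ) (hδ : δ ≤ 1) {s : ℝ} (hs : s ^ 2 ≤ 1) :
    s ^ 2 ≤ stretch δ s ^ 2 ∧ stretch δ s ^ 2 ≤ 1 ∧ stretch δ s ^ 2 - s ^ 2 ≤ 2 * δ := by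
  have h1 := (sq_le_one_iff_abs_le_one s).1 hs
  have h2 := stretch_bounds hδ0 hδ (abs_nonneg s) h1
  have h3 : stretch δ s ^ 2 = stretch δ |s| ^ 2 := by
    rcases stretch_eq_signed hδ s with h | h <;> rw [h]; ring
  have h4 : stretch δ s ^ 2 ≤ 1 := (sq_le_one_iff_abs_le_one _).2 (abs_stretch_le s)
  rw [← sq_abs s]
  have h5 := abs_nonneg s
  refine ⟨by rw [h3]; exact pow_le_pow_left₀ h5 h2.1 2, h4, ?_⟩
  have h6 : stretch δ |s| ≤ 1 := (le_abs_self _).trans (abs_stretch_le _)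
  rw [h3]
  nlinarith

lemma abs_stretch_sub_self_le (hδ0 : 0 ≤ δ) (hδ : δ ≤ 1) {s : ℝ} (hs : s ^ 2 ≤ 1) :
    |stretch δ s - s| ≤ δ := by
  have h1 := (sq_le_one_iff_abs_le_one s).1 hs
  have h2 := stretch_bounds hδ0 hδ (abs_nonneg s) h1
  rw [abs_le]
  rcases abs_choice s with h | h
  · rw [h] at h2; constructor <;> linarith
  · rw [h, stretch_neg _ hδ] at h2; constructor <;> linarith

/-- The outer branch reaches 1 exactly when (1 + δ)|s| = 1 + δ - δ². -/
lemma abs_lt_of_stretch_sq_lt (hδ0 : 0 ≤ δ) (hδ : δ ≤ 1) {s : ℝ} (hs : stretch δ s ^ 2 < 1) :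
    (1 + δ) * |s| < 1 + δ - δ ^ 2 := by
  by_contra hcon
  rw [not_lt] at hcon
  have h1 : stretch δ |s| = 1 := by
    rw [stretch_of_ge hδ0 hδ, min_eq_left]
    · linarith
    · nlinarith
  have h3 : stretch δ s ^ 2 = stretch δ |s| ^ 2 := by
    rcases stretch_eq_signed hδ s with h | h <;> rw [h]; ring
  rw [h3, h1] at hs
  norm_num at hs

end stretch

end

/-! ### Derivatives under stretching, and elementary estimates. -/

section

variable {H : ℝ}

section stretching

variable {f : ℝ → ℝ}

lemma abs_deriv_stretch_le {δ : ℝ} (hδ : 0 ≤ δ) {y : ℝ} (hd : DifferentiableAt ℝ f y) :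
    |deriv (fun y => stretch δ (f y)) y| ≤ (1 + 2 * δ) * |deriv f y| :=
  abs_deriv_le_of_eventually (by linarith) hd.hasDerivAt
    (Eventually.of_forall fun _ => abs_stretch_sub_le hδ _ _)

/-- Such a y is an interior maximum of f². -/
lemma deriv_eq_zero_of_sq_eq_one (hf1 : ∀ y ∈ Icc (-H) H, f y ^ 2 ≤ 1) {y : ℝ}
    (hy : y ∈ Ioo (-H) H) (hd : DifferentiableAt ℝ f y) (h1 : f y ^ 2 = 1) : deriv f y = 0 := by
  have hmax : IsLocalMax (fun x => f x ^ 2) y := by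
    filter_upwards [Ioo_mem_nhds hy.1 hy.2] with x hx
    rw [h1]; exact hf1 x (Ioo_subset_Icc_self hx)
  have h2 := hmax.deriv_eq_zero
  rw [(hd.hasDerivAt.fun_pow 2).deriv] at h2
  have h3 : f y ≠ 0 := by
    intro h; rw [h] at h1; norm_num at h1
  simpa [h3] using h2

/-- If |f y| < 1, stretching is the identity near f y for small δ. If f y ² = 1, both derivatives
vanish. -/
lemma eventually_deriv_stretch_eq (hf1 : ∀ y ∈ Icc (-H) H, f y ^ 2 ≤ 1) {y : ℝ}
    (hy : y ∈ Ioo (-H) H) (hd : DifferentiableAt ℝ f y) :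
    ∀ᶠ δ in 𝓝[>] (0 : ℝ), deriv (fun y => stretch δ (f y)) y = deriv f y := by
  rcases (hf1 y (Ioo_subset_Icc_self hy)).lt_or_eq with h1 | h1
  · rw [sq_lt_one_iff_abs_lt_one] at h1
    filter_upwards [eventually_small (sub_pos.2 h1)] with δ hδ
    apply EventuallyEq.deriv_eq
    filter_upwards [hd.continuousAt.abs.eventually_lt_const (by linarith [hδ.2] : |f y| < 1 - δ)]
      with x hx
    exact stretch_of_abs_le hδ.1.le hx.le
  · have h2 := deriv_eq_zero_of_sq_eq_one hf1 hy hd h1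
    filter_upwards [self_mem_nhdsWithin] with δ hδ
    have h3 := abs_deriv_stretch_le (le_of_lt hδ) hd
    rw [h2, abs_zero, mul_zero] at h3
    rw [h2]; exact abs_nonpos_iff.1 h3

/-- Dominated convergence: for δ < 1 the difference of derivatives is at most (1 + 2δ)|f'| + |f'| ≤
4|f'|. -/
lemma tendsto_lintegral_deriv_stretch (hH : 0 < H) (hf : ACL2 H f)
    (hf1 : ∀ y ∈ Icc (-H) H, f y ^ 2 ≤ 1) :
    Tendsto (fun δ => ∫⁻ y, ENNReal.ofReal
      ((deriv (fun y => stretch δ (f y)) y - deriv f y) ^ 2) ∂(intervalMeasure H))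
      (𝓝[>] 0) (𝓝 0) := by
  have key := tendsto_lintegral_filter_of_dominated_convergence (μ := intervalMeasure H)
    (l := 𝓝[>] (0 : ℝ)) (f := fun _ => 0) (F := fun δ y => ENNReal.ofReal
      ((deriv (fun y => stretch δ (f y)) y - deriv f y) ^ 2))
    (fun y => ENNReal.ofReal ((4 * deriv f y) ^ 2)) ?_ ?_ ?_ ?_
  · simpa using key
  · exact Eventually.of_forall fun δ =>
      (((measurable_deriv _).sub (measurable_deriv _)).pow_const 2).ennreal_ofReal
  · filter_upwards [eventually_small one_pos] with δ hδ
    filter_upwards [hf.ae_differentiableAt hH] with y hd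
    refine ENNReal.ofReal_le_ofReal (sq_le_sq.2 ?_)
    have h3 := abs_deriv_stretch_le hδ.1.le hd
    have h4 := abs_sub (deriv (fun y => stretch δ (f y)) y) (deriv f y)
    rw [abs_mul, abs_of_pos (by norm_num : (0 : ℝ) < 4)]
    nlinarith [abs_nonneg (deriv f y), hδ.2]
  · rw [lintegral_sq_eq (hf.memLp.const_mul 4)]
    exact ENNReal.ofReal_ne_top
  · filter_upwards [hf.ae_differentiableAt hH, ae_mem_Ioo] with y hd hy
    refine tendsto_const_nhds.congr' ?_
    filter_upwards [eventually_deriv_stretch_eq hf1 hy hd] with δ hδ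
    rw [hδ]; simp

lemma eventually_lintegral_deriv_stretch_le (hH : 0 < H) (hf : ACL2 H f) {η : ℝ} (hη : 0 < η) :
    ∀ᶠ δ in 𝓝[>] (0 : ℝ),
      ∫⁻ y, ENNReal.ofReal (deriv (fun y => stretch δ (f y)) y ^ 2) ∂(intervalMeasure H)
        ≤ ∫⁻ y, ENNReal.ofReal (deriv f y ^ 2) ∂(intervalMeasure H) + ENNReal.ofReal η := by
  set N := ∫ y, deriv f y ^ 2 ∂(intervalMeasure H) with hN
  have hN0 : 0 ≤ N := integral_nonneg fun _ => sq_nonneg _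
  have ht : Tendsto (fun δ : ℝ => (1 + 2 * δ) ^ 2 * N) (𝓝[>] 0) (𝓝 N) := by
    have : Continuous fun δ : ℝ => (1 + 2 * δ) ^ 2 * N := by fun_prop
    have h := this.tendsto 0
    simp only [mul_zero, add_zero, one_pow, one_mul] at h
    exact h.mono_left nhdsWithin_le_nhds
  filter_upwards [ht.eventually_le_const (by linarith : N < N + η), self_mem_nhdsWithin]
    with δ hδ hδ0
  rw [lintegral_sq_eq hf.memLp, ← ENNReal.ofReal_add hN0 hη.le]
  refine le_trans ?_ (ENNReal.ofReal_le_ofReal hδ)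
  rw [ENNReal.ofReal_mul (by positivity), hN, ← lintegral_sq_eq hf.memLp,
    ← lintegral_const_mul' _ _ ENNReal.ofReal_ne_top]
  refine lintegral_mono_ae ?_
  filter_upwards [hf.ae_differentiableAt hH] with y hd
  rw [← ENNReal.ofReal_mul (by positivity), ← mul_pow]
  refine ENNReal.ofReal_le_ofReal (sq_le_sq.2 ?_)
  rw [abs_mul, abs_of_pos (by linarith [mem_Ioi.1 hδ0] : 0 < 1 + 2 * δ)]
  exact abs_deriv_stretch_le (le_of_lt hδ0) hd

end stretching

lemma eq_signOf_mul_sqrt {c f : ℝ} (h : c ^ 2 + f ^ 2 = 1) : c = signOf c * √(1 - f ^ 2) := by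
  have h1 : √(1 - f ^ 2) = |c| := by rw [← h, add_sub_cancel_right, Real.sqrt_sq_eq_abs]
  rw [h1]
  rcases lt_or_ge 0 c with hc | hc
  · rw [signOf_of_pos hc, abs_of_pos hc, one_mul]
  · rw [signOf_of_nonpos hc, abs_of_nonpos hc]; ring

lemma sq_sqrt_sub_sqrt_le {x y d : ℝ} (hx : 0 ≤ x) (hxy : x ≤ y) (hd : y - x ≤ d) :
    (√x - √y) ^ 2 ≤ d := by
  have h1 := Real.sq_sqrt hx
  have h2 := Real.sq_sqrt (hx.trans hxy)
  have h3 := Real.sqrt_le_sqrt hxy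
  nlinarith [Real.sqrt_nonneg x]

lemma continuousOn_wallCost {f : ℝ → ℝ} {s : Set ℝ} (hf : ContinuousOn f s) :
    ContinuousOn (wallCost f) s :=
  ENNReal.continuous_ofReal.comp_continuousOn (by fun_prop)

lemma wallCost_le_of_sq_le {f g : ℝ → ℝ} {x y : ℝ} (h : f x ^ 2 ≤ g y ^ 2) :
    wallCost g y ≤ wallCost f x := by
  unfold wallCost
  gcongr

end

/-! ### Signs of the first component, in the interior and near the boundary. -/

section

variable {H : ℝ}

namespace LimitField

variable {a : ℝ} {u : ℝ → ℝ × ℝ} {f : ℝ → ℝ} {G : Set ℝ}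

lemma sq_le_one (hH : 0 < H) (h : LimitField H a u f G) {y : ℝ} (hy : y ∈ Icc (-H) H) :
    f y ^ 2 ≤ 1 := by
  rcases hy.2.lt_or_eq with h1 | h1
  · have := h.right_sq hH ⟨hy.1, h1⟩
    nlinarith [sq_nonneg (rightTrace (fun y => (u y).1) y)]
  · have := h.left_sq hH ⟨by rw [h1]; linarith, hy.2⟩
    nlinarith [sq_nonneg (leftTrace (fun y => (u y).1) y)]

/-- Only finitely many jumps have a cost bounded from below. -/
lemma finite_jumpSet (hH : 0 < H) (h : LimitField H a u f G) {c : ℝ} (hc : 0 < c) :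
    {x | x ∈ jumpSet H (fun y => (u y).1) ∧ c ≤ 1 - f x ^ 2}.Finite := by
  refine (h.reg.finite_jumps (Real.sqrt_pos.2 hc)).subset fun x hx => ⟨hx.1.1, ?_⟩
  have h1 := h.right_sq hH (Ioo_subset_Ico_self hx.1.1)
  have h2 := h.left_sq hH (Ioo_subset_Ioc_self hx.1.1)
  have h3 := h.reg.leftTrace_ne_rightTrace hx.1
  -- The traces at a jump are opposite, so its height is 2√(1 - f²) ≥ √c, and only finitely many
  -- jumps are that high.
  have h4 : leftTrace (fun y => (u y).1) x = -rightTrace (fun y => (u y).1) x :=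
    (sq_eq_sq_iff_eq_or_eq_neg.1 (by linarith)).resolve_left h3
  rw [← Real.sqrt_sq_eq_abs]
  refine Real.sqrt_le_sqrt ?_
  rw [h4]
  nlinarith [hx.2]

/-- Off the jump set the trace is continuous, and f² < 1 keeps it away from zero. -/
lemma signOf_rightTrace_eventually (hH : 0 < H) (h : LimitField H a u f G) {t : ℝ}
    (ht : t ∈ Ioo (-H) H) (hJ : t ∉ jumpSet H (fun y => (u y).1)) (hf : f t ^ 2 < 1) :
    ∀ᶠ x in 𝓝 t, signOf (rightTrace (fun y => (u y).1) x)
      = signOf (rightTrace (fun y => (u y).1) t) := by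
  have hc := h.reg.continuousAt_rightTrace ht hJ
  have h1 := h.right_sq hH (Ioo_subset_Ico_self ht)
  have h2 : rightTrace (fun y => (u y).1) t ≠ 0 := by
    intro h0; rw [h0] at h1; nlinarith
  rcases lt_or_gt_of_ne h2 with h3 | h3
  · filter_upwards [hc.eventually_lt_const h3] with x hx
    rw [signOf_of_nonpos hx.le, signOf_of_nonpos h3.le]
  · filter_upwards [hc.eventually_const_lt h3] with x hx
    rw [signOf_of_pos hx, signOf_of_pos h3]

/-- Near the left end the sign of `u₁` is `-1`, unless there is a boundary wall. -/
lemma eventually_left_end (hH : 0 < H) (ha : |a| < 1) (h : LimitField H a u f G)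
    (hw : rightTrace (fun y => (u y).1) (-H) ≠ √(1 - a ^ 2)) :
    ∀ᶠ ρ in 𝓝[>] (0 : ℝ), ∀ x ∈ Ioo (-H) (-H + 2 * ρ), rightTrace (fun y => (u y).1) x < 0 := by
  have hc : 0 < √(1 - a ^ 2) :=
    Real.sqrt_pos.2 (by rw [sub_pos, sq_lt_one_iff_abs_lt_one]; exact ha)
  have hm : -H ∈ Ico (-H) H := left_mem_Ico.2 (by linarith)
  have h1 := h.right_sq hH hm
  rw [h.left_eq] at h1
  have h2 := (eq_or_eq_neg_sqrt h1).resolve_left hw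
  have h3 := h.reg.tendsto_rightTrace_right hm
  have h4 := h3.eventually_lt_const (by rw [h2]; linarith : _ < (0 : ℝ))
  obtain ⟨b, hb, hsub⟩ := mem_nhdsGT_iff_exists_Ioo_subset.1 h4
  filter_upwards [eventually_small (by linarith [mem_Ioi.1 hb] : 0 < (b + H) / 2)] with ρ hρ x hx
  exact hsub ⟨hx.1, by linarith [hx.2, hρ.2]⟩

lemma eventually_right_end (hH : 0 < H) (ha : |a| < 1) (h : LimitField H a u f G)
    (hw : leftTrace (fun y => (u y).1) H ≠ -√(1 - a ^ 2)) :
    ∀ᶠ ρ in 𝓝[>] (0 : ℝ), ∀ x ∈ Ioo (H - 2 * ρ) H, 0 < rightTrace (fun y => (u y).1) x := by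
  have hc : 0 < √(1 - a ^ 2) :=
    Real.sqrt_pos.2 (by rw [sub_pos, sq_lt_one_iff_abs_lt_one]; exact ha)
  have hm : H ∈ Ioc (-H) H := right_mem_Ioc.2 (by linarith)
  have h1 := h.left_sq hH hm
  rw [h.right_eq] at h1
  have h2 := (eq_or_eq_neg_sqrt h1).resolve_right hw
  have h3 := h.reg.tendsto_rightTrace_left hm
  have h4 := h3.eventually_const_lt (by rw [h2]; exact hc : (0 : ℝ) < _)
  obtain ⟨b, hb, hsub⟩ := mem_nhdsLT_iff_exists_Ioo_subset.1 h4
  filter_upwards [eventually_small (by linarith [mem_Iio.1 hb] : 0 < (H - b) / 2)] with ρ hρ x hx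
  exact hsub ⟨by linarith [hx.1, hρ.2], hx.2⟩

/-- Continuity of the wall cost allows a boundary wall to be moved inside by ρ at small extra cost.
-/
lemma eventually_wallCost_le (hH : 0 < H) (h : LimitField H a u f G) {η : ℝ} (hη : 0 < η) :
    ∀ᶠ ρ in 𝓝[>] (0 : ℝ), wallCost f (-H + ρ) ≤ wallCost f (-H) + ENNReal.ofReal η ∧
      wallCost f (H - ρ) ≤ wallCost f H + ENNReal.ofReal η := by
  have hc := continuousOn_wallCost (h.ac.continuousOn hH)
  have h1 : Tendsto (fun ρ : ℝ => -H + ρ) (𝓝[>] 0) (𝓝[Icc (-H) H] (-H)) := by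
    refine tendsto_nhdsWithin_iff.2 ⟨?_, ?_⟩
    · have : Tendsto (fun ρ : ℝ => -H + ρ) (𝓝 0) (𝓝 (-H + 0)) := Continuous.tendsto (by fun_prop) 0
      rw [add_zero] at this
      exact this.mono_left nhdsWithin_le_nhds
    · filter_upwards [eventually_small hH] with ρ hρ
      constructor <;> linarith [hρ.1, hρ.2]
  have h2 : Tendsto (fun ρ : ℝ => H - ρ) (𝓝[>] 0) (𝓝[Icc (-H) H] H) := by
    refine tendsto_nhdsWithin_iff.2 ⟨?_, ?_⟩
    · have : Tendsto (fun ρ : ℝ => H - ρ) (𝓝 0) (𝓝 (H - 0)) := Continuous.tendsto (by fun_prop) 0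
      rw [sub_zero] at this
      exact this.mono_left nhdsWithin_le_nhds
    · filter_upwards [eventually_small hH] with ρ hρ
      constructor <;> linarith [hρ.1, hρ.2]
  have hη' := (ENNReal.ofReal_pos.2 hη).ne'
  have e1 := (Tendsto.comp (hc (-H) (left_mem_Icc.2 (by linarith))) h1).eventually_le_const
    (ENNReal.lt_add_right (wallCost_ne_top f (-H)) hη')
  have e2 := (Tendsto.comp (hc H (right_mem_Icc.2 (by linarith))) h2).eventually_le_const
    (ENNReal.lt_add_right (wallCost_ne_top f H) hη')
  filter_upwards [e1, e2] with ρ h1 h2 using ⟨h1, h2⟩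

end LimitField

/-- The sign of `v` away from the boundary, with prescribed signs near the boundary. -/
def cutSign (v : ℝ → ℝ) (b₁ b₂ t : ℝ) : ℝ := if t ≤ b₁ then -1 else if b₂ ≤ t then 1 else signOf (v t)

section cutSign

variable {v : ℝ → ℝ} {b₁ b₂ t : ℝ}

lemma cutSign_of_le (h : t ≤ b₁) : cutSign v b₁ b₂ t = -1 := if_pos h

lemma cutSign_of_ge (hb : b₁ < b₂) (h : b₂ ≤ t) : cutSign v b₁ b₂ t = 1 := by
  rw [cutSign, if_neg (by linarith), if_pos h]

lemma cutSign_of_mem (h : t ∈ Ioo b₁ b₂) : cutSign v b₁ b₂ t = signOf (v t) := by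
  rw [cutSign, if_neg (not_le.2 h.1), if_neg (not_le.2 h.2)]

lemma cutSign_ne_zero : cutSign v b₁ b₂ t ≠ 0 := by
  unfold cutSign signOf; split_ifs <;> norm_num

lemma signOf_cutSign_of_mem (h : t ∈ Ioo b₁ b₂) : signOf (cutSign v b₁ b₂ t) = signOf (v t) := by
  rw [cutSign_of_mem h]
  unfold signOf
  split_ifs with h1 h2 h2 <;> first | rfl | (norm_num at h2)

/-- The function is locally constant near t. At b₁ and b₂ this requires the prescribed sign to match
that of v on the inner side, which is the case without a boundary wall. -/
lemma continuousAt_cutSign (hb : b₁ < b₂) (h₁ : t = b₁ → ∀ᶠ x in 𝓝[>] b₁, v x < 0)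
    (h₂ : t = b₂ → ∀ᶠ x in 𝓝[<] b₂, 0 < v x)
    (h : t ∈ Ioo b₁ b₂ → ∀ᶠ x in 𝓝 t, signOf (v x) = signOf (v t)) :
    ContinuousAt (cutSign v b₁ b₂) t := by
  suffices ∃ c, ∀ᶠ x in 𝓝 t, cutSign v b₁ b₂ x = c by
    obtain ⟨c, hc⟩ := this
    exact continuousAt_const.congr (EventuallyEq.symm hc)
  rcases lt_trichotomy t b₁ with h1 | h1 | h1
  · exact ⟨-1, (eventually_le_nhds h1).mono fun x hx => cutSign_of_le hx⟩
  · refine ⟨-1, ?_⟩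
    have h3 := eventually_nhdsWithin_iff.1 (h₁ h1)
    subst h1
    filter_upwards [h3, eventually_lt_nhds hb] with x hx hx2
    rcases le_or_gt x t with h4 | h4
    · exact cutSign_of_le h4
    · rw [cutSign_of_mem ⟨h4, hx2⟩, signOf_of_nonpos (hx h4).le]
  rcases lt_trichotomy t b₂ with h2 | h2 | h2
  · refine ⟨signOf (v t), ?_⟩
    filter_upwards [h ⟨h1, h2⟩, Ioo_mem_nhds h1 h2] with x hx hx2
    rw [cutSign_of_mem hx2, hx]
  · refine ⟨1, ?_⟩
    have h3 := eventually_nhdsWithin_iff.1 (h₂ h2)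
    subst h2
    filter_upwards [h3, eventually_gt_nhds hb] with x hx hx2
    rcases le_or_gt t x with h4 | h4
    · exact cutSign_of_ge hb h4
    · rw [cutSign_of_mem ⟨hx2, h4⟩, signOf_of_pos (hx h4)]
  · exact ⟨1, (eventually_ge_nhds h2).mono fun x hx => cutSign_of_ge hb hx⟩

lemma measurable_signOf : Measurable signOf :=
  Measurable.ite measurableSet_Ioi measurable_const measurable_const

lemma aemeasurable_cutSign {μ : Measure ℝ} (hv : AEMeasurable v μ) :
    AEMeasurable (cutSign v b₁ b₂) μ := by
  obtain ⟨v', hm, hv'⟩ := hv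
  refine ⟨cutSign v' b₁ b₂, Measurable.ite measurableSet_Iic measurable_const
    (Measurable.ite measurableSet_Ici measurable_const (measurable_signOf.comp hm)), ?_⟩
  filter_upwards [hv'] with t ht
  simp only [cutSign, ht]

end cutSign

end

/-! ### Reduction to finitely many interior walls. -/

section

variable {H : ℝ}

namespace LimitField

variable {a : ℝ} {u : ℝ → ℝ × ℝ} {f : ℝ → ℝ} {G : Set ℝ}

/-- In the two boundary strips of width ρ the integrand is at most 4, giving 8ρ. Elsewhere the signs
agree, and (√x - √y)² ≤ |x - y| ≤ δ. -/
lemma lintegral_cutSign_sub_sq_le (hH : 0 < H) (h : LimitField H a u f G) {g : ℝ → ℝ} {δ ρ : ℝ}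
    (hδ : 0 ≤ δ) (hg : ∀ y ∈ Icc (-H) H, f y ^ 2 ≤ g y ^ 2 ∧ g y ^ 2 ≤ 1 ∧ g y ^ 2 - f y ^ 2 ≤ δ)
    (hρ : 0 ≤ ρ) :
    ∫⁻ y, ENNReal.ofReal ((signOf (cutSign (rightTrace fun y => (u y).1) (-H + ρ) (H - ρ) y)
      * √(1 - g y ^ 2) - (u y).1) ^ 2) ∂(intervalMeasure H)
      ≤ ENNReal.ofReal (δ * (2 * H) + 8 * ρ) := by
  set R := cutSign (rightTrace fun y => (u y).1) (-H + ρ) (H - ρ) with hR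
  set A := Ioc (-H) (-H + ρ) with hA
  set B := Ico (H - ρ) H with hB
  calc ∫⁻ y, ENNReal.ofReal ((signOf (R y) * √(1 - g y ^ 2) - (u y).1) ^ 2) ∂(intervalMeasure H)
      ≤ ∫⁻ y, (ENNReal.ofReal δ + (A.indicator (fun _ => ENNReal.ofReal 4) y
          + B.indicator (fun _ => ENNReal.ofReal 4) y)) ∂(intervalMeasure H) := by
        refine lintegral_mono_ae ?_
        filter_upwards [h.reg.rightTrace_ae_eq h.integrable, ae_mem_Ioo] with y hy hyI
        have h1 := h.right_sq hH (Ioo_subset_Ico_self hyI)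
        obtain ⟨g1, g2, g3⟩ := hg y (Ioo_subset_Icc_self hyI)
        rw [hy] at h1
        have hbad : ENNReal.ofReal ((signOf (R y) * √(1 - g y ^ 2) - (u y).1) ^ 2)
            ≤ ENNReal.ofReal 4 := by
          refine ENNReal.ofReal_le_ofReal ?_
          have s1 : (signOf (R y) * √(1 - g y ^ 2)) ^ 2 ≤ 1 := by
            rw [mul_pow, signOf_sq, Real.sq_sqrt (by linarith)]; nlinarith [sq_nonneg (g y)]
          have s2 : (u y).1 ^ 2 ≤ 1 := by nlinarith [sq_nonneg (f y)]
          nlinarith [sq_nonneg (signOf (R y) * √(1 - g y ^ 2) + (u y).1)]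
        by_cases hyA : y ∈ A
        · rw [indicator_of_mem hyA]
          exact (hbad.trans le_self_add).trans le_add_self
        by_cases hyB : y ∈ B
        · rw [indicator_of_mem hyB]
          exact (hbad.trans le_add_self).trans le_add_self
        refine le_add_right (ENNReal.ofReal_le_ofReal ?_)
        have hy1 : -H + ρ < y := by
          by_contra hc; exact hyA ⟨hyI.1, not_lt.1 hc⟩
        have hy2 : y < H - ρ := by
          by_contra hc; exact hyB ⟨not_lt.1 hc, hyI.2⟩
        rw [hR, signOf_cutSign_of_mem ⟨hy1, hy2⟩, hy]
        nth_rewrite 2 [eq_signOf_mul_sqrt h1]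
        rw [← mul_sub, mul_pow, signOf_sq, one_mul]
        exact sq_sqrt_sub_sqrt_le (by linarith) (by linarith) (by linarith)
    _ ≤ ENNReal.ofReal δ * ENNReal.ofReal (2 * H)
          + (ENNReal.ofReal 4 * ENNReal.ofReal ρ + ENNReal.ofReal 4 * ENNReal.ofReal ρ) := by
        have hmA : MeasurableSet A := measurableSet_Ioc
        have hmB : MeasurableSet B := measurableSet_Ico
        rw [lintegral_add_left measurable_const, lintegral_add_left
          (measurable_const.indicator hmA), lintegral_const, lintegral_indicator_const hmA,
          lintegral_indicator_const hmB]
        have hle : ∀ s, intervalMeasure H s ≤ volume s := fun s => Measure.restrict_apply_le _ _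
        gcongr
        · refine le_of_eq ?_
          rw [intervalMeasure, Measure.restrict_apply_univ, Real.volume_Ioo]
          congr 1; ring
        · refine (hle _).trans_eq ?_
          rw [hA, Real.volume_Ioc]; congr 1; ring
        · refine (hle _).trans_eq ?_
          rw [hB, Real.volume_Ico]; congr 1; ring
    _ = ENNReal.ofReal (δ * (2 * H) + 8 * ρ) := by
        rw [← ENNReal.ofReal_mul hδ, ← ENNReal.ofReal_mul (by norm_num),
          ← ENNReal.ofReal_add (by positivity) (by positivity),
          ← ENNReal.ofReal_add (by positivity) (by positivity)]
        congr 1; ring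

open scoped Classical in
/-- Limit fields are approximated by fields with finitely many transitions, all in the interior. -/
lemma exists_finite_transitions (hH : 0 < H) (ha : |a| < 1) (h : LimitField H a u f G) {η : ℝ}
    (hη : 0 < η) : ∃ (g R : ℝ → ℝ) (P : Finset ℝ), ACL2 H g ∧ (∀ y ∈ Icc (-H) H, g y ^ 2 ≤ 1) ∧
      g (-H) = a ∧ g H = a ∧ (∀ p ∈ P, p ∈ Ioo (-H) H) ∧
      (∀ t ∈ Icc (-H) H, t ∉ P → g t ^ 2 < 1 →
        ContinuousWithinAt R (Icc (-H) H) t ∧ R t ≠ 0) ∧ R (-H) < 0 ∧ 0 < R H ∧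
      AEMeasurable R (intervalMeasure H) ∧
      ∑ p ∈ P, wallCost g p ≤ ∑' x : jumpSet H (fun y => (u y).1), wallCost f x
        + (if rightTrace (fun y => (u y).1) (-H) = √(1 - a ^ 2) then wallCost f (-H) else 0)
        + (if leftTrace (fun y => (u y).1) H = -√(1 - a ^ 2) then wallCost f H else 0)
        + ENNReal.ofReal η ∧
      ∫⁻ y, ENNReal.ofReal ((signOf (R y) * √(1 - g y ^ 2) - (u y).1) ^ 2) ∂(intervalMeasure H)
        ≤ ENNReal.ofReal η ∧
      ∫⁻ y, ENNReal.ofReal ((g y - f y) ^ 2) ∂(intervalMeasure H) ≤ ENNReal.ofReal η ∧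
      ∫⁻ y, ENNReal.ofReal ((deriv g y - deriv f y) ^ 2) ∂(intervalMeasure H) ≤ ENNReal.ofReal η ∧
      ∫⁻ y, ENNReal.ofReal (deriv g y ^ 2) ∂(intervalMeasure H)
        ≤ ∫⁻ y, ENNReal.ofReal (deriv f y ^ 2) ∂(intervalMeasure H) + ENNReal.ofReal η := by
  have hf1 : ∀ y ∈ Icc (-H) H, f y ^ 2 ≤ 1 := fun y hy => h.sq_le_one hH hy
  -- The bound δ < 1 - |a| keeps the boundary value a fixed under stretching. With δ < η/(8H) and,
  -- below, ρ < η/16, the L² error 4Hδ + 8ρ stays below η.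
  obtain ⟨δ, ⟨⟨⟨⟨d1, d2⟩, ⟨-, d3⟩⟩, ⟨-, d4⟩⟩, d5⟩, d6⟩ :=
    (((((eventually_small (sub_pos.2 ha)).and (eventually_small one_pos)).and
      (eventually_small (b := η / (8 * H)) (by positivity))).and
      (ENNReal.tendsto_nhds_zero.1 (tendsto_lintegral_deriv_stretch hH h.ac hf1) _
        (ENNReal.ofReal_pos.2 hη))).and
      (eventually_lintegral_deriv_stretch_le hH h.ac hη)).exists
  rw [lt_div_iff₀ (by positivity)] at d4
  set g : ℝ → ℝ := fun y => stretch δ (f y) with hgdef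
  have hg : ∀ y ∈ Icc (-H) H, f y ^ 2 ≤ g y ^ 2 ∧ g y ^ 2 ≤ 1 ∧ g y ^ 2 - f y ^ 2 ≤ 2 * δ :=
    fun y hy => sq_le_stretch_sq d1.le d3.le (hf1 y hy)
  have hgac : ACL2 H g := (h.ac.of_abs_sub_le hH (by linarith : 0 ≤ 1 + 2 * δ)
    fun x _ y _ => abs_stretch_sub_le d1.le _ _).1
  have hsa : stretch δ a = a := stretch_of_abs_le d1.le (by linarith)
  -- Where g² < 1 one has |f| < 1 - c, hence 1 - f² ≥ c. Jumps with smaller 1 - f² lie where g² = 1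
  -- and need no transition.
  set c : ℝ := δ ^ 2 / (1 + δ) with hc
  have hc0 : 0 < c := by positivity
  have hgc : ∀ y ∈ Icc (-H) H, g y ^ 2 < 1 → c ≤ 1 - f y ^ 2 := by
    intro y hy hgy
    have h1 := abs_lt_of_stretch_sq_lt d1.le d3.le hgy
    have h2 := (sq_le_one_iff_abs_le_one _).1 (hf1 y hy)
    rw [hc, div_le_iff₀ (by linarith), ← sq_abs (f y)]
    nlinarith [abs_nonneg (f y), mul_nonneg (mul_nonneg (abs_nonneg (f y)) (sub_nonneg.2 h2)) d1.le,
      mul_nonneg (abs_nonneg (f y)) (sub_nonneg.2 h2)]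
  set v := rightTrace fun y => (u y).1 with hv
  have hleft : ∀ᶠ ρ in 𝓝[>] (0 : ℝ), v (-H) ≠ √(1 - a ^ 2) →
      ∀ x ∈ Ioo (-H) (-H + 2 * ρ), v x < 0 := by
    by_cases hw : v (-H) = √(1 - a ^ 2)
    · exact Eventually.of_forall fun _ hn => absurd hw hn
    · exact (h.eventually_left_end hH ha hw).mono fun _ hx _ => hx
  have hright : ∀ᶠ ρ in 𝓝[>] (0 : ℝ), leftTrace (fun y => (u y).1) H ≠ -√(1 - a ^ 2) →
      ∀ x ∈ Ioo (H - 2 * ρ) H, 0 < v x := by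
    by_cases hw : leftTrace (fun y => (u y).1) H = -√(1 - a ^ 2)
    · exact Eventually.of_forall fun _ hn => absurd hw hn
    · exact (h.eventually_right_end hH ha hw).mono fun _ hx _ => hx
  obtain ⟨ρ, ⟨⟨⟨⟨r1, r2⟩, ⟨-, r3⟩⟩, r4⟩, r5⟩, r6, r7⟩ :=
    (((((eventually_small hH).and (eventually_small (b := η / 16) (by positivity))).and hleft).and
      hright).and (h.eventually_wallCost_le hH (half_pos hη))).exists
  have hb : -H + ρ < H - ρ := by linarith
  have hb1 : -H + ρ ∈ Ioo (-H) H := ⟨by linarith, by linarith⟩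
  have hb2 : H - ρ ∈ Ioo (-H) H := ⟨by linarith, by linarith⟩
  have hfin := h.finite_jumpSet hH hc0
  set P₀ := hfin.toFinset with hP₀
  -- A wall at the left end is represented by a transition at -H + ρ; otherwise the sign near -H is
  -- already -1 and no point is added. The right end is treated likewise.
  set P₁ : Finset ℝ := if v (-H) = √(1 - a ^ 2) then {-H + ρ} else ∅ with hP₁
  set P₂ : Finset ℝ :=
    if leftTrace (fun y => (u y).1) H = -√(1 - a ^ 2) then {H - ρ} else ∅ with hP₂
  have hm1 : ∀ p ∈ P₁, p = -H + ρ := by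
    intro p hp; rw [hP₁] at hp; split_ifs at hp
    · exact Finset.mem_singleton.1 hp
    · simp at hp
  have hm2 : ∀ p ∈ P₂, p = H - ρ := by
    intro p hp; rw [hP₂] at hp; split_ifs at hp
    · exact Finset.mem_singleton.1 hp
    · simp at hp
  have hPI : ∀ p ∈ P₀ ∪ P₁ ∪ P₂, p ∈ Ioo (-H) H := by
    intro p hp
    rw [Finset.mem_union, Finset.mem_union] at hp
    rcases hp with (hp | hp) | hp
    · exact (hfin.mem_toFinset.1 hp).1.1
    · rw [hm1 p hp]; exact hb1
    · rw [hm2 p hp]; exact hb2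
  have hcost : ∀ p ∈ Ioo (-H) H, wallCost g p ≤ wallCost f p := fun p hp =>
    wallCost_le_of_sq_le (hg p (Ioo_subset_Icc_self hp)).1
  refine ⟨g, cutSign v (-H + ρ) (H - ρ), P₀ ∪ P₁ ∪ P₂, hgac, fun y hy => (hg y hy).2.1, ?_, ?_,
    hPI, ?_, ?_, ?_, aemeasurable_cutSign ?_, ?_, ?_, ?_, d5, d6⟩
  · simp only [hgdef, h.left_eq, hsa]
  · simp only [hgdef, h.right_eq, hsa]
  · intro t ht htP hgt
    refine ⟨(continuousAt_cutSign hb ?_ ?_ ?_).continuousWithinAt, cutSign_ne_zero⟩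
    · intro e
      have hn : v (-H) ≠ √(1 - a ^ 2) := fun hn => htP (by
        rw [hP₁, if_pos hn, e]; simp)
      filter_upwards [Ioo_mem_nhdsGT (by linarith : -H + ρ < -H + 2 * ρ)] with x hx
      exact r4 hn x ⟨by linarith [hx.1], hx.2⟩
    · intro e
      have hn : leftTrace (fun y => (u y).1) H ≠ -√(1 - a ^ 2) := fun hn => htP (by
        rw [hP₂, if_pos hn, e]; simp)
      filter_upwards [Ioo_mem_nhdsLT (by linarith : H - 2 * ρ < H - ρ)] with x hx
      exact r5 hn x ⟨hx.1, by linarith [hx.2]⟩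
    · intro hI
      have h1 := hgc t ht hgt
      refine h.signOf_rightTrace_eventually hH ⟨by linarith [hI.1], by linarith [hI.2]⟩ ?_
        (by linarith)
      intro hJ
      exact htP (Finset.mem_union_left _ (Finset.mem_union_left _ (hfin.mem_toFinset.2 ⟨hJ, h1⟩)))
  · rw [cutSign_of_le (by linarith)]; norm_num
  · rw [cutSign_of_ge hb (by linarith)]; norm_num
  · exact h.integrable.aestronglyMeasurable.aemeasurable.congr
      (h.reg.rightTrace_ae_eq h.integrable).symm
  · have hun : ∀ A B : Finset ℝ, ∑ p ∈ A ∪ B, wallCost f p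
        ≤ ∑ p ∈ A, wallCost f p + ∑ p ∈ B, wallCost f p := fun A B => by
      rw [← Finset.sum_union_inter]; exact le_self_add
    have s0 : ∑ p ∈ P₀, wallCost f p ≤ ∑' x : jumpSet H (fun y => (u y).1), wallCost f x := by
      rw [tsum_subtype (jumpSet H fun y => (u y).1) (wallCost f)]
      refine le_trans (Finset.sum_le_sum fun p hp => ?_) (ENNReal.sum_le_tsum P₀)
      rw [indicator_of_mem (hfin.mem_toFinset.1 hp).1]
    have s1 : ∑ p ∈ P₁, wallCost f p
        ≤ (if v (-H) = √(1 - a ^ 2) then wallCost f (-H) else 0) + ENNReal.ofReal (η / 2) := by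
      rw [hP₁]; split_ifs
      · rw [Finset.sum_singleton]; exact r6
      · simp
    have s2 : ∑ p ∈ P₂, wallCost f p
        ≤ (if leftTrace (fun y => (u y).1) H = -√(1 - a ^ 2) then wallCost f H else 0)
          + ENNReal.ofReal (η / 2) := by
      rw [hP₂]; split_ifs
      · rw [Finset.sum_singleton]; exact r7
      · simp
    have hηη : ENNReal.ofReal η = ENNReal.ofReal (η / 2) + ENNReal.ofReal (η / 2) := by
      rw [← ENNReal.ofReal_add (by positivity) (by positivity), add_halves]
    calc ∑ p ∈ P₀ ∪ P₁ ∪ P₂, wallCost g p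
        ≤ ∑ p ∈ P₀ ∪ P₁ ∪ P₂, wallCost f p := Finset.sum_le_sum fun p hp => hcost p (hPI p hp)
      _ ≤ ∑ p ∈ P₀, wallCost f p + ∑ p ∈ P₁, wallCost f p + ∑ p ∈ P₂, wallCost f p :=
          (hun _ _).trans (add_le_add (hun _ _) le_rfl)
      _ ≤ _ := add_le_add (add_le_add s0 s1) s2
      _ = _ := by rw [hηη]; ring
  · refine (h.lintegral_cutSign_sub_sq_le hH (by linarith) hg r1.le).trans
      (ENNReal.ofReal_le_ofReal ?_)
    nlinarith
  · calc ∫⁻ y, ENNReal.ofReal ((g y - f y) ^ 2) ∂(intervalMeasure H)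
        ≤ ∫⁻ _, ENNReal.ofReal δ ∂(intervalMeasure H) := by
          refine lintegral_mono_ae ?_
          filter_upwards [ae_mem_Ioo] with y hy
          refine ENNReal.ofReal_le_ofReal ?_
          have h1 := abs_stretch_sub_self_le d1.le d3.le (hf1 y (Ioo_subset_Icc_self hy))
          rw [← sq_abs]
          have h2 : |g y - f y| ≤ δ := h1
          nlinarith [abs_nonneg (g y - f y)]
      _ = ENNReal.ofReal (δ * (2 * H)) := by
          rw [lintegral_const, intervalMeasure, Measure.restrict_apply_univ, Real.volume_Ioo,
            ENNReal.ofReal_mul d1.le]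
          congr 2; ring
      _ ≤ ENNReal.ofReal η := ENNReal.ofReal_le_ofReal (by nlinarith)

end LimitField

end

/-! ### Admissible pairs and modes of convergence. -/

section

variable {H : ℝ}

/-- Admissible pairs of representatives. -/
def RecoveryField (H a : ℝ) : Type :=
  {w : (ℝ → ℝ) × (ℝ → ℝ) // ACL2 H w.1 ∧ ACL2 H w.2 ∧ w.1 (-H) = -√(1 - a ^ 2) ∧
    w.2 (-H) = a ∧ w.1 H = √(1 - a ^ 2) ∧ w.2 H = a}

namespace RecoveryField

variable {a : ℝ}

/-- The vector field with the given components. -/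
def toField (w : RecoveryField H a) (y : ℝ) : ℝ × ℝ := (w.1.1 y, w.1.2 y)

lemma memA1 (hH : 0 < H) (w : RecoveryField H a) : MemA1 H a w.toField := by
  obtain ⟨h1, h2, h3, h4, h5, h6⟩ := w.2
  have hl : -H ∈ Icc (-H) H := left_mem_Icc.2 (by linarith)
  have hr : H ∈ Icc (-H) H := right_mem_Icc.2 (by linarith)
  have c1 := fun {x : ℝ} (hx : x ∈ Icc (-H) H) =>
    contRep_eq hH (h1.continuousOn hH) (EventuallyEq.refl _ w.1.1) hx
  have c2 := fun {x : ℝ} (hx : x ∈ Icc (-H) H) =>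
    contRep_eq hH (h2.continuousOn hH) (EventuallyEq.refl _ w.1.2) hx
  exact ⟨h1.memH1 hH, h2.memH1 hH, (c1 hl).trans h3, (c2 hl).trans h4, (c1 hr).trans h5,
    (c2 hr).trans h6⟩

end RecoveryField

lemma sub_sq_le_two_mul_add (x y z : ℝ) :
    ENNReal.ofReal ((x - z) ^ 2)
      ≤ ENNReal.ofReal 2 * (ENNReal.ofReal ((x - y) ^ 2) + ENNReal.ofReal ((y - z) ^ 2)) := by
  rw [← ENNReal.ofReal_add (by positivity) (by positivity), ← ENNReal.ofReal_mul (by norm_num)]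
  refine ENNReal.ofReal_le_ofReal ?_
  nlinarith [sq_nonneg ((x - y) - (y - z))]

lemma tendsto_strongL2_of_lintegral {ι : Type*} {l : Filter ι} {v : ι → ℝ → ℝ} {w : ℝ → ℝ}
    (h : Tendsto (fun i => ∫⁻ y, ENNReal.ofReal ((v i y - w y) ^ 2) ∂(intervalMeasure H)) l
      (𝓝 0)) : StrongL2Tendsto H l v w := by
  have h1 := (ENNReal.continuous_rpow_const (y := 1 / 2)).tendsto 0 |>.comp h
  rw [ENNReal.zero_rpow_of_pos (by norm_num)] at h1
  refine h1.congr fun i => ?_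
  rw [eLpNorm_eq_lintegral_rpow_enorm_toReal (by norm_num) (by norm_num)]
  simp only [Function.comp, ENNReal.toReal_ofNat]
  congr 1
  refine lintegral_congr fun y => ?_
  rw [Real.enorm_eq_ofReal_abs, ENNReal.ofReal_rpow_of_nonneg (abs_nonneg _) (by norm_num)]
  congr 1
  rw [Real.rpow_ofNat, sq_abs]

lemma weakL2Tendsto_of_strong {ι : Type*} {l : Filter ι} {v : ι → ℝ → ℝ} {w : ℝ → ℝ}
    (hv : ∀ i, MemLp (v i) 2 (intervalMeasure H)) (hw : MemLp w 2 (intervalMeasure H))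
    (h : StrongL2Tendsto H l v w) : WeakL2Tendsto H l v w := by
  intro ψ hψ
  rw [tendsto_iff_edist_tendsto_0]
  have h1 : Tendsto (fun i => eLpNorm (fun y => v i y - w y) 2 (intervalMeasure H)
      * eLpNorm ψ 2 (intervalMeasure H)) l (𝓝 0) := by
    have := ENNReal.Tendsto.mul_const h (b := eLpNorm ψ 2 (intervalMeasure H))
      (Or.inr hψ.eLpNorm_ne_top)
    rwa [zero_mul] at this
  refine tendsto_of_tendsto_of_tendsto_of_le_of_le tendsto_const_nhds h1 (fun _ => zero_le)
    fun i => ?_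
  have i1 : Integrable (fun y => v i y * ψ y) (intervalMeasure H) := (hv i).integrable_mul hψ
  have i2 : Integrable (fun y => w y * ψ y) (intervalMeasure H) := hw.integrable_mul hψ
  have h2 := eLpNorm_smul_le_mul_eLpNorm (p := 2) (q := 2) (r := 1) hψ.aestronglyMeasurable
    ((hv i).sub hw).aestronglyMeasurable
  rw [edist_eq_enorm_sub, ← integral_sub i1 i2]
  refine (enorm_integral_le_lintegral_enorm _).trans ?_
  rw [eLpNorm_one_eq_lintegral_enorm] at h2
  refine le_trans (le_of_eq (lintegral_congr fun y => ?_)) h2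
  rw [← sub_mul]; rfl

end

/-! ### The recovery family. -/

section

variable {H L a : ℝ} {u : ℝ → ℝ × ℝ} {f : ℝ → ℝ} {G : Set ℝ}

/-- Excess energy of a recovery field, plus its squared distances to the limit field. -/
def recoveryDefect (L : ℝ) (u : ℝ → ℝ × ℝ) (f : ℝ → ℝ) (ε : ℝ) (w : RecoveryField H a) : ℝ≥0∞ :=
  (energyEps H L ε w.toField - energyZero H L a u)
    + (∫⁻ y, ENNReal.ofReal ((w.1.1 y - (u y).1) ^ 2) ∂(intervalMeasure H)
      + ∫⁻ y, ENNReal.ofReal ((w.1.2 y - f y) ^ 2) ∂(intervalMeasure H)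
      + ∫⁻ y, ENNReal.ofReal ((deriv w.1.2 y - deriv f y) ^ 2) ∂(intervalMeasure H))

lemma LimitField.eventually_exists_recoveryDefect_le (hH : 0 < H) (hL : 0 < L) (ha : |a| < 1)
    (h : LimitField H a u f G) {η : ℝ} (hη : 0 < η) :
    ∀ᶠ ε in 𝓝[>] (0 : ℝ), ∃ w : RecoveryField H a, recoveryDefect L u f ε w ≤ ENNReal.ofReal η := by
  classical
  -- The budget is (L/2 + 2)κ for the energy, 4κ for the first component and κ each for the second
  -- component and its derivative, in total η.
  set κ : ℝ := η / (L / 2 + 8) with hκ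
  have hκ0 : 0 < κ := by positivity
  obtain ⟨g, R, P, hg, hg1, hgl, hgr, hPI, hR, hRl, hRr, hRm, c1, c2, c3, c4, c5⟩ :=
    h.exists_finite_transitions hH ha hκ0
  filter_upwards [eventually_exists_recovery hH ha hg hg1 hgl hgr hPI hR hRl hRr hκ0,
    self_mem_nhdsWithin] with ε ⟨w, w1, w2, w3, w4, w5⟩ hε
  refine ⟨⟨(w, g), w1, hg, w2, hgl, w3, hgr⟩, ?_⟩
  have hE : energyEps H L ε (fun y => (w y, g y))
      ≤ energyZero H L a u + ENNReal.ofReal ((L / 2 + 2) * κ) := by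
    rw [energyEps_eq hH hL hε w1 hg EventuallyEq.rfl EventuallyEq.rfl, h.energyZero_eq hH ha L]
    have e1 : ENNReal.ofReal ((L / 2 + 2) * κ) = ENNReal.ofReal (L / 2) * ENNReal.ofReal κ
        + (ENNReal.ofReal κ + ENNReal.ofReal κ) := by
      rw [← ENNReal.ofReal_mul (by positivity), ← ENNReal.ofReal_add (by positivity) (by positivity),
        ← ENNReal.ofReal_add (by positivity) (by positivity)]
      congr 1; ring
    rw [e1]
    refine (add_le_add (mul_le_mul_right c5 (ENNReal.ofReal (L / 2)))
      (w4.trans (add_le_add c1 le_rfl))).trans_eq ?_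
    rw [mul_add]; ring
  have hI : ∫⁻ y, ENNReal.ofReal ((w y - (u y).1) ^ 2) ∂(intervalMeasure H)
      ≤ ENNReal.ofReal (4 * κ) := by
    calc _ ≤ ∫⁻ y, ENNReal.ofReal 2 * (ENNReal.ofReal ((w y - signOf (R y) * √(1 - g y ^ 2)) ^ 2)
          + ENNReal.ofReal ((signOf (R y) * √(1 - g y ^ 2) - (u y).1) ^ 2)) ∂(intervalMeasure H) :=
          lintegral_mono fun y => sub_sq_le_two_mul_add _ _ _
      _ ≤ ENNReal.ofReal 2 * (ENNReal.ofReal κ + ENNReal.ofReal κ) := by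
          have hm : AEMeasurable (fun y => ENNReal.ofReal
              ((w y - signOf (R y) * √(1 - g y ^ 2)) ^ 2)) (intervalMeasure H) :=
            (((w1.aemeasurable hH).sub ((measurable_signOf.comp_aemeasurable hRm).mul
              (((hg.aemeasurable hH).pow_const 2).const_sub 1).sqrt)).pow_const 2).ennreal_ofReal
          rw [lintegral_const_mul' _ _ ENNReal.ofReal_ne_top, lintegral_add_left' hm]
          gcongr
      _ = ENNReal.ofReal (4 * κ) := by
          rw [← ENNReal.ofReal_add hκ0.le hκ0.le, ← ENNReal.ofReal_mul (by norm_num)]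
          congr 1; ring
  have hsum : ENNReal.ofReal η = ENNReal.ofReal ((L / 2 + 2) * κ)
      + (ENNReal.ofReal (4 * κ) + ENNReal.ofReal κ + ENNReal.ofReal κ) := by
    rw [← ENNReal.ofReal_add (by positivity) (by positivity),
      ← ENNReal.ofReal_add (by positivity) (by positivity),
      ← ENNReal.ofReal_add (by positivity) (by positivity)]
    congr 1
    rw [hκ]; field_simp; ring
  rw [hsum]
  exact add_le_add (tsub_le_iff_left.2 hE) (add_le_add (add_le_add hI c3) c4)

/-- Existence of recovery families. -/
theorem exists_recovery_family (hH : 0 < H) (hL : 0 < L) (ha : |a| < 1) (hu : MemA0 H a u) :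
    ∃ w : ℝ → ℝ → ℝ × ℝ, (∀ ε, MemA1 H a (w ε)) ∧ HatTendsto H (𝓝[>] 0) w u ∧
      Tendsto (fun ε => energyEps H L ε (w ε)) (𝓝[>] 0) (𝓝 (energyZero H L a u)) := by
  obtain ⟨f, G, h⟩ := hu.exists_limitField hH
  obtain ⟨w, hw⟩ := exists_tendsto_zero_of_eventually
    fun η hη => h.eventually_exists_recoveryDefect_le hH hL ha hη
  have hle : ∀ {F : ℝ → ℝ≥0∞}, (∀ ε, F ε ≤ recoveryDefect L u f ε (w ε)) →
      Tendsto F (𝓝[>] 0) (𝓝 0) := fun hF =>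
    tendsto_of_tendsto_of_tendsto_of_le_of_le tendsto_const_nhds hw (fun _ => zero_le) hF
  have hmem : ∀ ε, MemA1 H a (w ε).toField := fun ε => (w ε).memA1 hH
  have hac1 := fun ε => (w ε).2.1
  have hac2 := fun ε => (w ε).2.2.1
  have s1 : StrongL2Tendsto H (𝓝[>] 0) (fun ε => (w ε).1.1) fun y => (u y).1 :=
    tendsto_strongL2_of_lintegral <| hle fun ε =>
      (le_self_add.trans le_self_add).trans le_add_self
  have s2' : StrongL2Tendsto H (𝓝[>] 0) (fun ε => (w ε).1.2) f :=
    tendsto_strongL2_of_lintegral <| hle fun ε =>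
      (le_add_self.trans le_self_add).trans le_add_self
  have s3' : StrongL2Tendsto H (𝓝[>] 0) (fun ε => deriv (w ε).1.2) (deriv f) :=
    tendsto_strongL2_of_lintegral <| hle fun ε => le_add_self.trans le_add_self
  have hcongr : ∀ {v v' : ℝ → ℝ → ℝ} {w w' : ℝ → ℝ},
      (∀ ε, v ε =ᵐ[intervalMeasure H] v' ε) → w =ᵐ[intervalMeasure H] w' →
      StrongL2Tendsto H (𝓝[>] 0) v w → StrongL2Tendsto H (𝓝[>] 0) v' w' := by
    intro v v' w w' hv hw hs
    refine Tendsto.congr (fun ε => eLpNorm_congr_ae ?_) hs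
    filter_upwards [hv ε, hw] with y h1 h2
    rw [h1, h2]
  have s2 := hcongr (fun ε => EventuallyEq.rfl) h.ae_eq s2'
  have hwd := fun ε => ((hac2 ε).weakDeriv_ae hH (EventuallyEq.refl _ (w ε).1.2))
  have s3 := hcongr (fun ε => (hwd ε).symm) h.deriv_ae s3'
  have m1 : MemLp (fun y => (u y).1) 2 (intervalMeasure H) := by
    refine MemLp.of_bound h.integrable.aestronglyMeasurable 1 ?_
    filter_upwards [hu.2.2.2.2] with y hy
    rw [Real.norm_eq_abs, ← sq_le_one_iff_abs_le_one]
    nlinarith [sq_nonneg (u y).2]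
  have hhat : HatTendsto H (𝓝[>] 0) (fun ε => (w ε).toField) u :=
    ⟨⟨weakL2Tendsto_of_strong (fun ε => (hac1 ε).memLp_self hH) m1 s1,
      weakL2Tendsto_of_strong (fun ε => (hac2 ε).memLp_self hH) hu.2.1.1 s2,
      weakL2Tendsto_of_strong (fun ε => (hmem ε).2.1.weakDeriv_spec.1)
        hu.2.1.weakDeriv_spec.1 s3⟩, s1, s2⟩
  refine ⟨fun ε => (w ε).toField, hmem, hhat, ?_⟩
  -- The defect uses truncated subtraction and so controls only the energy excess; the opposite
  -- inequality is the lower bound applied along the filter ε → 0⁺.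
  refine tendsto_of_le_liminf_of_limsup_le
    (energyZero_le_liminf hH hL ha hu self_mem_nhdsWithin hmem hhat) ?_
  have h1 : ∀ ε, energyEps H L ε (w ε).toField
      ≤ energyZero H L a u + recoveryDefect L u f ε (w ε) := fun ε =>
    tsub_le_iff_left.1 le_self_add
  have h2 : Tendsto (fun ε => energyZero H L a u + recoveryDefect L u f ε (w ε)) (𝓝[>] 0)
      (𝓝 (energyZero H L a u)) := by
    simpa using hw.const_add (energyZero H L a u)
  exact (limsup_le_limsup (Eventually.of_forall h1)).trans_eq h2.limsup_eq

end

end OneDWall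

end

theorem theorem6p2 (H L a : ℝ) (hH : 0 < H) (hL : 0 < L) (ha : |a| < 1)
    (u : ℝ → ℝ × ℝ) (hu : OneDWall.MemA0 H a u) :
    (∀ (ε : ℕ → ℝ) (v : ℕ → ℝ → ℝ × ℝ),
        (∀ n, 0 < ε n) → Tendsto ε atTop (𝓝 0) →
        (∀ n, OneDWall.MemA1 H a (v n)) → OneDWall.HatTendsto H atTop v u →
        OneDWall.energyZero H L a u
          ≤ liminf (fun n => OneDWall.energyEps H L (ε n) (v n)) atTop) ∧
    (∃ w : ℝ → ℝ → ℝ × ℝ,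
        (∀ ε, 0 < ε → OneDWall.MemA1 H a (w ε)) ∧
        OneDWall.HatTendsto H (𝓝[>] 0) w u ∧
        Tendsto (fun ε => OneDWall.energyEps H L ε (w ε)) (𝓝[>] 0)
          (𝓝 (OneDWall.energyZero H L a u))) := by
  refine ⟨fun ε v hε _ hv hvu =>
    OneDWall.energyZero_le_liminf hH hL ha hu (Eventually.of_forall hε) hv hvu, ?_⟩
  obtain ⟨w, h1, h2, h3⟩ := OneDWall.exists_recovery_family hH hL ha hu
  exact ⟨w, fun ε _ => h1 ε, h2, h3⟩
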